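/- Let $P_0,\dots,P_8$ be real symmetric $32\times 32$ matrices with $P_iP_j+P_jP_i=2\delta_{ij}I$ (a symmetric Clifford system with $m=8$, $l=16$) in the definite case, i.e. $P_0P_1\cdots P_8=\pm I$. Put $F(x)=|x|^4-2\sum_{i=0}^{8}\langle P_ix,x\rangle^2$ on $\mathbb{R}^{32}$, and let $M_+=\{x\in S^{31}: F(x)=1\}$, the focal submanifold of OT-FKM type with $(g,m_1,m_2)=(4,8,7)$. Then $M_+$ is a smooth embedded submanifold of $\mathbb{R}^{32}$ of dimension $22$. Let the Lie group $Spin(9)$ act linearly on $\mathbb{R}^{32}$ through the representation of the Clifford algebra of $\mathbb{R}^9$ in which the $i$-th standard basis vector ($0\le i\le 8$) acts by $P_i$. This action restricts to a smooth transitive action on $M_+$, and $M_+$ is $Spin(9)$-equivariantly diffeomorphic to $Spin(9)/G_2$, where $G_2$ (the automorphism group of the octonions) is realized as a subgroup of $Spin(9)$. At every $x\in M_+$, the isotropy representation of the stabilizer of $x$ on $T_xM_+$ is the direct sum of a $1$-dimensional trivial representation and three irreducible $7$-dimensional representations. Moreover, $M_+$ admits no $Spin(9)$-invariant almost complex structure,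 i.e. no almost complex structure that commutes with the differentials of all the maps $y\mapsto g\cdot y$, $g\in Spin(9)$. -/

import Mathlib

open scoped Manifold ContDiff Quaternion

noncomputable section

/-! ### The spin groups -/

/-- The standard quadratic form `v ↦ v₁² + ⋯ + vₙ²` on `ℝⁿ`. -/
abbrev stdForm (n : ℕ) : QuadraticForm ℝ (Fin n → ℝ) :=
  QuadraticMap.weightedSumSquares ℝ (fun _ : Fin n => (1 : ℝ))

/-- The compact group `Spin(n)`, inside the Clifford algebra of the standard form on `ℝⁿ`. -/
abbrev Spin (n : ℕ) : Type := spinGroup (stdForm n)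

/-- The canonical topology of the (finite-dimensional) real vector space `Cl(ℝⁿ)`. The topology
of `Spin n` is the subspace topology. -/
instance cliffordTopology (n : ℕ) : TopologicalSpace (CliffordAlgebra (stdForm n)) :=
  moduleTopology ℝ (CliffordAlgebra (stdForm n))

/-! ### The exceptional group `G₂` -/

/-- The underlying normed space of the octonions: pairs of quaternions. -/
abbrev Octonions : Type := ℍ[ℝ] × ℍ[ℝ]

/-- Octonion multiplication, by the Cayley–Dickson formula `(a, b)(c, d) = (ac - d̄b, da + bc̄)`. -/
def octMul (x y : Octonions) : Octonions :=
  (x.1 * y.1 - star y.2 * x.2, y.2 * x.1 + x.2 * star y.1)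

/-- The compact group `G₂`: all automorphisms of the algebra of octonions, with the
topology of the group of invertible linear maps. -/
def G2 : Subgroup (Octonions →L[ℝ] Octonions)ˣ where
  carrier := {u | ∀ x y : Octonions, u.val (octMul x y) = octMul (u.val x) (u.val y)}
  mul_mem' := by
    intro a b ha hb x y
    have h1 := hb x y
    have h2 := ha (b.val x) (b.val y)
    simp only [Units.val_mul, mul_apply_eq_comp] at *
    rw [h1, h2]
  one_mem' := by
    intro x y
    simp
  inv_mem' := by
    intro a ha x y
    have key : ∀ z, a⁻¹.val (a.val z) = z := fun z => by
      have h : (a⁻¹.val * a.val) z = z := by simp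
      simpa only [mul_apply_eq_comp] using h
    have key' : ∀ z, a.val (a⁻¹.val z) = z := fun z => by
      have h : (a.val * a⁻¹.val) z = z := by simp
      simpa only [mul_apply_eq_comp] using h
    have h := ha (a⁻¹.val x) (a⁻¹.val y)
    rw [key', key'] at h
    rw [← h, key]

/-! ### Symmetric Clifford systems and focal submanifolds of OT-FKM type -/

/-- A symmetric Clifford system `P₀, …, Pₘ` on `ℝ^{2l}`. -/
structure SymmetricCliffordSystem (m l : ℕ) where
  /-- The matrices `P₀, …, Pₘ`. -/
  P : Fin (m + 1) → Matrix (Fin (2 * l)) (Fin (2 * l)) ℝ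
  symm : ∀ i, (P i).transpose = P i
  anticomm : ∀ i j, P i * P j + P j * P i = if i = j then 2 else 0

namespace SymmetricCliffordSystem

variable {m l : ℕ} (C : SymmetricCliffordSystem m l)

/-- The definite case: `P₀ P₁ ⋯ Pₘ = ± I`. -/
def IsDefinite : Prop :=
  (List.ofFn C.P).prod = 1 ∨ (List.ofFn C.P).prod = -1

/-- The linear operator on `ℝ^{2l}` given by a matrix. -/
abbrev op (A : Matrix (Fin (2 * l)) (Fin (2 * l)) ℝ) :
    EuclideanSpace ℝ (Fin (2 * l)) →L[ℝ] EuclideanSpace ℝ (Fin (2 * l)) :=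
  Matrix.toEuclideanCLM (n := Fin (2 * l)) (𝕜 := ℝ) A

/-- The OT-FKM polynomial `F(x) = |x|⁴ - 2 ∑ᵢ ⟨Pᵢ x, x⟩²`. -/
def fkmPoly (x : EuclideanSpace ℝ (Fin (2 * l))) : ℝ :=
  ‖x‖ ^ 4 - 2 * ∑ i, inner ℝ (op (C.P i) x) x ^ 2

/-- The focal submanifold `M₊ = f⁻¹(1)`, where `f` is the restriction of `F` to the unit sphere. -/
def focalPlus : Set (EuclideanSpace ℝ (Fin (2 * l))) :=
  {x | ‖x‖ = 1 ∧ C.fkmPoly x = 1}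

theorem mem_focalPlus_iff (x : EuclideanSpace ℝ (Fin (2 * l))) :
    x ∈ C.focalPlus ↔ ‖x‖ = 1 ∧ ∀ i, inner ℝ (op (C.P i) x) x = 0 := by
  unfold focalPlus fkmPoly
  simp only [Set.mem_ofPred_eq]
  refine and_congr_right fun hx => ?_
  rw [hx]
  constructor
  · intro h i
    have h0 : ∑ i, inner ℝ (op (C.P i) x) x ^ 2 = 0 := by linarith
    rw [Finset.sum_eq_zero_iff_of_nonneg (fun i _ => sq_nonneg _)] at h0
    exact pow_eq_zero_iff (two_ne_zero) |>.1 (h0 i (Finset.mem_univ i))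
  · intro h
    simp [h]

/-- The linear map `v ↦ ∑ᵢ vᵢ Pᵢ`. -/
def vec : (Fin (m + 1) → ℝ) →ₗ[ℝ] Matrix (Fin (2 * l)) (Fin (2 * l)) ℝ :=
  Fintype.linearCombination ℝ C.P

theorem vec_apply (v : Fin (m + 1) → ℝ) : C.vec v = ∑ i, v i • C.P i := by
  simp [vec, Fintype.linearCombination_apply]

theorem vec_mul_self (v : Fin (m + 1) → ℝ) :
    C.vec v * C.vec v = algebraMap ℝ _ (stdForm (m + 1) v) := by
  have h1 : C.vec v * C.vec v = ∑ i, ∑ j, (v i * v j) • (C.P i * C.P j) := by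
    simp only [vec_apply, Finset.sum_mul_sum, smul_mul_smul_comm]
  have h2 : C.vec v * C.vec v = ∑ i, ∑ j, (v i * v j) • (C.P j * C.P i) := by
    rw [h1, Finset.sum_comm]
    simp only [mul_comm (v _) (v _)]
  have h3 : (2 : ℝ) • (C.vec v * C.vec v) =
      (2 : ℝ) • algebraMap ℝ _ (stdForm (m + 1) v) := by
    rw [two_smul]
    nth_rewrite 1 [h1]
    rw [h2]
    simp only [← Finset.sum_add_distrib, ← smul_add, C.anticomm]
    simp only [smul_ite, smul_zero, Finset.sum_ite_eq, Finset.mem_univ, if_true,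
      QuadraticMap.weightedSumSquares_apply, one_smul, Algebra.algebraMap_eq_smul_one,
      Finset.sum_smul, Finset.smul_sum]
    refine Finset.sum_congr rfl fun i _ => ?_
    rw [smul_comm, two_smul, one_add_one_eq_two]
  exact smul_right_injective _ (two_ne_zero (α := ℝ)) h3

/-- The representation of the Clifford algebra of `ℝ^{m+1}` on `ℝ^{2l}` determined by the system:
the `i`-th standard basis vector acts by `Pᵢ`. -/
def rep : CliffordAlgebra (stdForm (m + 1)) →ₐ[ℝ] Matrix (Fin (2 * l)) (Fin (2 * l)) ℝ :=
  CliffordAlgebra.lift (stdForm (m + 1)) ⟨C.vec, C.vec_mul_self⟩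

theorem rep_ι (v : Fin (m + 1) → ℝ) :
    C.rep (CliffordAlgebra.ι (stdForm (m + 1)) v) = C.vec v := by
  simp [rep]

theorem rep_reverse (a : CliffordAlgebra (stdForm (m + 1))) :
    C.rep (CliffordAlgebra.reverse a) = (C.rep a).transpose := by
  induction a using CliffordAlgebra.induction with
  | algebraMap r =>
    simp [Matrix.algebraMap_eq_diagonal]
  | ι v =>
    rw [CliffordAlgebra.reverse_ι, rep_ι, vec_apply]
    simp [Matrix.transpose_sum, C.symm]
  | mul a b ha hb => rw [CliffordAlgebra.reverse.map_mul, map_mul, map_mul, ha, hb,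
      Matrix.transpose_mul]
  | add a b ha hb => rw [map_add, map_add, map_add, ha, hb, Matrix.transpose_add]

theorem rep_star (g : Spin (m + 1)) :
    C.rep (star (g : CliffordAlgebra (stdForm (m + 1)))) = star (C.rep g) := by
  rw [CliffordAlgebra.star_def, spinGroup.involute_eq g.2, rep_reverse,
    Matrix.star_eq_conjTranspose, Matrix.conjTranspose_eq_transpose_of_trivial]

theorem inner_op_rep (g : Spin (m + 1)) (x y : EuclideanSpace ℝ (Fin (2 * l))) :
    inner ℝ x (op (C.rep g) y) = inner ℝ (op (C.rep (star (g : CliffordAlgebra _))) x) y := by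
  rw [rep_star]
  unfold op
  rw [map_star, ContinuousLinearMap.star_eq_adjoint, ContinuousLinearMap.adjoint_inner_left]

theorem op_rep_mem (g : Spin (m + 1)) {x : EuclideanSpace ℝ (Fin (2 * l))}
    (hx : x ∈ C.focalPlus) : op (C.rep g) x ∈ C.focalPlus := by
  rw [mem_focalPlus_iff] at hx ⊢
  obtain ⟨hx1, hx2⟩ := hx
  have hop : ∀ A B z, op (l := l) A (op B z) = op (A * B) z := fun A B z => by
    unfold op
    rw [map_mul]
    rfl
  refine ⟨?_, fun i => ?_⟩
  · have h : inner ℝ (op (C.rep g) x) (op (C.rep g) x) = inner ℝ x x := by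
      rw [inner_op_rep, hop, ← map_mul, spinGroup.coe_star_mul_self, map_one]
      unfold op
      rw [map_one]
      rfl
    rw [real_inner_self_eq_norm_sq, real_inner_self_eq_norm_sq, hx1] at h
    nlinarith [norm_nonneg (op (C.rep g) x)]
  · have hP : C.P i = C.rep (CliffordAlgebra.ι (stdForm (m + 1)) (Pi.single i 1)) := by
      rw [rep_ι, vec_apply]
      simp [Pi.single_apply]
    have hmem := spinGroup.conjAct_smul_ι_mem_range_ι
      (x := spinGroup.toUnits g⁻¹) (g⁻¹).2 (Pi.single i (1 : ℝ))
    obtain ⟨w, hw⟩ := hmem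
    rw [ConjAct.units_smul_def, ConjAct.ofConjAct_toConjAct, ← map_inv, inv_inv] at hw
    have hw' : CliffordAlgebra.ι (stdForm (m + 1)) w =
        star (g : CliffordAlgebra (stdForm (m + 1))) *
          CliffordAlgebra.ι (stdForm (m + 1)) (Pi.single i 1) * g := hw
    rw [inner_op_rep, hop, hop, hP, ← map_mul, ← map_mul, ← hw', rep_ι, vec_apply]
    unfold op at hx2 ⊢
    simp only [map_sum, map_smul, sum_apply, smul_apply,
      sum_inner, real_inner_smul_left, hx2, mul_zero, Finset.sum_const_zero]

/-- The action of `Spin(m+1)` on `M₊`: the restriction of the linear action of `Spin(m+1)` on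
`ℝ^{2l}` given by the representation `rep` of the Clifford algebra. -/
instance : MulAction (Spin (m + 1)) C.focalPlus where
  smul g x := ⟨op (C.rep g) x, C.op_rep_mem g x.2⟩
  one_smul x := Subtype.ext <| by
    change op (C.rep 1) (x : EuclideanSpace ℝ (Fin (2 * l))) = x
    unfold op
    rw [map_one, map_one]
    rfl
  mul_smul g h x := Subtype.ext <| by
    change op (C.rep (g * h)) (x : EuclideanSpace ℝ (Fin (2 * l))) =
      op (C.rep g) (op (C.rep h) x)
    unfold op
    rw [map_mul, map_mul]
    rfl

end SymmetricCliffordSystem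

/-! ### Almost complex structures and the isotropy representation -/

section Manifold

variable {E : Type*} [NormedAddCommGroup E] [NormedSpace ℝ E]
  {H : Type*} [TopologicalSpace H] (I : ModelWithCorners ℝ E H)
  (M : Type*) [TopologicalSpace M] [ChartedSpace H M]

/-- An almost complex structure on a smooth manifold: a smooth section `J` of the bundle `End(TM)`
with `J² = -id`. -/
structure AlmostComplexStructure [IsManifold I ∞ M] where
  /-- The endomorphism of each tangent space. -/
  J : ∀ x : M, TangentSpace I x →L[ℝ] TangentSpace I x
  smooth : ContMDiff I (I.prod 𝓘(ℝ, E →L[ℝ] E)) ∞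
    (fun x => Bundle.TotalSpace.mk' (E →L[ℝ] E)
      (E := fun y : M => TangentSpace I y →L[ℝ] TangentSpace I y) x (J x))
  sq : ∀ (x : M) (v : TangentSpace I x), J x (J x v) = -v

variable {M}

/-- Invariance of an almost complex structure under an action of `G`: it commutes with the
differentials of all translations `τ_g`. -/
def AlmostComplexStructure.IsInvariant [IsManifold I ∞ M] (J : AlmostComplexStructure I M)
    (G : Type*) [Group G] [MulAction G M] : Prop :=
  ∀ (g : G) (x : M) (v : TangentSpace I x),
    J.J (g • x) (mfderiv I I (fun y : M => g • y) x v) =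
      mfderiv I I (fun y : M => g • y) x (J.J x v)

variable (G : Type*) [Group G] [MulAction G M]

/-- The isotropy representation at `x`: an element `g` of the isotropy group of `x` acts
on `T_x M` by the differential of `y ↦ g • y` at `x`. -/
def isotropyRep (x : M) (g : MulAction.stabilizer G x) :
    TangentSpace I x →L[ℝ] TangentSpace I x :=
  have h : (TangentSpace I x →L[ℝ] TangentSpace I ((g : G) • x)) =
      (TangentSpace I x →L[ℝ] TangentSpace I x) := by
    rw [show (g : G) • x = x from g.2]
  cast h (mfderiv I I (fun y : M => (g : G) • y) x)

/-- A subspace of `T_x M` is invariant under the isotropy representation. -/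
def IsIsotropyInvariant (x : M) (U : Submodule ℝ (TangentSpace I x)) : Prop :=
  ∀ g : MulAction.stabilizer G x, ∀ v ∈ U, isotropyRep I G x g v ∈ U

/-- A nonzero invariant subspace of `T_x M` with no invariant subspaces but `0` and itself. -/
def IsIsotropyIrreducible (x : M) (W : Submodule ℝ (TangentSpace I x)) : Prop :=
  IsIsotropyInvariant I G x W ∧ W ≠ ⊥ ∧
    ∀ U ≤ W, IsIsotropyInvariant I G x U → U = ⊥ ∨ U = W

end Manifold

end

/-! Octonions make the whole configuration explicit. Write `r 0, …, r 7` for P₁, …, P₈. Four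
commuting involutions, each a product of four of the `r i`, have a common fixed vector s. The
relations they impose at s encode the multiplication table of 𝕆, so s generates a module 𝕆² on which
(t, w) ∈ ℝ ⊕ 𝕆 acts by (x₁, x₂) ↦ (t x₁ + w̄ x₂, w x₁ - t x₂). Definiteness fixes the action of P₀
on s up to one global sign. Doing this in ℝ³² and again in the orthogonal complement of the first
module gives ℝ³² = 𝕆² ⊕ 𝕆², two copies of the same spin representation (`exists_spinorModel`).

In this model M₊ consists of the pairs (x, y) with |x|² + |y|² = 1 and q(x) + q(y) = 0, where q is
`spinorSq` and |q(x)| = |x|². Hence |x|² = |y|² = 1/2. Spin(9) is transitive on the unit sphere of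
𝕆², so x moves to a multiple of (1, 0); then y lies in 0 ⊕ 𝕆, and the stabilizer of (1, 0) is
transitive on the unit sphere there. So M₊ is one orbit. An element fixing (1, 0) and (0, 1) acts
diagonally by an automorphism of 𝕆 (`spinRep_apply_of_fixing`). Conversely an automorphism acting
diagonally normalizes the Clifford vectors, so by generation of isometries by reflections and a
Schur argument it agrees up to sign with an element of Spin(9) (`exists_spinRep_eq_diag`). The
stabilizer is therefore G₂; injectivity comes from faithfulness of the representation on the even
Clifford algebra (`eq_zero_of_rep_eq_zero`).

Smooth structures come from `hasSliceAt_of_ker_le_range`: a set squeezed between a smooth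
parametrization and smooth equations is a submanifold near a point where the kernel of the
differential of the equations lies in the image of the differential of the parametrization. It is
applied to Spin(9) inside End(ℝ³²) at 1, with products of plane rotations as parametrization and the
span of the PᵢPⱼ as tangent space, and to M₊ at a base point, with the orbit map as parametrization.
Homogeneity carries both slices to all other points.

At the base point the tangent space is Im 𝕆 ⊕ 𝕆 ⊕ Im 𝕆 with G₂ acting naturally on each summand.
Conjugations by sixth roots of unity are automorphisms that rotate planes by 2π/3, which shows that
Im 𝕆 is irreducible without nonzero fixed vectors. So the fixed vectors of the isotropy
representation form a line. An invariant J would preserve this line and act on it by a real c with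
c² = -1. -/

noncomputable section

/-! ### Embedded submanifolds from slice charts -/

section SliceCharts

open Set Filter Topology

variable {E : Type*} [NormedAddCommGroup E] [NormedSpace ℝ E]
  {F : Type*} [NormedAddCommGroup F] [NormedSpace ℝ F]
  {B : Type*} [NormedAddCommGroup B] [NormedSpace ℝ B]

/-- The smooth inverse function theorem, with an inverse that is smooth on its whole domain. -/
theorem exists_openPartialHomeomorph_of_contDiffOn [CompleteSpace E] {f : E → F} {U : Set E}
    (hU : IsOpen U) (hf : ContDiffOn ℝ ∞ f U) {p : E} (hp : p ∈ U) (e : E ≃L[ℝ] F)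
    (he : HasFDerivAt f (e : E →L[ℝ] F) p) :
    ∃ ψ : OpenPartialHomeomorph E F, p ∈ ψ.source ∧ ψ.source ⊆ U ∧ (ψ : E → F) = f ∧
      ContDiffOn ℝ ∞ ψ.symm ψ.target := by
  have hfp : ContDiffAt ℝ ∞ f p := hf.contDiffAt (hU.mem_nhds hp)
  set ψ₀ := hfp.toOpenPartialHomeomorph f he (by simp) with hψ₀
  have hcont : ContinuousOn (fderiv ℝ f) U := hf.continuousOn_fderiv_of_isOpen hU (by simp)
  have hInv : IsOpen (range ((↑) : (E ≃L[ℝ] F) → E →L[ℝ] F)) := ContinuousLinearEquiv.isOpen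
  -- Restricting to the points of `U` where the derivative is invertible makes the inverse smooth on
  -- all of its domain, not only at `f p`.
  have hV : IsOpen (U ∩ fderiv ℝ f ⁻¹' range ((↑) : (E ≃L[ℝ] F) → E →L[ℝ] F)) :=
    hcont.isOpen_inter_preimage hU hInv
  refine ⟨ψ₀.restrOpen _ hV, ?_, ?_, ?_, ?_⟩
  · rw [OpenPartialHomeomorph.restrOpen_source]
    exact ⟨hfp.mem_toOpenPartialHomeomorph_source he (by simp), hp, e, he.fderiv.symm⟩
  · rw [OpenPartialHomeomorph.restrOpen_source]
    exact fun x hx => hx.2.1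
  · rfl
  · intro y hy
    refine ContDiffAt.contDiffWithinAt ?_
    have hx := (ψ₀.restrOpen _ hV).map_target hy
    rw [OpenPartialHomeomorph.restrOpen_source] at hx
    obtain ⟨-, hxU, e', he'⟩ := hx
    have hd : ContDiffAt ℝ ∞ f ((ψ₀.restrOpen _ hV).symm y) := hf.contDiffAt (hU.mem_nhds hxU)
    refine (ψ₀.restrOpen _ hV).contDiffAt_symm (f₀' := e') hy ?_ hd
    rw [he']
    exact (hd.differentiableAt (by simp)).hasFDerivAt

/-- A chart of `E` with values in a product `F × B` that straightens `S` to `F × 0`. -/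
structure IsSliceChart (S : Set E) (ψ : OpenPartialHomeomorph E (F × B)) : Prop where
  contDiffOn : ContDiffOn ℝ ∞ ψ ψ.source
  contDiffOn_symm : ContDiffOn ℝ ∞ ψ.symm ψ.target
  snd_eq_zero : ∀ y ∈ S, y ∈ ψ.source → (ψ y).2 = 0
  symm_mem : ∀ u : F, (u, (0 : B)) ∈ ψ.target → ψ.symm (u, 0) ∈ S

variable (F B) in
/-- `S` admits a slice chart around `p`. -/
def HasSliceAt (S : Set E) (p : E) : Prop :=
  ∃ ψ : OpenPartialHomeomorph E (F × B), p ∈ ψ.source ∧ IsSliceChart S ψ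

/-- For an orbit of a linear action this reduces slices at all points to a slice at one point. -/
theorem HasSliceAt.image {S : Set E} {p : E} (h : HasSliceAt F B S p) (A : E ≃L[ℝ] E)
    (hA : ∀ y, A y ∈ S ↔ y ∈ S) : HasSliceAt F B S (A p) := by
  obtain ⟨ψ, hp, hψ⟩ := h
  refine ⟨A.symm.toHomeomorph.toOpenPartialHomeomorph.trans ψ, ?_, ?_, ?_, ?_, ?_⟩
  · simpa using hp
  · refine hψ.contDiffOn.comp A.symm.contDiff.contDiffOn fun y hy => ?_
    simpa using hy
  · refine A.contDiff.comp_contDiffOn (hψ.contDiffOn_symm.mono fun y hy => ?_)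
    simpa using hy
  · intro y hy hys
    refine hψ.snd_eq_zero (A.symm y) ?_ ?_
    · rw [← hA]; simpa using hy
    · simpa using hys
  · intro u hu
    have := hψ.symm_mem u (by simpa using hu)
    rw [← hA] at this
    simpa using this

/-- A set that contains the image of a smooth map `σ` and on which a smooth map `Z` vanishes is
a submanifold near `σ 0` as soon as the kernel of `dZ` is contained in the image of `dσ`. -/
theorem hasSliceAt_of_ker_le_range {N B' : Type*} [NormedAddCommGroup N] [NormedSpace ℝ N]
    [FiniteDimensional ℝ N] [NormedAddCommGroup B'] [NormedSpace ℝ B']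
    [FiniteDimensional ℝ B'] [FiniteDimensional ℝ E]
    {S : Set E} {p : E} {σ : N → E} {Z : E → B'} (hσ : ContDiff ℝ ∞ σ) (hσp : σ 0 = p)
    (hσS : ∀ t, σ t ∈ S) (hZ : ContDiff ℝ ∞ Z) (hZS : ∀ y ∈ S, Z y = 0)
    {dσ : N →L[ℝ] E} (hdσ : HasFDerivAt σ dσ 0) {dZ : E →L[ℝ] B'} (hdZ : HasFDerivAt Z dZ p)
    (hle : dZ.ker ≤ dσ.range) (e : E ≃L[ℝ] F × B) (he : ∀ y, (e y).2 = 0 ↔ dZ y = 0) :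
    HasSliceAt F B S p := by
  -- A generalized inverse `g` of `dZ`: then `id - g ∘ dZ` is a projection of `E` onto the kernel of
  -- `dZ`.
  obtain ⟨g, hg⟩ : ∃ g : B' →L[ℝ] E, ∀ y, dZ (g (dZ y)) = dZ y := by
    obtain ⟨g₀, hg₀⟩ := (dZ : E →ₗ[ℝ] B').rangeRestrict.exists_rightInverse_of_surjective
      (LinearMap.range_rangeRestrict _)
    obtain ⟨g₁, hg₁⟩ := g₀.exists_extend
    refine ⟨LinearMap.toContinuousLinearMap g₁, fun y => ?_⟩
    have h1 : g₁ (dZ y) = g₀ ((dZ : E →ₗ[ℝ] B').rangeRestrict y) :=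
      LinearMap.congr_fun hg₁ ((dZ : E →ₗ[ℝ] B').rangeRestrict y)
    have h2 := congrArg Subtype.val (LinearMap.congr_fun hg₀ ((dZ : E →ₗ[ℝ] B').rangeRestrict y))
    simp only [LinearMap.coe_toContinuousLinearMap', h1]
    exact h2
  let P : E →L[ℝ] E := ContinuousLinearMap.id ℝ E - g.comp dZ
  have hPK : ∀ y, P y ∈ dZ.ker := fun y => by simp [P, hg]
  have hKP : ∀ y ∈ dZ.ker, P y = y := fun y hy => by
    have : dZ y = 0 := hy
    simp [P, this]
  let PK : E →L[ℝ] dZ.ker := P.codRestrict dZ.ker hPK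
  have hpS : p ∈ S := hσp ▸ hσS 0
  -- `Θ` has derivative the identity at `p`, and it sends `S` into the kernel of `dZ` because its
  -- second term vanishes on `S`.
  let Θ : E → E := fun y => P (y - p) + g (Z y)
  have hΘ : ContDiff ℝ ∞ Θ := by fun_prop
  have hΘp : HasFDerivAt Θ ((ContinuousLinearEquiv.refl ℝ E : E ≃L[ℝ] E) : E →L[ℝ] E) p := by
    have h1 : HasFDerivAt (fun y => P (y - p)) P p :=
      P.hasFDerivAt.comp p ((hasFDerivAt_id p).sub_const p)
    have h2 : HasFDerivAt (fun y => g (Z y)) (g.comp dZ) p := g.hasFDerivAt.comp p hdZ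
    have h3 : ((ContinuousLinearEquiv.refl ℝ E : E ≃L[ℝ] E) : E →L[ℝ] E) = P + g.comp dZ := by
      ext y
      simp [P]
    rw [h3]
    exact h1.add h2
  obtain ⟨ψ, hpψ, -, hψ, hψs⟩ := exists_openPartialHomeomorph_of_contDiffOn isOpen_univ
    hΘ.contDiffOn (mem_univ p) _ hΘp
  have hΘS : ∀ y ∈ S, Θ y = P (y - p) := fun y hy => by simp [Θ, hZS y hy]
  have hσc : ContinuousAt σ 0 := hσ.continuous.continuousAt
  have hnear : ∀ᶠ t in 𝓝 (0 : N), σ t ∈ ψ.source :=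
    hσc (ψ.open_source.mem_nhds (by rwa [hσp]))
  have hτ : HasStrictFDerivAt (fun t => PK (σ t - p)) (PK.comp dσ) 0 :=
    PK.hasStrictFDerivAt.comp 0
      ((hσ.contDiffAt.hasStrictFDerivAt' hdσ (by simp)).sub_const p)
  -- Since the image of `dσ` contains the kernel, `t ↦ P (σ t - p)` is a submersion onto the kernel
  -- at 0. So every small vector of the kernel is `Θ (σ t)` with `σ t ∈ S`.
  have hmap := hτ.map_nhds_eq_of_surj (LinearMap.range_eq_top.2 fun k => by
    obtain ⟨t, ht⟩ := hle k.2
    refine ⟨t, Subtype.ext ?_⟩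
    have ht' : dσ t = k := ht
    simp only [ContinuousLinearMap.coe_coe, ContinuousLinearMap.comp_apply, ht']
    exact hKP _ k.2)
  rw [hσp, sub_self, map_zero] at hmap
  have himg : (fun t => PK (σ t - p)) '' {t | σ t ∈ ψ.source} ∈ 𝓝 (0 : dZ.ker) := by
    rw [← hmap]
    exact image_mem_map hnear
  obtain ⟨W, hWsub, hWo, hW0⟩ := mem_nhds_iff.1 himg
  -- The target is cut down so that its points in the kernel are all reached by `Θ ∘ σ`; their
  -- preimages then lie in `S`.
  let ψ₁ := (ψ.symm.restrOpen (PK ⁻¹' W) (hWo.preimage PK.continuous)).symm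
  have htgt : ψ₁.target = ψ.target ∩ PK ⁻¹' W := by
    simp [ψ₁, OpenPartialHomeomorph.restrOpen]
  refine ⟨ψ₁.trans e.toHomeomorph.toOpenPartialHomeomorph, ?_, ?_, ?_, ?_, ?_⟩
  · have : ψ p ∈ ψ₁.target := by
      rw [htgt]
      refine ⟨ψ.map_source hpψ, ?_⟩
      rw [hψ, mem_preimage, hΘS p hpS]
      simpa using hW0
    have h2 := ψ₁.map_target this
    have h3 : ψ₁.symm (ψ p) = p := ψ.left_inv hpψ
    rw [h3] at h2
    simpa using h2
  · refine e.contDiff.comp_contDiffOn ?_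
    refine ContDiffOn.congr (f := Θ) hΘ.contDiffOn fun y _ => ?_
    rw [← hψ]
    rfl
  · refine ContDiffOn.comp (hψs.mono ?_) e.symm.contDiff.contDiffOn (t := ψ₁.target) fun y hy => ?_
    · rw [htgt]
      exact inter_subset_left
    · simpa using hy
  · intro y hy _
    change (e (ψ y)).2 = 0
    rw [he, hψ, hΘS y hy]
    exact hPK _
  · intro u hu
    have hk : e.symm (u, 0) ∈ ψ₁.target := by simpa using hu
    have hkK : e.symm (u, 0) ∈ dZ.ker := by
      have := (he (e.symm (u, 0))).1 (by simp)
      exact this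
    rw [htgt] at hk
    obtain ⟨t, ht, htk⟩ := hWsub hk.2
    have h1 : P (σ t - p) = e.symm (u, 0) := by
      have := congrArg Subtype.val htk
      exact this.trans (hKP _ hkK)
    change ψ.symm (e.symm (u, 0)) ∈ S
    rw [← h1, ← hΘS _ (hσS t), ← hψ, ψ.left_inv ht]
    exact hσS t

end SliceCharts

/-! ### Manifold structure induced by an embedding with slice charts -/

section SliceManifold

open Set Filter Topology

variable {E : Type*} [NormedAddCommGroup E] [NormedSpace ℝ E]
  {F : Type*} [NormedAddCommGroup F] [NormedSpace ℝ F]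
  {B : Type*} [NormedAddCommGroup B] [NormedSpace ℝ B]
  {X : Type*} [TopologicalSpace X] {j : X → E}

/-- The chart of `X` obtained from a slice chart of the image of an embedding `j : X → E`. -/
def sliceChart (hj : IsEmbedding j) (ψ : OpenPartialHomeomorph E (F × B))
    (hψ : IsSliceChart (range j) ψ) (x₀ : X) : OpenPartialHomeomorph X F :=
  haveI : Nonempty X := ⟨x₀⟩
  have key : ∀ u, (u, (0 : B)) ∈ ψ.target → j (Function.invFun j (ψ.symm (u, 0))) = ψ.symm (u, 0) :=
    fun u hu => Function.invFun_eq (hψ.symm_mem u hu)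
  have hfst : ∀ x, j x ∈ ψ.source → ((ψ (j x)).1, (0 : B)) = ψ (j x) := fun x hx =>
    Prod.ext rfl (hψ.snd_eq_zero _ (mem_range_self x) hx).symm
  { toFun := fun x => (ψ (j x)).1
    invFun := fun u => Function.invFun j (ψ.symm (u, 0))
    source := j ⁻¹' ψ.source
    target := (fun u => (u, (0 : B))) ⁻¹' ψ.target
    map_source' := fun x hx => by
      rw [mem_preimage, hfst x hx]
      exact ψ.map_source hx
    map_target' := fun u hu => by
      rw [mem_preimage, key u hu]
      exact ψ.map_target hu
    left_inv' := fun x hx => by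
      rw [hfst x hx, ψ.left_inv hx]
      exact Function.leftInverse_invFun hj.injective x
    right_inv' := fun u hu => by
      rw [key u hu, ψ.right_inv hu]
    open_source := ψ.open_source.preimage hj.continuous
    open_target := ψ.open_target.preimage (by fun_prop)
    continuousOn_toFun := continuous_fst.comp_continuousOn
      (ψ.continuousOn.comp hj.continuous.continuousOn fun _ hx => hx)
    continuousOn_invFun := by
      rw [hj.continuousOn_iff]
      refine ContinuousOn.congr (f := fun u => ψ.symm (u, 0)) ?_ fun u hu => key u hu
      exact ψ.continuousOn_symm.comp (by fun_prop) fun _ hu => hu }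

theorem apply_sliceChart_symm (hj : IsEmbedding j) (ψ : OpenPartialHomeomorph E (F × B))
    (hψ : IsSliceChart (range j) ψ) (x₀ : X) {u : F} (hu : (u, (0 : B)) ∈ ψ.target) :
    j ((sliceChart hj ψ hψ x₀).symm u) = ψ.symm (u, 0) :=
  haveI : Nonempty X := ⟨x₀⟩
  Function.invFun_eq (hψ.symm_mem u hu)

variable (F B) in
/-- An embedding of a space into a vector space whose image has slice charts everywhere. -/
structure IsSliceEmbedding (j : X → E) : Prop where
  isEmbedding : IsEmbedding j
  hasSliceAt : ∀ x, HasSliceAt F B (range j) (j x)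

namespace IsSliceEmbedding

variable (h : IsSliceEmbedding F B j)
include h

/-- The slice chart at a point. -/
def slice (x : X) : OpenPartialHomeomorph E (F × B) := (h.hasSliceAt x).choose

theorem mem_slice_source (x : X) : j x ∈ (h.slice x).source := (h.hasSliceAt x).choose_spec.1

theorem isSliceChart (x : X) : IsSliceChart (range j) (h.slice x) :=
  (h.hasSliceAt x).choose_spec.2

/-- The chart at a point. -/
def chart (x : X) : OpenPartialHomeomorph X F :=
  sliceChart h.isEmbedding (h.slice x) (h.isSliceChart x) x

/-- The manifold structure on a space embedded with slice charts. -/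
@[reducible] def chartedSpace : ChartedSpace F X where
  atlas := range h.chart
  chartAt := h.chart
  mem_chart_source x := h.mem_slice_source x
  chart_mem_atlas x := mem_range_self x

theorem isManifold :
    letI := h.chartedSpace
    IsManifold 𝓘(ℝ, F) ∞ X := by
  let _ := h.chartedSpace
  refine isManifold_of_contDiffOn 𝓘(ℝ, F) ∞ X ?_
  rintro _ _ ⟨x, rfl⟩ ⟨y, rfl⟩
  simp only [modelWithCornersSelf_coe, modelWithCornersSelf_coe_symm, Function.comp_id,
    Function.id_comp, preimage_id, range_id, inter_univ]
  intro u hu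
  rw [OpenPartialHomeomorph.trans_source] at hu
  obtain ⟨hu1, hu2⟩ := hu
  have hu1' : (u, (0 : B)) ∈ (h.slice x).target := hu1
  have hjy : j ((h.chart x).symm u) = (h.slice x).symm (u, 0) :=
    apply_sliceChart_symm h.isEmbedding (h.slice x) (h.isSliceChart x) x hu1'
  have hu2' : (h.slice x).symm (u, 0) ∈ (h.slice y).source := by
    rw [← hjy]
    exact hu2
  have hc : ContDiffAt ℝ ∞ (fun u : F => (h.slice y ((h.slice x).symm (u, 0))).1) u := by
    have h1 : ContDiffAt ℝ ∞ (h.slice x).symm (u, 0) :=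
      (h.isSliceChart x).contDiffOn_symm.contDiffAt ((h.slice x).open_target.mem_nhds hu1')
    have h2 : ContDiffAt ℝ ∞ (h.slice y) ((h.slice x).symm (u, 0)) :=
      (h.isSliceChart y).contDiffOn.contDiffAt ((h.slice y).open_source.mem_nhds hu2')
    have h3 : ContDiffAt ℝ ∞ (fun u : F => (u, (0 : B))) u := by fun_prop
    exact contDiff_fst.contDiffAt.comp u (h2.comp u (h1.comp u h3))
  refine (hc.congr_of_eventuallyEq ?_).contDiffWithinAt
  filter_upwards [(h.chart x).open_target.mem_nhds hu1] with v hv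
  change (h.slice y (j ((h.chart x).symm v))).1 = _
  rw [show j ((h.chart x).symm v) = _ from
    apply_sliceChart_symm h.isEmbedding (h.slice x) (h.isSliceChart x) x hv]

/-- Read in a slice chart followed by `e`, the map `j` is `u ↦ e (u, 0)`, the normal form of an
immersion. -/
theorem isImmersionOfComplement (e : (F × B) ≃L[ℝ] E) :
    letI := h.chartedSpace
    Manifold.IsImmersionOfComplement B 𝓘(ℝ, F) 𝓘(ℝ, E) ∞ j := by
  let _ := h.chartedSpace
  have := h.isManifold
  intro x
  let θ : OpenPartialHomeomorph E E := (h.slice x).trans e.toHomeomorph.toOpenPartialHomeomorph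
  have hθs : θ.source = (h.slice x).source := by simp [θ]
  have hθ : θ ∈ IsManifold.maximalAtlas 𝓘(ℝ, E) ∞ E := by
    rw [IsManifold.mem_maximalAtlas_iff]
    refine StructureGroupoid.mem_maximalAtlas_of_mem_groupoid _ ?_
    rw [contDiffGroupoid, mem_groupoid_of_pregroupoid]
    simp only [contDiffPregroupoid, modelWithCornersSelf_coe, modelWithCornersSelf_coe_symm,
      Function.comp_id, Function.id_comp, preimage_id, range_id, inter_univ]
    refine ⟨?_, ?_⟩
    · refine e.contDiff.comp_contDiffOn ((h.isSliceChart x).contDiffOn.mono hθs.le)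
    · refine (h.isSliceChart x).contDiffOn_symm.comp e.symm.contDiff.contDiffOn fun y hy => ?_
      simpa [θ] using hy
  refine Manifold.IsImmersionAtOfComplement.mk_of_continuousAt
    h.isEmbedding.continuous.continuousAt e (h.chart x) θ (h.mem_slice_source x) ?_ ?_ hθ ?_
  · rw [hθs]
    exact h.mem_slice_source x
  · exact IsManifold.chart_mem_maximalAtlas x
  · intro u hu
    have hu' : (u, (0 : B)) ∈ (h.slice x).target := by
      have h0 : u ∈ (h.chart x).target := by simpa using hu
      exact h0
    have := apply_sliceChart_symm h.isEmbedding (h.slice x) (h.isSliceChart x) x hu'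
    simp only [OpenPartialHomeomorph.extend_coe, OpenPartialHomeomorph.extend_coe_symm,
      modelWithCornersSelf_coe, modelWithCornersSelf_coe_symm, Function.comp_apply, id_eq]
    change e (h.slice x (j ((h.chart x).symm u))) = e (u, 0)
    rw [show j ((h.chart x).symm u) = _ from this, (h.slice x).right_inv hu']

/-- An embedding that is an immersion detects smoothness, so smoothness of every map into `X` can be
checked in the ambient vector space. All smoothness claims about Spin(9), M₊ and the quotient go
through this. -/
theorem contMDiff_iff (e : (F × B) ≃L[ℝ] E) {E' H' : Type*} [NormedAddCommGroup E']
    [NormedSpace ℝ E'] [TopologicalSpace H'] {I' : ModelWithCorners ℝ E' H'} {M : Type*}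
    [TopologicalSpace M] [ChartedSpace H' M] [IsManifold I' ∞ M] (f : M → X) :
    letI := h.chartedSpace
    ContMDiff I' 𝓘(ℝ, F) ∞ f ↔ ContMDiff I' 𝓘(ℝ, E) ∞ (j ∘ f) := by
  let _ := h.chartedSpace
  have := h.isManifold
  have himm := h.isImmersionOfComplement e
  refine ⟨fun hf => himm.contMDiff.comp hf, fun hf x => ?_⟩
  rw [ContMDiffAt.iff_comp_isImmersionAtOfComplement (himm (f x))]
  exact ⟨(h.isEmbedding.continuous_iff.2 hf.continuous).continuousAt, hf x⟩

end IsSliceEmbedding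

end SliceManifold

/-! ### Maps with surjective differentials are submersions -/

section Submersion

open Set Filter Topology

variable {F₁ F₂ C : Type*} [NormedAddCommGroup F₁] [NormedSpace ℝ F₁] [FiniteDimensional ℝ F₁]
  [NormedAddCommGroup F₂] [NormedSpace ℝ F₂] [FiniteDimensional ℝ F₂]
  [NormedAddCommGroup C] [NormedSpace ℝ C] [FiniteDimensional ℝ C]

/-- A surjective linear map is the first component of a linear equivalence. -/
theorem exists_equiv_prod_of_surjective (g : F₁ →L[ℝ] F₂) (hg : Function.Surjective g)
    (hdim : Module.finrank ℝ F₁ = Module.finrank ℝ F₂ + Module.finrank ℝ C) :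
    ∃ (π : F₁ →L[ℝ] C) (e : F₁ ≃L[ℝ] F₂ × C), (e : F₁ →L[ℝ] F₂ × C) = g.prod π := by
  have hker : Module.finrank ℝ g.ker = Module.finrank ℝ C := by
    have h1 := (g : F₁ →ₗ[ℝ] F₂).finrank_range_add_finrank_ker
    rw [LinearMap.range_eq_top.2 hg, finrank_top] at h1
    omega
  obtain ⟨ε⟩ := FiniteDimensional.nonempty_linearEquiv_of_finrank_eq hker
  obtain ⟨q, hq⟩ := (g.ker.subtype).exists_leftInverse_of_injective (by simp)
  let π : F₁ →ₗ[ℝ] C := (ε : g.ker →ₗ[ℝ] C) ∘ₗ q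
  have hinj : Function.Injective ((g : F₁ →ₗ[ℝ] F₂).prod π) := by
    rw [injective_iff_map_eq_zero]
    intro x hx
    have hx1 : g x = 0 := congrArg Prod.fst hx
    have hx2 : π x = 0 := congrArg Prod.snd hx
    have hx3 : q x = 0 := by simpa [π] using hx2
    have hx4 := LinearMap.congr_fun hq ⟨x, hx1⟩
    have hx5 : q x = ⟨x, hx1⟩ := hx4
    rw [hx3] at hx5
    exact (congrArg Subtype.val hx5).symm
  let e := (LinearEquiv.ofInjectiveOfFinrankEq _ hinj
    (by rw [hdim, Module.finrank_prod])).toContinuousLinearEquiv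
  exact ⟨LinearMap.toContinuousLinearMap π, e, by ext x <;> rfl⟩

variable {M N : Type*} [TopologicalSpace M] [ChartedSpace F₁ M] [IsManifold 𝓘(ℝ, F₁) ∞ M]
  [TopologicalSpace N] [ChartedSpace F₂ N] [IsManifold 𝓘(ℝ, F₂) ∞ N]

/-- A smooth map with surjective differentials is a submersion. -/
theorem isSubmersionOfComplement_of_surjective_mfderiv {f : M → N}
    (hf : ContMDiff 𝓘(ℝ, F₁) 𝓘(ℝ, F₂) ∞ f)
    (hsurj : ∀ x, Function.Surjective (mfderiv 𝓘(ℝ, F₁) 𝓘(ℝ, F₂) f x))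
    (hdim : Module.finrank ℝ F₁ = Module.finrank ℝ F₂ + Module.finrank ℝ C) :
    Manifold.IsSubmersionOfComplement C 𝓘(ℝ, F₁) 𝓘(ℝ, F₂) ∞ f := by
  intro x
  set φ := chartAt F₁ x with hφ
  set ψ := chartAt F₂ (f x) with hψ
  let g : F₁ → F₂ := ψ ∘ f ∘ φ.symm
  let U : Set F₁ := φ.target ∩ φ.symm ⁻¹' (f ⁻¹' ψ.source)
  have hU : IsOpen U := φ.isOpen_inter_preimage_symm (ψ.open_source.preimage hf.continuous)
  have hxU : φ x ∈ U := by
    refine ⟨mem_chart_target F₁ x, ?_⟩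
    rw [mem_preimage, φ.left_inv (mem_chart_source F₁ x)]
    exact mem_chart_source F₂ (f x)
  have hgU : ContDiffOn ℝ ∞ g U := by
    have h1 := (contMDiff_iff.1 hf).2 x (f x)
    simpa [g, U, extChartAt, OpenPartialHomeomorph.extend] using h1
  let D : F₁ →L[ℝ] F₂ := mfderiv 𝓘(ℝ, F₁) 𝓘(ℝ, F₂) f x
  obtain ⟨π, e, he⟩ := exists_equiv_prod_of_surjective (C := C) D (hsurj x) hdim
  have hdg : HasFDerivAt g D (φ x) := by
    have h1 := ((hf x).mdifferentiableAt (by simp)).hasMFDerivAt.2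
    simp only [writtenInExtChartAt, extChartAt, OpenPartialHomeomorph.extend, mfld_simps] at h1
    exact hasFDerivWithinAt_univ.1 h1
  -- Completing the local expression `g` by a linear map `π` that is injective on the kernel gives a
  -- local diffeomorphism. Used as a new chart of the source, it turns `f` into the first
  -- projection.
  have hΘ : HasFDerivAt (fun y => (g y, π y)) (e : F₁ →L[ℝ] F₂ × C) (φ x) := by
    rw [he]
    exact hdg.prodMk π.hasFDerivAt
  obtain ⟨θ, hxθ, hθU, hθ, hθs⟩ := exists_openPartialHomeomorph_of_contDiffOn hU
    (hgU.prodMk π.contDiff.contDiffOn) hxU e hΘ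
  have hθc : ContDiffOn ℝ ∞ θ θ.source := by
    rw [hθ]
    exact (hgU.prodMk π.contDiff.contDiffOn).mono hθU
  let θ' : OpenPartialHomeomorph F₁ F₁ := θ.trans e.symm.toHomeomorph.toOpenPartialHomeomorph
  have hθ' : θ' ∈ contDiffGroupoid ∞ 𝓘(ℝ, F₁) := by
    rw [contDiffGroupoid, mem_groupoid_of_pregroupoid]
    simp only [contDiffPregroupoid, modelWithCornersSelf_coe, modelWithCornersSelf_coe_symm,
      Function.comp_id, Function.id_comp, preimage_id, range_id, inter_univ]
    refine ⟨?_, ?_⟩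
    · refine e.symm.contDiff.comp_contDiffOn (hθc.mono fun y hy => ?_)
      simpa [θ'] using hy
    · refine hθs.comp e.contDiff.contDiffOn fun y hy => ?_
      simpa [θ'] using hy
  have hmax : φ.trans θ' ∈ IsManifold.maximalAtlas 𝓘(ℝ, F₁) ∞ M := by
    rw [IsManifold.mem_maximalAtlas_iff, mem_maximalAtlas_iff]
    intro e' he'
    refine ⟨?_, ?_⟩
    · rw [OpenPartialHomeomorph.trans_symm_eq_symm_trans_symm, OpenPartialHomeomorph.trans_assoc]
      exact StructureGroupoid.trans _ (StructureGroupoid.symm _ hθ')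
        (HasGroupoid.compatible (chart_mem_atlas F₁ x) he')
    · rw [← OpenPartialHomeomorph.trans_assoc]
      exact StructureGroupoid.trans _ (HasGroupoid.compatible he' (chart_mem_atlas F₁ x)) hθ'
  refine Manifold.IsSubmersionAtOfComplement.mk_of_continuousAt hf.continuous.continuousAt
    e (φ.trans θ') ψ ?_ (mem_chart_source F₂ (f x)) hmax
    (IsManifold.chart_mem_maximalAtlas (f x)) ?_
  · rw [OpenPartialHomeomorph.trans_source]
    exact ⟨mem_chart_source F₁ x, by simpa [θ'] using hxθ⟩
  · intro y hy
    have hy' : y ∈ (φ.trans θ').target := by simpa using hy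
    have hey : e y ∈ θ.target := by
      rw [OpenPartialHomeomorph.trans_target] at hy'
      simpa [θ'] using hy'.1
    have h1 : (φ.trans θ').symm y = φ.symm (θ.symm (e y)) := rfl
    have h2 : θ (θ.symm (e y)) = e y := θ.right_inv hey
    rw [hθ] at h2
    simp only [OpenPartialHomeomorph.extend_coe, OpenPartialHomeomorph.extend_coe_symm,
      modelWithCornersSelf_coe, modelWithCornersSelf_coe_symm, Function.comp_apply, id_eq, h1]
    exact congrArg Prod.fst h2

end Submersion

set_option linter.unusedSimpArgs false

local infixl:70 " ⋆ " => octMul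

/-! ### Octonions -/


/-- The unit of the octonions. -/
def octOne : Octonions := (1, 0)

/-- Octonion conjugation. -/
def octConj (x : Octonions) : Octonions := (star x.1, -x.2)

/-- The Euclidean inner product of the octonions. -/
def octDot (x y : Octonions) : ℝ :=
  x.1.re * y.1.re + x.1.imI * y.1.imI + x.1.imJ * y.1.imJ + x.1.imK * y.1.imK +
    (x.2.re * y.2.re + x.2.imI * y.2.imI + x.2.imJ * y.2.imJ + x.2.imK * y.2.imK)

/-- The real part of an octonion. -/
def octRe : Octonions →ₗ[ℝ] ℝ where
  toFun x := x.1.re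
  map_add' _ _ := by simp
  map_smul' _ _ := by simp

theorem octRe_apply (x : Octonions) : octRe x = x.1.re := rfl

theorem octExt {x y : Octonions} (h1 : x.1.re = y.1.re) (h2 : x.1.imI = y.1.imI)
    (h3 : x.1.imJ = y.1.imJ) (h4 : x.1.imK = y.1.imK) (h5 : x.2.re = y.2.re)
    (h6 : x.2.imI = y.2.imI) (h7 : x.2.imJ = y.2.imJ) (h8 : x.2.imK = y.2.imK) : x = y :=
  Prod.ext (QuaternionAlgebra.ext h1 h2 h3 h4) (QuaternionAlgebra.ext h5 h6 h7 h8)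

/-- With products expanded in coordinates, the polynomial identities of the octonions below are
checked by `ring`. -/
theorem octMul_coords (x y : Octonions) :
    (x ⋆ y).1.re =
    x.1.re * y.1.re - x.1.imI * y.1.imI - x.1.imJ * y.1.imJ - x.1.imK * y.1.imK - x.2.re * y.2.re
      - x.2.imI * y.2.imI - x.2.imJ * y.2.imJ - x.2.imK * y.2.imK ∧
    (x ⋆ y).1.imI =
    x.1.re * y.1.imI + x.1.imI * y.1.re + x.1.imJ * y.1.imK - x.1.imK * y.1.imJ + x.2.re * y.2.imI
      - x.2.imI * y.2.re - x.2.imJ * y.2.imK + x.2.imK * y.2.imJ ∧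
    (x ⋆ y).1.imJ =
    x.1.re * y.1.imJ - x.1.imI * y.1.imK + x.1.imJ * y.1.re + x.1.imK * y.1.imI + x.2.re * y.2.imJ
      + x.2.imI * y.2.imK - x.2.imJ * y.2.re - x.2.imK * y.2.imI ∧
    (x ⋆ y).1.imK =
    x.1.re * y.1.imK + x.1.imI * y.1.imJ - x.1.imJ * y.1.imI + x.1.imK * y.1.re + x.2.re * y.2.imK
      - x.2.imI * y.2.imJ + x.2.imJ * y.2.imI - x.2.imK * y.2.re ∧
    (x ⋆ y).2.re =
    x.1.re * y.2.re - x.1.imI * y.2.imI - x.1.imJ * y.2.imJ - x.1.imK * y.2.imK + x.2.re * y.1.re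
      + x.2.imI * y.1.imI + x.2.imJ * y.1.imJ + x.2.imK * y.1.imK ∧
    (x ⋆ y).2.imI =
    x.1.re * y.2.imI + x.1.imI * y.2.re - x.1.imJ * y.2.imK + x.1.imK * y.2.imJ - x.2.re * y.1.imI
      + x.2.imI * y.1.re - x.2.imJ * y.1.imK + x.2.imK * y.1.imJ ∧
    (x ⋆ y).2.imJ =
    x.1.re * y.2.imJ + x.1.imI * y.2.imK + x.1.imJ * y.2.re - x.1.imK * y.2.imI - x.2.re * y.1.imJ
      + x.2.imI * y.1.imK + x.2.imJ * y.1.re - x.2.imK * y.1.imI ∧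
    (x ⋆ y).2.imK =
    x.1.re * y.2.imK - x.1.imI * y.2.imJ + x.1.imJ * y.2.imI + x.1.imK * y.2.re - x.2.re * y.1.imK
      - x.2.imI * y.1.imJ + x.2.imJ * y.1.imI + x.2.imK * y.1.re := by
  refine ⟨?_, ?_, ?_, ?_, ?_, ?_, ?_, ?_⟩ <;> simp [octMul] <;> ring

theorem octConj_coords (x : Octonions) :
    (octConj x).1.re = x.1.re ∧
    (octConj x).1.imI = -x.1.imI ∧
    (octConj x).1.imJ = -x.1.imJ ∧
    (octConj x).1.imK = -x.1.imK ∧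
    (octConj x).2.re = -x.2.re ∧
    (octConj x).2.imI = -x.2.imI ∧
    (octConj x).2.imJ = -x.2.imJ ∧
    (octConj x).2.imK = -x.2.imK := by
  simp [octConj]

theorem octSMul_coords (a : ℝ) (x : Octonions) :
    (a • x).1.re = a * x.1.re ∧
    (a • x).1.imI = a * x.1.imI ∧
    (a • x).1.imJ = a * x.1.imJ ∧
    (a • x).1.imK = a * x.1.imK ∧
    (a • x).2.re = a * x.2.re ∧
    (a • x).2.imI = a * x.2.imI ∧
    (a • x).2.imJ = a * x.2.imJ ∧
    (a • x).2.imK = a * x.2.imK := by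
  simp

theorem octAdd_coords (x y : Octonions) :
    (x + y).1.re = x.1.re + y.1.re ∧
    (x + y).1.imI = x.1.imI + y.1.imI ∧
    (x + y).1.imJ = x.1.imJ + y.1.imJ ∧
    (x + y).1.imK = x.1.imK + y.1.imK ∧
    (x + y).2.re = x.2.re + y.2.re ∧
    (x + y).2.imI = x.2.imI + y.2.imI ∧
    (x + y).2.imJ = x.2.imJ + y.2.imJ ∧
    (x + y).2.imK = x.2.imK + y.2.imK := by
  simp

theorem octMul_add (x y z : Octonions) : x ⋆ (y + z) = x ⋆ y + x ⋆ z := by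
  simp only [octMul, Prod.fst_add, Prod.snd_add, star_add, Prod.mk_add_mk]
  congr 1 <;> noncomm_ring

theorem add_octMul (x y z : Octonions) : (x + y) ⋆ z = x ⋆ z + y ⋆ z := by
  simp only [octMul, Prod.fst_add, Prod.snd_add, Prod.mk_add_mk]
  congr 1 <;> noncomm_ring

theorem octMul_smul (a : ℝ) (x y : Octonions) : x ⋆ (a • y) = a • (x ⋆ y) := by
  simp [octMul, smul_sub, smul_add]

theorem smul_octMul (a : ℝ) (x y : Octonions) : (a • x) ⋆ y = a • (x ⋆ y) := by
  simp [octMul, smul_sub, smul_add]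

/-- Octonion multiplication as a bilinear map. -/
def octMulₗ : Octonions →ₗ[ℝ] Octonions →ₗ[ℝ] Octonions :=
  LinearMap.mk₂ ℝ octMul add_octMul smul_octMul octMul_add octMul_smul

theorem octMul_neg (x y : Octonions) : x ⋆ (-y) = -(x ⋆ y) := (octMulₗ x).map_neg y
theorem neg_octMul (x y : Octonions) : (-x) ⋆ y = -(x ⋆ y) := octMulₗ.map_neg₂ x y
theorem octMul_zero (x : Octonions) : x ⋆ 0 = 0 := (octMulₗ x).map_zero
theorem zero_octMul (x : Octonions) : 0 ⋆ x = 0 := octMulₗ.map_zero₂ x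
theorem octMul_sub (x y z : Octonions) : x ⋆ (y - z) = x ⋆ y - x ⋆ z := (octMulₗ x).map_sub y z
theorem sub_octMul (x y z : Octonions) : (x - y) ⋆ z = x ⋆ z - y ⋆ z := octMulₗ.map_sub₂ x y z

theorem octOne_mul (x : Octonions) : octOne ⋆ x = x := by
  simp [octMul, octOne]

theorem octMul_one (x : Octonions) : x ⋆ octOne = x := by
  simp [octMul, octOne]

/-- Octonion conjugation as a linear map. -/
def octConjₗ : Octonions →ₗ[ℝ] Octonions where
  toFun := octConj
  map_add' x y := by simp [octConj, add_comm]
  map_smul' a x := by simp [octConj]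

theorem octConj_add (x y : Octonions) : octConj (x + y) = octConj x + octConj y :=
  octConjₗ.map_add x y
theorem octConj_neg (x : Octonions) : octConj (-x) = -octConj x := octConjₗ.map_neg x
theorem octConj_zero : octConj 0 = 0 := octConjₗ.map_zero
theorem octConj_smul (a : ℝ) (x : Octonions) : octConj (a • x) = a • octConj x :=
  octConjₗ.map_smul a x

theorem octConj_conj (x : Octonions) : octConj (octConj x) = x := by simp [octConj]

theorem octConj_one : octConj octOne = octOne := by simp [octConj, octOne]

theorem octConj_mul (x y : Octonions) : octConj (x ⋆ y) = octConj y ⋆ octConj x := by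
  apply octExt <;> simp only [octMul_coords, octConj_coords, octSMul_coords, octAdd_coords] <;> ring

theorem octConj_octMul_octMul (x y : Octonions) : octConj x ⋆ (x ⋆ y) = octDot x x • y := by
  apply octExt <;> simp only [octMul_coords, octConj_coords, octSMul_coords, octAdd_coords] <;>
    unfold octDot <;> ring

theorem octDot_conj_conj (x y : Octonions) : octDot (octConj x) (octConj y) = octDot x y := by
  simp [octConj, octDot]

theorem octMul_octConj_octMul (x y : Octonions) : x ⋆ (octConj x ⋆ y) = octDot x x • y := by
  have := octConj_octMul_octMul (octConj x) y
  rwa [octConj_conj, octDot_conj_conj] at this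

theorem octMul_octMul_octConj (x y : Octonions) : (y ⋆ x) ⋆ octConj x = octDot x x • y := by
  have := congrArg octConj (octMul_octConj_octMul x (octConj y))
  simpa [octConj_mul, octConj_smul, octConj_conj] using this

theorem octMul_octConj_octMul' (x y : Octonions) : (y ⋆ octConj x) ⋆ x = octDot x x • y := by
  have := octMul_octMul_octConj (octConj x) y
  rwa [octConj_conj, octDot_conj_conj] at this

theorem octConj_octMul_octMul_add (x y z : Octonions) :
    octConj x ⋆ (y ⋆ z) + octConj y ⋆ (x ⋆ z) = (2 * octDot x y) • z := by
  apply octExt <;> simp only [octMul_coords, octConj_coords, octSMul_coords, octAdd_coords] <;>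
    unfold octDot <;> ring

theorem octDot_comm (x y : Octonions) : octDot x y = octDot y x := by
  unfold octDot
  ring

theorem octDot_octMul_left (x y z : Octonions) :
    octDot (x ⋆ y) z = octDot y (octConj x ⋆ z) := by
  unfold octDot
  simp only [octMul_coords, octConj_coords, octSMul_coords, octAdd_coords]
  ring

theorem octDot_octMul_right (x y z : Octonions) :
    octDot (x ⋆ y) z = octDot x (z ⋆ octConj y) := by
  unfold octDot
  simp only [octMul_coords, octConj_coords, octSMul_coords, octAdd_coords]
  ring

theorem octMoufang_left (u x z : Octonions) : ((u ⋆ x) ⋆ u) ⋆ z = u ⋆ (x ⋆ (u ⋆ z)) := by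
  apply octExt <;> simp only [octMul_coords] <;> ring

theorem octMoufang_right (u y z : Octonions) : z ⋆ ((u ⋆ y) ⋆ u) = ((z ⋆ u) ⋆ y) ⋆ u := by
  apply octExt <;> simp only [octMul_coords] <;> ring

theorem octDot_add_left (x y z : Octonions) : octDot (x + y) z = octDot x z + octDot y z := by
  simp [octDot]
  ring

theorem octDot_smul_left (a : ℝ) (x y : Octonions) : octDot (a • x) y = a * octDot x y := by
  simp [octDot]
  ring

/-- The inner product of the octonions as a bilinear form. -/
def octDotₗ : Octonions →ₗ[ℝ] Octonions →ₗ[ℝ] ℝ :=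
  LinearMap.mk₂ ℝ octDot octDot_add_left octDot_smul_left
    (fun x y z => by rw [octDot_comm, octDot_add_left, octDot_comm y, octDot_comm z])
    (fun a x y => by rw [octDot_comm, octDot_smul_left, octDot_comm y, smul_eq_mul])

theorem octDot_add_right (x y z : Octonions) : octDot x (y + z) = octDot x y + octDot x z :=
  (octDotₗ x).map_add y z
theorem octDot_smul_right (a : ℝ) (x y : Octonions) : octDot x (a • y) = a * octDot x y :=
  (octDotₗ x).map_smul a y
theorem octDot_neg_right (x y : Octonions) : octDot x (-y) = -octDot x y := (octDotₗ x).map_neg y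
theorem octDot_neg_left (x y : Octonions) : octDot (-x) y = -octDot x y := octDotₗ.map_neg₂ x y
theorem octDot_sub_right (x y z : Octonions) : octDot x (y - z) = octDot x y - octDot x z :=
  (octDotₗ x).map_sub y z
theorem octDot_zero_right (x : Octonions) : octDot x 0 = 0 := (octDotₗ x).map_zero
theorem octDot_zero_left (x : Octonions) : octDot 0 x = 0 := octDotₗ.map_zero₂ x

theorem octDot_one_left (x : Octonions) : octDot octOne x = octRe x := by
  simp [octDot, octOne, octRe_apply]

theorem octDot_one_right (x : Octonions) : octDot x octOne = octRe x := by
  rw [octDot_comm, octDot_one_left]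

theorem octRe_one : octRe octOne = 1 := by simp [octRe_apply, octOne]

theorem octRe_conj (x : Octonions) : octRe (octConj x) = octRe x := by simp [octRe_apply, octConj]

theorem octDot_self_nonneg (x : Octonions) : 0 ≤ octDot x x := by
  unfold octDot
  linarith [mul_self_nonneg x.1.re, mul_self_nonneg x.1.imI,
    mul_self_nonneg x.1.imJ, mul_self_nonneg x.1.imK, mul_self_nonneg x.2.re,
    mul_self_nonneg x.2.imI, mul_self_nonneg x.2.imJ, mul_self_nonneg x.2.imK]

theorem octDot_self_eq_zero {x : Octonions} : octDot x x = 0 ↔ x = 0 := by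
  refine ⟨fun h => ?_, fun h => by rw [h, octDot_zero_left]⟩
  unfold octDot at h
  apply octExt <;> simp <;> nlinarith [mul_self_nonneg x.1.re, mul_self_nonneg x.1.imI,
    mul_self_nonneg x.1.imJ, mul_self_nonneg x.1.imK, mul_self_nonneg x.2.re,
    mul_self_nonneg x.2.imI, mul_self_nonneg x.2.imJ, mul_self_nonneg x.2.imK]

theorem octDot_self_pos {x : Octonions} (hx : x ≠ 0) : 0 < octDot x x :=
  lt_of_le_of_ne (octDot_self_nonneg x) fun h => hx (octDot_self_eq_zero.1 h.symm)

theorem octConj_eq (x : Octonions) : octConj x = (2 * octRe x) • octOne - x := by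
  apply octExt <;> simp [octConj, octRe_apply, octOne]
  ring

theorem octRe_mul (x y : Octonions) : octRe (x ⋆ y) = octDot (octConj x) y := by
  rw [← octDot_one_left, octDot_comm, octDot_octMul_left, octMul_one, octDot_comm]

theorem octConj_mul_self (x : Octonions) : octConj x ⋆ x = octDot x x • octOne := by
  simpa [octMul_one] using octConj_octMul_octMul x octOne

theorem octMul_self (x : Octonions) : x ⋆ x = (2 * octRe x) • x - octDot x x • octOne := by
  have h := octConj_mul_self x
  rw [octConj_eq, sub_octMul, smul_octMul, octOne_mul] at h
  rw [← h]
  abel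

theorem octMul_octMul_self (x y : Octonions) : x ⋆ (x ⋆ y) = (x ⋆ x) ⋆ y := by
  have h := octConj_octMul_octMul x y
  rw [octConj_eq, sub_octMul, smul_octMul, octOne_mul] at h
  rw [octMul_self, sub_octMul, smul_octMul, smul_octMul, octOne_mul, ← h]
  abel

theorem octMul_flexible (x y : Octonions) : (x ⋆ y) ⋆ x = x ⋆ (y ⋆ x) := by
  apply octExt <;> simp only [octMul_coords] <;> ring

theorem octMul_flexible_conj (x y : Octonions) : (x ⋆ y) ⋆ octConj x = x ⋆ (y ⋆ octConj x) := by
  simp only [octConj_eq, octMul_sub, octMul_smul, octMul_one, octMul_flexible]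

theorem octDot_mul_mul (x y : Octonions) :
    octDot (x ⋆ y) (x ⋆ y) = octDot x x * octDot y y := by
  rw [octDot_octMul_left, octConj_octMul_octMul, octDot_smul_right]

/-- This is the polarized composition law `octConj_octMul_octMul_add` at `z = 1`: orthogonality
kills the right side, and `octConj j = -j`. -/
theorem octMul_eq_conj_mul {j x : Octonions} (hj : octRe j = 0) (hjx : octDot j x = 0) :
    j ⋆ x = octConj x ⋆ j := by
  have h := octConj_octMul_octMul_add x j octOne
  rw [octMul_one, octMul_one, octDot_comm, hjx, octConj_eq j, hj] at h
  simp only [mul_zero, zero_smul, zero_sub, neg_octMul] at h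
  exact (add_neg_eq_zero.1 h).symm

theorem finrank_octonions : Module.finrank ℝ Octonions = 8 := by
  rw [Module.finrank_prod, Quaternion.finrank_eq_four]

/-- There are imaginary units orthogonal to any given octonion. -/
theorem exists_imaginary_unit_orthogonal (x : Octonions) :
    ∃ j, octDot j j = 1 ∧ octRe j = 0 ∧ octDot j x = 0 := by
  let f : Octonions →ₗ[ℝ] ℝ × ℝ := octRe.prod (octDotₗ x)
  obtain ⟨y, hy, hy0⟩ : ∃ y ∈ LinearMap.ker f, y ≠ 0 := by
    refine (Submodule.ne_bot_iff _).1 (LinearMap.ker_ne_bot_of_finrank_lt ?_)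
    rw [finrank_octonions, Module.finrank_prod, Module.finrank_self]
    norm_num
  have h1 : octRe y = 0 := congrArg Prod.fst hy
  have h2 : octDot x y = 0 := congrArg Prod.snd hy
  have h3 := octDot_self_pos hy0
  refine ⟨(Real.sqrt (octDot y y))⁻¹ • y, ?_, ?_, ?_⟩
  · rw [octDot_smul_left, octDot_smul_right, ← mul_assoc, ← mul_inv,
      Real.mul_self_sqrt h3.le, inv_mul_cancel₀ h3.ne']
  · rw [map_smul, h1, smul_zero]
  · rw [octDot_smul_left, octDot_comm y x, h2, mul_zero]

/-- Unit octonions have square roots. -/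
theorem exists_octMul_self_eq {z : Octonions} (hz : octDot z z = 1) :
    ∃ x, octDot x x = 1 ∧ x ⋆ x = z := by
  by_cases h : octRe z = -1
  · obtain ⟨j, hj1, hj2, -⟩ := exists_imaginary_unit_orthogonal 0
    refine ⟨j, hj1, ?_⟩
    have hz' : z + octOne = 0 := by
      rw [← octDot_self_eq_zero]
      simp only [octDot_add_left, octDot_add_right, hz, octDot_one_right, octDot_one_left,
        octRe_one, h, map_add]
      norm_num
    rw [octMul_self, hj1, hj2, eq_neg_of_add_eq_zero_left hz']
    simp
  -- For z ≠ -1 the root is 1 + z, normalized, since (1 + z)² = (2 + 2 Re z) z.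
  · have hN : octDot (octOne + z) (octOne + z) = 2 + 2 * octRe z := by
      simp only [octDot_add_left, octDot_add_right, hz, octDot_one_right, octDot_one_left, octRe_one, map_add]
      ring
    have hne : (2 + 2 * octRe z) ≠ 0 := fun h' => h (by linarith)
    have hpos : 0 < 2 + 2 * octRe z :=
      lt_of_le_of_ne (hN ▸ octDot_self_nonneg _) hne.symm
    refine ⟨(Real.sqrt (2 + 2 * octRe z))⁻¹ • (octOne + z), ?_, ?_⟩
    · rw [octDot_smul_left, octDot_smul_right, ← mul_assoc, ← mul_inv,
        Real.mul_self_sqrt hpos.le, hN, inv_mul_cancel₀ hne]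
    · rw [octMul_smul, smul_octMul, smul_smul, ← mul_inv, Real.mul_self_sqrt hpos.le,
        inv_smul_eq_iff₀ hne, octMul_self, map_add, octRe_one, hN]
      module

theorem octExt_iff {x y : Octonions} : x = y ↔
    x.1.re = y.1.re ∧ x.1.imI = y.1.imI ∧ x.1.imJ = y.1.imJ ∧ x.1.imK = y.1.imK ∧
      x.2.re = y.2.re ∧ x.2.imI = y.2.imI ∧ x.2.imJ = y.2.imJ ∧ x.2.imK = y.2.imK :=
  ⟨fun h => by simp [h], fun ⟨h1, h2, h3, h4, h5, h6, h7, h8⟩ => octExt h1 h2 h3 h4 h5 h6 h7 h8⟩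

/-- The nucleus of the octonions is the real line. -/
theorem eq_octRe_smul_of_assoc {a : Octonions} (h : ∀ v p, (v ⋆ p) ⋆ a = v ⋆ (p ⋆ a)) :
    a = octRe a • octOne := by
  -- Vanishing of the associators with the pairs (i, j), (i, ℓ), (j, ℓ), where ℓ = (0, 1), already
  -- kills all imaginary coordinates.
  have h1 := h (⟨0, 1, 0, 0⟩, 0) (⟨0, 0, 1, 0⟩, 0)
  have h2 := h (⟨0, 1, 0, 0⟩, 0) (0, 1)
  have h3 := h (⟨0, 0, 1, 0⟩, 0) (0, 1)
  simp only [octExt_iff, octMul_coords] at h1 h2 h3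
  simp at h1 h2 h3
  apply octExt <;> simp [octRe_apply, octOne] <;> linarith

/-! ### Automorphisms of the octonions -/

/-- Conjugation by a unit octonion with real part `1 / 2` is an automorphism. -/
theorem octConjBy_mul {u : Octonions} (hu : octDot u u = 1) (hr : octRe u = 1 / 2)
    (x y : Octonions) :
    ((u ⋆ x) ⋆ octConj u) ⋆ ((u ⋆ y) ⋆ octConj u) = (u ⋆ (x ⋆ y)) ⋆ octConj u := by
  set c := octConj u with hc
  have hcu : c = octOne - u := by
    rw [hc, octConj_eq, hr]
    norm_num
  -- Norm 1 and real part 1/2 make `u` a sixth root of unity: u² = -ū and ū² = -u.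
  have huu : u ⋆ u = -c := by
    rw [octMul_self, hu, hr, hcu]
    norm_num
  have hcc : c ⋆ c = -u := by
    have h1 : octDot c c = 1 := by rw [hc, octDot_conj_conj, hu]
    have h2 : octRe c = 1 / 2 := by rw [hc, octRe_conj, hr]
    rw [octMul_self, h1, h2, hcu]
    norm_num
  have hl : ∀ z, u ⋆ (c ⋆ z) = z := fun z => by
    rw [hc, octMul_octConj_octMul, hu, one_smul]
  have hrr : ∀ z, (z ⋆ u) ⋆ c = z := fun z => by
    rw [hc, octMul_octMul_octConj, hu, one_smul]
  have e1 : ((u ⋆ x) ⋆ u) ⋆ (c ⋆ y) = u ⋆ (x ⋆ y) := by rw [octMoufang_left, hl]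
  have e2 : (((u ⋆ x) ⋆ u) ⋆ u) = -((u ⋆ x) ⋆ c) := by
    have := congrArg octConj (octMul_octMul_self (octConj u) (octConj (u ⋆ x)))
    simp only [octConj_mul, octConj_conj] at this
    rw [this, huu, octMul_neg]
  -- Right Moufang for ū, applied to ūy and z = ((ux)u)u. By `e1` and `e2` one side becomes
  -- (u(xy))ū, and the other becomes ((ux)ū)((uy)ū) after the two minus signs cancel.
  have e3 := octMoufang_right c (c ⋆ y) (((u ⋆ x) ⋆ u) ⋆ u)
  rw [hrr, e1, octMul_octMul_self, hcc, e2, neg_octMul, neg_octMul, neg_octMul, octMul_neg,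
    neg_neg] at e3
  exact e3

namespace G2

theorem map_mul (α : G2) (x y : Octonions) : α.1.val (x ⋆ y) = α.1.val x ⋆ α.1.val y := α.2 x y

theorem inv_apply_apply (α : G2) (x : Octonions) : (α⁻¹).1.val (α.1.val x) = x := by
  have h : ((α⁻¹ * α).1.val) x = x := by simp
  exact h

theorem apply_inv_apply (α : G2) (x : Octonions) : α.1.val ((α⁻¹).1.val x) = x := by
  have h : ((α * α⁻¹).1.val) x = x := by simp
  exact h

theorem map_one (α : G2) : α.1.val octOne = octOne := by
  have h := map_mul α octOne ((α⁻¹).1.val octOne)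
  rw [octOne_mul, apply_inv_apply, octMul_one] at h
  exact h.symm

/-- The square of the image y is -|x|², a real number. If Re y were nonzero, the quadratic equation
of y would make y real, hence x = α⁻¹ y real as well as imaginary, so x = 0 and y = 0. -/
theorem octRe_map_of_octRe_eq_zero (α : G2) {x : Octonions} (hx : octRe x = 0) :
    octRe (α.1.val x) = 0 := by
  by_contra hne
  set y := α.1.val x with hy
  have h1 : y ⋆ y = -(octDot x x • octOne) := by
    rw [hy, ← map_mul, octMul_self, hx]
    simp [map_one]
  rw [octMul_self] at h1
  have h2 : y = ((2 * octRe y)⁻¹ * (octDot y y - octDot x x)) • octOne := by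
    rw [mul_smul, ← inv_smul_eq_iff₀ (inv_ne_zero (mul_ne_zero two_ne_zero hne)), inv_inv, sub_smul]
    rw [sub_eq_iff_eq_add] at h1
    rw [h1]
    abel
  set c := (2 * octRe y)⁻¹ * (octDot y y - octDot x x)
  have h3 : x = c • octOne := by
    rw [← inv_apply_apply α x, ← hy, h2, map_smul, map_one]
  have h4 : c = 0 := by simpa [hx, octRe_one] using (congrArg octRe h3).symm
  rw [h4, zero_smul] at h2
  exact hne (by rw [h2, map_zero])

theorem octRe_map (α : G2) (x : Octonions) : octRe (α.1.val x) = octRe x := by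
  have h : octRe (α.1.val (x - octRe x • octOne)) = 0 :=
    octRe_map_of_octRe_eq_zero α (by simp [octRe_one])
  rw [map_sub, map_smul, map_one, map_sub, map_smul, octRe_one, smul_eq_mul, mul_one] at h
  linarith

theorem map_conj (α : G2) (x : Octonions) : α.1.val (octConj x) = octConj (α.1.val x) := by
  rw [octConj_eq, octConj_eq, octRe_map, map_sub, map_smul, map_one]

/-- The inner product is Re(x̄ y), which is expressed by operations that automorphisms preserve. -/
theorem octDot_map (α : G2) (x y : Octonions) :
    octDot (α.1.val x) (α.1.val y) = octDot x y := by
  rw [← octConj_conj x, ← octRe_mul, map_conj, ← octRe_mul, ← map_mul, octRe_map]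

/-- The automorphism of the octonions given by a bijective multiplicative linear map. -/
def ofLinearEquiv (f : Octonions ≃ₗ[ℝ] Octonions) (hf : ∀ x y, f (x ⋆ y) = f x ⋆ f y) : G2 :=
  ⟨ContinuousLinearEquiv.toUnit f.toContinuousLinearEquiv, hf⟩

theorem exists_eq_conjBy {u : Octonions} (hu : octDot u u = 1) (hr : octRe u = 1 / 2) :
    ∃ α : G2, ∀ x, α.1.val x = (u ⋆ x) ⋆ octConj u := by
  let f : Octonions →ₗ[ℝ] Octonions := octMulₗ.flip (octConj u) ∘ₗ octMulₗ u
  have hinj : Function.Injective f := by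
    rw [injective_iff_map_eq_zero]
    intro x hx
    have h1 : (u ⋆ x) ⋆ octConj u = 0 := hx
    have h2 := octMul_octConj_octMul' u (u ⋆ x)
    rw [h1, zero_octMul, hu, one_smul] at h2
    have h3 := octConj_octMul_octMul u x
    rwa [← h2, octMul_zero, hu, one_smul, eq_comm] at h3
  refine ⟨ofLinearEquiv (LinearEquiv.ofInjectiveEndo f hinj) fun x y => ?_, fun x => rfl⟩
  exact (octConjBy_mul hu hr x y).symm

/-- For orthogonal imaginary octonions `n`, `w` with `|n| = 1` some automorphism rotates `w` in
the plane of `w` and `nw` by the angle `2π/3`. -/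
theorem exists_rotation {n w : Octonions} (hn : octDot n n = 1) (hn0 : octRe n = 0)
    (hw0 : octRe w = 0) (hnw : octDot n w = 0) :
    ∃ α : G2, α.1.val w = (-(1 / 2) : ℝ) • w + (Real.sqrt 3 / 2) • (n ⋆ w) := by
  have h3 : Real.sqrt 3 * Real.sqrt 3 = 3 := Real.mul_self_sqrt (by norm_num)
  -- As `w` is imaginary and orthogonal to `u`, one has w ū = u w, so u w ū = u² w; and u² = u - 1 =
  -- -1/2 + (√3/2) n.
  let u : Octonions := (1 / 2 : ℝ) • octOne + (Real.sqrt 3 / 2) • n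
  have hr : octRe u = 1 / 2 := by simp [u, octRe_one, hn0]
  have hu : octDot u u = 1 := by
    simp only [u, octDot_add_left, octDot_add_right, octDot_smul_left, octDot_smul_right,
      octDot_one_left, octDot_one_right, octRe_one, hn, hn0, map_add, map_smul, smul_eq_mul]
    linear_combination h3 / 4
  obtain ⟨α, hα⟩ := exists_eq_conjBy hu hr
  refine ⟨α, ?_⟩
  have hwu : octDot w (octConj u) = 0 := by
    rw [octConj_eq, octDot_sub_right, octDot_smul_right, octDot_one_right, hw0]
    simp [u, octDot_add_right, octDot_smul_right, octDot_one_right, hw0, octDot_comm w n, hnw]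
  rw [hα, octMul_flexible_conj, octMul_eq_conj_mul hw0 hwu, octConj_conj, octMul_octMul_self,
    octMul_self, hu, hr]
  simp only [u, sub_octMul, smul_octMul, add_octMul, octOne_mul]
  module

/-- The imaginary octonions are an irreducible representation of `G₂`. -/
theorem eq_bot_or_eq_ker_of_invariant {U : Submodule ℝ Octonions} (hU : U ≤ LinearMap.ker octRe)
    (hinv : ∀ α : G2, ∀ v ∈ U, α.1.val v ∈ U) : U = ⊥ ∨ U = LinearMap.ker octRe := by
  by_cases hbot : U = ⊥
  · exact Or.inl hbot
  obtain ⟨w, hwU, hw⟩ := (Submodule.ne_bot_iff _).1 hbot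
  have hw0 : octRe w = 0 := hU hwU
  have hwp := octDot_self_pos hw
  have h3 : Real.sqrt 3 / 2 ≠ 0 := by positivity
  -- The unit `n` is chosen proportional to y w. Then n w is a nonzero multiple of (y w) w = -|w|²
  -- y, so the image of `w` under the rotation puts `y` into `U`.
  have key : ∀ y, octRe y = 0 → octDot y w = 0 → y ∈ U := by
    intro y hy hyw
    by_cases hy0 : y = 0
    · rw [hy0]; exact U.zero_mem
    have hyp := octDot_self_pos hy0
    have hNp : 0 < octDot y y * octDot w w := mul_pos hyp hwp
    set r := (Real.sqrt (octDot y y * octDot w w))⁻¹ with hr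
    have hr0 : r ≠ 0 := by positivity
    have hc : octConj w = -w := by rw [octConj_eq, hw0]; simp
    have hn : octDot (r • (y ⋆ w)) (r • (y ⋆ w)) = 1 := by
      rw [octDot_smul_left, octDot_smul_right, octDot_mul_mul, ← mul_assoc, hr, ← mul_inv,
        Real.mul_self_sqrt hNp.le, inv_mul_cancel₀ hNp.ne']
    have hn0 : octRe (r • (y ⋆ w)) = 0 := by
      rw [map_smul, octRe_mul, octConj_eq, hy]
      simp [octDot_neg_left, hyw]
    have hnw : octDot (r • (y ⋆ w)) w = 0 := by
      rw [octDot_smul_left, octDot_octMul_right, hc, octMul_neg, octMul_self, hw0,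
        octDot_neg_right, octDot_sub_right, octDot_smul_right, octDot_smul_right,
        octDot_one_right, hy]
      simp
    obtain ⟨α, hα⟩ := exists_rotation hn hn0 hw0 hnw
    have hmem := hinv α w hwU
    rw [hα, U.add_mem_iff_right (U.smul_mem _ hwU), U.smul_mem_iff h3, smul_octMul,
      U.smul_mem_iff hr0] at hmem
    have h5 := octMul_octMul_octConj w y
    rw [hc, octMul_neg] at h5
    rw [← neg_neg ((y ⋆ w) ⋆ w), h5, U.neg_mem_iff, U.smul_mem_iff hwp.ne'] at hmem
    exact hmem
  refine Or.inr (le_antisymm hU fun z hz => ?_)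
  have hz0 : octRe z = 0 := hz
  have h1 := key (z - (octDot z w / octDot w w) • w) (by simp [hz0, hw0]) (by
    rw [sub_eq_add_neg, octDot_add_left, octDot_neg_left, octDot_smul_left,
      div_mul_cancel₀ _ hwp.ne']
    ring)
  have h2 := U.add_mem h1 (U.smul_mem (octDot z w / octDot w w) hwU)
  simpa using h2

/-- A vector fixed by the rotation through 2π/3 satisfies n z = √3 z. Applying n twice gives -z = 3
z. -/
theorem eq_zero_of_fixed {z : Octonions} (hz : octRe z = 0) (h : ∀ α : G2, α.1.val z = z) :
    z = 0 := by
  obtain ⟨n, hn, hn0, hnz⟩ := exists_imaginary_unit_orthogonal z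
  obtain ⟨α, hα⟩ := exists_rotation hn hn0 hz hnz
  rw [h α] at hα
  have h3 : Real.sqrt 3 * Real.sqrt 3 = 3 := Real.mul_self_sqrt (by norm_num)
  have h4 : n ⋆ z = Real.sqrt 3 • z := by
    have h5 : (Real.sqrt 3 / 2) • (n ⋆ z) = (3 / 2 : ℝ) • z := by
      rw [eq_sub_of_add_eq' hα.symm]
      module
    have h6 : Real.sqrt 3 / 2 ≠ 0 := by positivity
    rw [← inv_smul_smul₀ h6 (n ⋆ z), h5, smul_smul]
    congr 1
    field_simp
    linarith
  have h7 : n ⋆ (n ⋆ z) = -z := by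
    rw [octMul_octMul_self, octMul_self, hn, hn0]
    simp [neg_octMul, octOne_mul]
  rw [h4, octMul_smul, h4, smul_smul, h3] at h7
  have h8 : (4 : ℝ) • z = 0 := by
    have : (4 : ℝ) • z = (3 : ℝ) • z + z := by module
    rw [this, h7]
    simp
  exact (smul_eq_zero.1 h8).resolve_left (by norm_num)

end G2

/-! ### Eight anticommuting involutions and octonions -/

section OctonionicAction

variable {V : Type*} [AddCommGroup V] [Module ℝ V]

/-- From an eigenvector-free start, a vector fixed by an involution `A` that anticommutes with
some injective `B`. -/
theorem exists_fixed_of_anticommuting {A B : V →ₗ[ℝ] V} {W : Submodule ℝ V}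
    (hA : ∀ x, A (A x) = x) (hAB : ∀ x, A (B x) = -B (A x)) (hB : ∀ x, B (B x) = x)
    (hAW : ∀ x ∈ W, A x ∈ W) (hBW : ∀ x ∈ W, B x ∈ W) {x : V} (hx : x ∈ W) (hx0 : x ≠ 0) :
    ∃ y ∈ W, y ≠ 0 ∧ A y = y ∧ (y = x + A x ∨ y = B x) := by
  by_cases h : x + A x = 0
  · refine ⟨B x, hBW x hx, fun h0 => hx0 ?_, ?_, Or.inr rfl⟩
    · rw [← hB x, h0, map_zero]
    · rw [hAB, eq_neg_of_add_eq_zero_right h, map_neg, neg_neg]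
  · exact ⟨x + A x, W.add_mem hx (hAW x hx), h, by rw [map_add, hA, add_comm], Or.inl rfl⟩

/-- Conditions already achieved survive `exists_fixed_of_anticommuting`, as long as the old
involution `D` commutes with the new `A` and `B`. -/
theorem fixed_of_fixed {A B D : V →ₗ[ℝ] V} {x y : V} (hDx : D x = x)
    (hDA : ∀ x, D (A x) = A (D x)) (hDB : ∀ x, D (B x) = B (D x))
    (h : y = x + A x ∨ y = B x) : D y = y := by
  rcases h with rfl | rfl
  · rw [map_add, hDA, hDx]
  · rw [hDB, hDx]

variable (r : Fin 8 → V →ₗ[ℝ] V)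

/-- The product of four of the operators `r`. -/
def quadProd (a b c d : Fin 8) : V →ₗ[ℝ] V := r a ∘ₗ r b ∘ₗ r c ∘ₗ r d

theorem quadProd_apply (a b c d : Fin 8) (x : V) :
    quadProd r a b c d x = r a (r b (r c (r d x))) := rfl

/-- The action of the octonions spanned by the operators `r`. -/
def octAct (w : Octonions) : V →ₗ[ℝ] V :=
  w.1.re • r 0 + w.1.imI • r 1 + w.1.imJ • r 2 + w.1.imK • r 3 +
    (w.2.re • r 4 + w.2.imI • r 5 + w.2.imJ • r 6 + w.2.imK • r 7)

theorem octAct_apply (w : Octonions) (x : V) : octAct r w x =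
    w.1.re • r 0 x + w.1.imI • r 1 x + w.1.imJ • r 2 x + w.1.imK • r 3 x +
    (w.2.re • r 4 x + w.2.imI • r 5 x + w.2.imJ • r 6 x + w.2.imK • r 7 x) := rfl

theorem octAct_one (x : V) : octAct r octOne x = r 0 x := by
  simp [octAct_apply, octOne]

theorem octAct_add (v w : Octonions) (x : V) :
    octAct r (v + w) x = octAct r v x + octAct r w x := by
  simp only [octAct_apply, octAdd_coords]
  module

theorem octAct_smul (a : ℝ) (w : Octonions) (x : V) : octAct r (a • w) x = a • octAct r w x := by
  simp only [octAct_apply, octSMul_coords]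
  module

variable {r} (h1 : ∀ i x, r i (r i x) = x) (h2 : ∀ i j x, i ≠ j → r i (r j x) = -r j (r i x))
include h1 h2

/-- The index sets of the four products meet pairwise in two elements, so these products are
commuting involutions. The operators `r 1`, `r 4`, `r 6`, `r 7` anticommute with the respective
product and commute with the preceding ones, so the conditions can be imposed one after another.
They encode e₁e₂ = e₃, e₁e₄ = e₅, e₂e₄ = e₆ and e₃e₄ = e₇. -/
theorem exists_octonionic_vector {W : Submodule ℝ V} (hW : ∀ i, ∀ x ∈ W, r i x ∈ W)
    (hne : W ≠ ⊥) : ∃ s ∈ W, s ≠ 0 ∧ quadProd r 3 1 0 2 s = s ∧ quadProd r 5 1 0 4 s = s ∧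
      quadProd r 6 2 0 4 s = s ∧ quadProd r 7 3 0 4 s = s := by
  have h2' : ∀ i j x, j < i → r i (r j x) = -r j (r i x) := fun i j x h => h2 i j x h.ne'
  have hQ : ∀ a b c d, ∀ x ∈ W, quadProd r a b c d x ∈ W := fun a b c d x hx =>
    hW _ _ (hW _ _ (hW _ _ (hW _ _ hx)))
  obtain ⟨x, hx, hx0⟩ := (Submodule.ne_bot_iff _).1 hne
  obtain ⟨y, hy, hy0, hA1, -⟩ := exists_fixed_of_anticommuting (A := quadProd r 3 1 0 2)
    (B := r 1) (fun x => by simp +decide [quadProd_apply, h1, h2'])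
    (fun x => by simp +decide [quadProd_apply, h1, h2']) (h1 1) (hQ _ _ _ _) (hW 1) hx hx0
  obtain ⟨z, hz, hz0, hB2, hzy⟩ := exists_fixed_of_anticommuting (A := quadProd r 5 1 0 4)
    (B := r 4) (fun x => by simp +decide [quadProd_apply, h1, h2'])
    (fun x => by simp +decide [quadProd_apply, h1, h2']) (h1 4) (hQ _ _ _ _) (hW 4) hy hy0
  have hB1 := fixed_of_fixed hA1 (fun x => by simp +decide [quadProd_apply, h1, h2'])
    (fun x => by simp +decide [quadProd_apply, h1, h2']) hzy
  obtain ⟨t, ht, ht0, hC3, htz⟩ := exists_fixed_of_anticommuting (A := quadProd r 6 2 0 4)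
    (B := r 6) (fun x => by simp +decide [quadProd_apply, h1, h2'])
    (fun x => by simp +decide [quadProd_apply, h1, h2']) (h1 6) (hQ _ _ _ _) (hW 6) hz hz0
  have hC1 := fixed_of_fixed hB1 (fun x => by simp +decide [quadProd_apply, h1, h2'])
    (fun x => by simp +decide [quadProd_apply, h1, h2']) htz
  have hC2 := fixed_of_fixed hB2 (fun x => by simp +decide [quadProd_apply, h1, h2'])
    (fun x => by simp +decide [quadProd_apply, h1, h2']) htz
  obtain ⟨s, hs, hs0, hD4, hst⟩ := exists_fixed_of_anticommuting (A := quadProd r 7 3 0 4)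
    (B := r 7) (fun x => by simp +decide [quadProd_apply, h1, h2'])
    (fun x => by simp +decide [quadProd_apply, h1, h2']) (h1 7) (hQ _ _ _ _) (hW 7) ht ht0
  have hD1 := fixed_of_fixed hC1 (fun x => by simp +decide [quadProd_apply, h1, h2'])
    (fun x => by simp +decide [quadProd_apply, h1, h2']) hst
  have hD2 := fixed_of_fixed hC2 (fun x => by simp +decide [quadProd_apply, h1, h2'])
    (fun x => by simp +decide [quadProd_apply, h1, h2']) hst
  have hD3 := fixed_of_fixed hC3 (fun x => by simp +decide [quadProd_apply, h1, h2'])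
    (fun x => by simp +decide [quadProd_apply, h1, h2']) hst
  exact ⟨s, hs, hs0, hD1, hD2, hD3, hD4⟩

variable {s : V} (hs1 : quadProd r 3 1 0 2 s = s) (hs2 : quadProd r 5 1 0 4 s = s)
  (hs3 : quadProd r 6 2 0 4 s = s) (hs4 : quadProd r 7 3 0 4 s = s)
include hs1 hs2 hs3 hs4

/-- Octonion multiplication appears here: at `s` the operators `r 3`, `r 5`, `r 6`, `r 7` become
words in `r 0`, `r 1`, `r 2`, `r 4`, and both sides are compared in a normal form of such words. -/
theorem octAct_octAct_one_octAct (v p : Octonions) :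
    octAct r v (octAct r octOne (octAct r p s)) = octAct r (v ⋆ p) s := by
  have h0 : ∀ i x, i ≠ 0 → r i (r 0 x) = -r 0 (r i x) := fun i x h => h2 i 0 x h
  have h2' : ∀ i j x, j < i → i ≠ 4 → r i (r j x) = -r j (r i x) :=
    fun i j x h _ => h2 i j x h.ne'
  have h4 : ∀ j x, j < 3 → r 4 (r j x) = -r j (r 4 x) :=
    fun j x h => h2 4 j x (by rintro rfl; revert h; decide)
  -- Against the index order, `r 3` moves inward past `r 4`, so that it reaches `s` and can be
  -- eliminated by `e3`.
  have h34 : ∀ x, r 3 (r 4 x) = -r 4 (r 3 x) := fun x => h2 3 4 x (by decide)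
  have e3 : r 3 s = r 1 (r 0 (r 2 s)) := by
    simpa only [quadProd_apply, h1] using (congrArg (r 3) hs1).symm
  have e5 : r 5 s = r 1 (r 0 (r 4 s)) := by
    simpa only [quadProd_apply, h1] using (congrArg (r 5) hs2).symm
  have e6 : r 6 s = r 2 (r 0 (r 4 s)) := by
    simpa only [quadProd_apply, h1] using (congrArg (r 6) hs3).symm
  have e7 : r 7 s = r 3 (r 0 (r 4 s)) := by
    simpa only [quadProd_apply, h1] using (congrArg (r 7) hs4).symm
  rw [octAct_one]
  simp only [octAct_apply, map_add, map_smul, octMul_coords]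
  simp only [ne_eq, not_false_eq_true, Fin.reduceLT, Fin.reduceEq, Fin.isValue, h1, h0, h2', h4, h34,  e3, e5, e6, e7, map_neg, neg_neg, smul_neg]
  module

/-- The product of the eight operators fixes `s`. With definiteness, this forces the ninth operator
P₀ to act on `s` by a sign. -/
theorem octVolume_apply :
    r 0 (r 1 (r 2 (r 3 (r 4 (r 5 (r 6 (r 7 s))))))) = s := by
  have h0 : ∀ i x, i ≠ 0 → r i (r 0 x) = -r 0 (r i x) := fun i x h => h2 i 0 x h
  have h2' : ∀ i j x, j < i → i ≠ 4 → r i (r j x) = -r j (r i x) :=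
    fun i j x h _ => h2 i j x h.ne'
  have h4 : ∀ j x, j < 3 → r 4 (r j x) = -r j (r 4 x) :=
    fun j x h => h2 4 j x (by rintro rfl; revert h; decide)
  have h34 : ∀ x, r 3 (r 4 x) = -r 4 (r 3 x) := fun x => h2 3 4 x (by decide)
  have e3 : r 3 s = r 1 (r 0 (r 2 s)) := by
    simpa only [quadProd_apply, h1] using (congrArg (r 3) hs1).symm
  have e5 : r 5 s = r 1 (r 0 (r 4 s)) := by
    simpa only [quadProd_apply, h1] using (congrArg (r 5) hs2).symm
  have e6 : r 6 s = r 2 (r 0 (r 4 s)) := by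
    simpa only [quadProd_apply, h1] using (congrArg (r 6) hs3).symm
  have e7 : r 7 s = r 3 (r 0 (r 4 s)) := by
    simpa only [quadProd_apply, h1] using (congrArg (r 7) hs4).symm
  simp only [ne_eq, not_false_eq_true, Fin.reduceLT, Fin.reduceEq, Fin.isValue, h1, h0, h2', h4, h34,  e3, e5, e6, e7, map_neg, neg_neg, smul_neg]

end OctonionicAction

/-! ### The spinor model -/

section OctonionicSpinor

variable {V : Type*} [AddCommGroup V] [Module ℝ V] (r : Fin 8 → V →ₗ[ℝ] V)

/-- `octAct` as a linear map in the octonion. -/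
def octActₗ (x : V) : Octonions →ₗ[ℝ] V where
  toFun w := octAct r w x
  map_add' v w := octAct_add r v w x
  map_smul' a w := octAct_smul r a w x

theorem octActₗ_apply (x : V) (w : Octonions) : octActₗ r x w = octAct r w x := rfl

/-- The parametrization of an irreducible Clifford module by pairs of octonions. -/
def octSpinor (s : V) : (Octonions × Octonions) →ₗ[ℝ] V :=
  (r 0 ∘ₗ octActₗ r s).coprod (octActₗ r s)

theorem octSpinor_apply (s : V) (x : Octonions × Octonions) :
    octSpinor r s x = r 0 (octAct r x.1 s) + octAct r x.2 s := rfl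

variable {r} (h1 : ∀ i x, r i (r i x) = x) (h2 : ∀ i j x, i ≠ j → r i (r j x) = -r j (r i x))

theorem octAct_anticomm {D : V →ₗ[ℝ] V} (hD : ∀ i x, D (r i x) = -r i (D x)) (w : Octonions)
    (x : V) : D (octAct r w x) = -octAct r w (D x) := by
  simp only [octAct_apply, map_add, map_smul, hD]
  module

theorem octAct_mem {W : Submodule ℝ V} (hW : ∀ i, ∀ x ∈ W, r i x ∈ W) (w : Octonions) {x : V}
    (hx : x ∈ W) : octAct r w x ∈ W := by
  rw [octAct_apply]
  have h : ∀ (a : ℝ) i, a • r i x ∈ W := fun a i => W.smul_mem a (hW i x hx)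
  exact W.add_mem (W.add_mem (W.add_mem (W.add_mem (h _ _) (h _ _)) (h _ _)) (h _ _))
    (W.add_mem (W.add_mem (W.add_mem (h _ _) (h _ _)) (h _ _)) (h _ _))

include h1 h2

theorem octAct_octAct_add (v w : Octonions) (x : V) :
    octAct r v (octAct r w x) + octAct r w (octAct r v x) = (2 * octDot v w) • x := by
  have h2' : ∀ i j x, j < i → r i (r j x) = -r j (r i x) := fun i j x h => h2 i j x h.ne'
  simp only [octAct_apply, map_add, map_smul, octDot]
  simp only [h1, h2', Fin.reduceLT, Fin.isValue, smul_neg]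
  module

theorem octAct_self (v : Octonions) (x : V) :
    octAct r v (octAct r v x) = octDot v v • x := by
  have h := octAct_octAct_add h1 h2 v v x
  rw [← two_smul ℝ, mul_smul] at h
  exact smul_right_injective _ (two_ne_zero (α := ℝ)) h

variable {s : V} (hs1 : quadProd r 3 1 0 2 s = s) (hs2 : quadProd r 5 1 0 4 s = s)
  (hs3 : quadProd r 6 2 0 4 s = s) (hs4 : quadProd r 7 3 0 4 s = s)
include hs1 hs2 hs3 hs4

/-- Put p = v̄ q in `octAct_octAct_one_octAct`, apply `octAct r v` once more, and cancel |v|². -/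
theorem octAct_octAct (v q : Octonions) :
    octAct r v (octAct r q s) = r 0 (octAct r (octConj v ⋆ q) s) := by
  by_cases hv : v = 0
  · subst hv
    have h0 : ∀ x, octAct r 0 x = 0 := fun x => by rw [← octActₗ_apply, map_zero]
    rw [octConj_zero, zero_octMul, h0, h0, map_zero]
  · have h := octAct_octAct_one_octAct h1 h2 hs1 hs2 hs3 hs4 v (octConj v ⋆ q)
    have hne := (octDot_self_pos hv).ne'
    rw [octMul_octConj_octMul, octAct_one] at h
    have h' := congrArg (octAct r v) h
    rw [octAct_self h1 h2, octAct_smul, map_smul] at h'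
    exact (smul_right_injective _ hne h').symm

theorem octAct_octSpinor (v : Octonions) (x : Octonions × Octonions) :
    octAct r v (octSpinor r s x) = octSpinor r s (octConj v ⋆ x.2, v ⋆ x.1) := by
  rw [octSpinor_apply, octSpinor_apply, map_add, octAct_octAct h1 h2 hs1 hs2 hs3 hs4,
    add_comm]
  congr 1
  rw [← octAct_octAct_one_octAct h1 h2 hs1 hs2 hs3 hs4, octAct_one]

omit h1 h2 hs1 hs2 hs3 hs4 in
theorem anticomm_octSpinor {D : V →ₗ[ℝ] V} (hD : ∀ i x, D (r i x) = -r i (D x)) {δ : ℝ}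
    (hDs : D s = δ • s) (x : Octonions × Octonions) :
    D (octSpinor r s x) = octSpinor r s (δ • x.1, -(δ • x.2)) := by
  simp only [octSpinor_apply, map_add, hD, octAct_anticomm hD, hDs, map_neg, map_smul, neg_neg,
    octAct_smul, ← neg_smul]

end OctonionicSpinor

section InnerOctonionicSpinor

variable {V : Type*} [NormedAddCommGroup V] [InnerProductSpace ℝ V] {r : Fin 8 → V →ₗ[ℝ] V}
  (h1 : ∀ i x, r i (r i x) = x) (h2 : ∀ i j x, i ≠ j → r i (r j x) = -r j (r i x))
  (h3 : ∀ i x y, inner ℝ (r i x) y = inner ℝ x (r i y))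
include h1 h2 h3

omit h1 h2 in
theorem inner_octAct (w : Octonions) (x y : V) :
    inner ℝ (octAct r w x) y = inner ℝ x (octAct r w y) := by
  simp only [octAct_apply, inner_add_left, inner_add_right, real_inner_smul_left,
    real_inner_smul_right, h3]

theorem inner_octAct_octAct (v w : Octonions) (x : V) :
    inner ℝ (octAct r v x) (octAct r w x) = octDot v w * inner ℝ x x := by
  have h := congrArg (inner ℝ x) (octAct_octAct_add h1 h2 v w x)
  rw [inner_add_right, ← inner_octAct h3 v x (octAct r w x),
    ← inner_octAct h3 w x (octAct r v x), real_inner_comm (octAct r v x), real_inner_smul_right] at h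
  linarith

theorem inner_octSpinor {s : V} (hs : inner ℝ s s = (1 : ℝ)) {D : V →ₗ[ℝ] V}
    (hD : ∀ i x, D (r i x) = -r i (D x)) (hD3 : ∀ x y, inner ℝ (D x) y = inner ℝ x (D y))
    {δ : ℝ} (hδ : δ * δ = 1) (hDs : D s = δ • s) (x y : Octonions × Octonions) :
    inner ℝ (octSpinor r s x) (octSpinor r s y) = octDot x.1 y.1 + octDot x.2 y.2 := by
  -- The two halves are eigenspaces of the symmetric operator `D` for the opposite eigenvalues δ and
  -- -δ.
  have hperp : ∀ p q, inner ℝ (r 0 (octAct r p s)) (octAct r q s) = (0 : ℝ) := fun p q => by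
    have h := hD3 (r 0 (octAct r p s)) (octAct r q s)
    rw [hD, octAct_anticomm hD, octAct_anticomm hD, hDs, map_neg, neg_neg, map_smul, map_smul,
      map_smul, real_inner_smul_left, inner_neg_right, real_inner_smul_right] at h
    have h0 : δ * inner ℝ (r 0 (octAct r p s)) (octAct r q s) = 0 := by linarith
    exact (mul_eq_zero.1 h0).resolve_left fun h => by simp [h] at hδ
  simp only [octSpinor_apply, inner_add_left, inner_add_right, hperp]
  rw [real_inner_comm (r 0 _) (octAct r x.2 s), hperp, h3, h1, inner_octAct_octAct h1 h2 h3,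
    inner_octAct_octAct h1 h2 h3, hs]
  ring

end InnerOctonionicSpinor

theorem exists_octAct_eq {V : Type*} [AddCommGroup V] [Module ℝ V] (r : Fin 8 → V →ₗ[ℝ] V)
    (i : Fin 8) : ∃ w : Octonions, octAct r w = r i := by
  fin_cases i
  · exact ⟨(⟨1, 0, 0, 0⟩, ⟨0, 0, 0, 0⟩), by simp [octAct]⟩
  · exact ⟨(⟨0, 1, 0, 0⟩, ⟨0, 0, 0, 0⟩), by simp [octAct]⟩
  · exact ⟨(⟨0, 0, 1, 0⟩, ⟨0, 0, 0, 0⟩), by simp [octAct]⟩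
  · exact ⟨(⟨0, 0, 0, 1⟩, ⟨0, 0, 0, 0⟩), by simp [octAct]⟩
  · exact ⟨(⟨0, 0, 0, 0⟩, ⟨1, 0, 0, 0⟩), by simp [octAct]⟩
  · exact ⟨(⟨0, 0, 0, 0⟩, ⟨0, 1, 0, 0⟩), by simp [octAct]⟩
  · exact ⟨(⟨0, 0, 0, 0⟩, ⟨0, 0, 1, 0⟩), by simp [octAct]⟩
  · exact ⟨(⟨0, 0, 0, 0⟩, ⟨0, 0, 0, 1⟩), by simp [octAct]⟩

/-- Pairs of octonions: the spin representation of `Spin(9)`. -/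
abbrev Spinors : Type := Octonions × Octonions

/-- The Euclidean inner product of the spinors. -/
def spinorDot (x y : Spinors) : ℝ := octDot x.1 y.1 + octDot x.2 y.2

/-- Clifford multiplication by vectors of `ℝ ⊕ 𝕆 = ℝ⁹`. -/
def cliffordOp (v : ℝ × Octonions) : Spinors →ₗ[ℝ] Spinors where
  toFun x := (v.1 • x.1 + octConj v.2 ⋆ x.2, v.2 ⋆ x.1 - v.1 • x.2)
  map_add' x y := by
    refine Prod.ext ?_ ?_ <;> simp only [Prod.fst_add, Prod.snd_add, smul_add, octMul_add] <;> abel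
  map_smul' a x := by
    refine Prod.ext ?_ ?_ <;>
      simp only [Prod.smul_fst, Prod.smul_snd, octMul_smul, RingHom.id_apply, smul_add, smul_sub,
        smul_comm a v.1]

theorem cliffordOp_apply (v : ℝ × Octonions) (x : Spinors) :
    cliffordOp v x = (v.1 • x.1 + octConj v.2 ⋆ x.2, v.2 ⋆ x.1 - v.1 • x.2) := rfl

/-- The coordinates of `ℝ ⊕ 𝕆`. -/
def octVec : (ℝ × Octonions) ≃ₗ[ℝ] (Fin (8 + 1) → ℝ) where
  toFun v := ![v.1, v.2.1.re, v.2.1.imI, v.2.1.imJ, v.2.1.imK,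
    v.2.2.re, v.2.2.imI, v.2.2.imJ, v.2.2.imK]
  map_add' v w := by
    ext i; fin_cases i <;> rfl
  map_smul' a v := by
    ext i; fin_cases i <;> rfl
  invFun x := (x 0, (⟨x 1, x 2, x 3, x 4⟩, ⟨x 5, x 6, x 7, x 8⟩))
  left_inv v := rfl
  right_inv x := by
    ext i; fin_cases i <;> rfl

theorem octVec_apply (v : ℝ × Octonions) : octVec v = ![v.1, v.2.1.re, v.2.1.imI, v.2.1.imJ,
    v.2.1.imK, v.2.2.re, v.2.2.imI, v.2.2.imJ, v.2.2.imK] := rfl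

theorem stdForm_octVec (v : ℝ × Octonions) :
    stdForm (8 + 1) (octVec v) = v.1 * v.1 + octDot v.2 v.2 := by
  simp [stdForm, octVec_apply, QuadraticMap.weightedSumSquares_apply, Fin.sum_univ_succ, octDot]
  ring

/-! ### Decomposition of ℝ³² into two spin modules -/

namespace SymmetricCliffordSystem

/-- The space `ℝ^{2l}` of a Clifford system. -/
abbrev Space (l : ℕ) : Type := EuclideanSpace ℝ (Fin (2 * l))

section
variable {m l : ℕ} (C : SymmetricCliffordSystem m l)

theorem op_op (A B : Matrix (Fin (2 * l)) (Fin (2 * l)) ℝ) (x : Space l) :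
    op A (op B x) = op (A * B) x := by
  unfold op
  rw [map_mul]
  rfl

theorem op_one (x : Space l) : op (1 : Matrix (Fin (2 * l)) (Fin (2 * l)) ℝ) x = x := by
  unfold op
  rw [map_one]
  rfl

theorem inner_op_transpose (A : Matrix (Fin (2 * l)) (Fin (2 * l)) ℝ) (x y : Space l) :
    inner ℝ (op A x) y = inner ℝ x (op A.transpose y) := by
  have h : op A.transpose = star (op A) := by
    unfold op
    rw [← map_star, Matrix.star_eq_conjTranspose, Matrix.conjTranspose_eq_transpose_of_trivial]
  rw [h, ContinuousLinearMap.star_eq_adjoint, ContinuousLinearMap.adjoint_inner_right]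

theorem inner_op_P (i : Fin (m + 1)) (x y : Space l) :
    inner ℝ (op (C.P i) x) y = inner ℝ x (op (C.P i) y) := by
  rw [inner_op_transpose, C.symm]

theorem P_mul_self (i : Fin (m + 1)) : C.P i * C.P i = 1 := by
  have h := C.anticomm i i
  rw [if_pos rfl, ← two_mul, ← Nat.cast_two (R := Matrix _ _ ℝ)] at h
  have h2 : (2 : ℝ) • (C.P i * C.P i) = (2 : ℝ) • (1 : Matrix _ _ ℝ) := by
    rw [two_smul, two_smul, ← two_mul, one_add_one_eq_two]
    exact_mod_cast h
  exact smul_right_injective _ (two_ne_zero (α := ℝ)) h2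

theorem P_mul_P {i j : Fin (m + 1)} (h : i ≠ j) : C.P i * C.P j = -(C.P j * C.P i) := by
  have := C.anticomm i j
  rw [if_neg h] at this
  exact eq_neg_of_add_eq_zero_left this

theorem op_P_op_P_self (i : Fin (m + 1)) (x : Space l) : op (C.P i) (op (C.P i) x) = x := by
  rw [op_op, P_mul_self, op_one]

theorem op_P_op_P {i j : Fin (m + 1)} (h : i ≠ j) (x : Space l) :
    op (C.P i) (op (C.P j) x) = -op (C.P j) (op (C.P i) x) := by
  rw [op_op, op_op, C.P_mul_P h]
  unfold op
  rw [map_neg]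
  rfl

end

/-- An identification of `ℝ³²` with two copies of the spin representation. -/
structure SpinorModel (C : SymmetricCliffordSystem 8 16) where
  /-- The identification of `ℝ⁹`. -/
  e : (ℝ × Octonions) ≃ₗ[ℝ] (Fin (8 + 1) → ℝ)
  stdForm_e : ∀ v, stdForm (8 + 1) (e v) = v.1 * v.1 + octDot v.2 v.2
  /-- The identification of `ℝ³²`. -/
  Ψ : (Spinors × Spinors) ≃ₗ[ℝ] Space 16
  inner_Ψ : ∀ x y, inner ℝ (Ψ x) (Ψ y) = spinorDot x.1 y.1 + spinorDot x.2 y.2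
  op_vec : ∀ v x, op (C.vec (e v)) (Ψ x) = Ψ (cliffordOp v x.1, cliffordOp v x.2)

variable {C : SymmetricCliffordSystem 8 16}

theorem op_vec_octVec (v : ℝ × Octonions) (x : Space 16) : op (C.vec (octVec v)) x =
    v.1 • op (C.P 0) x +
      octAct (fun i => ((op (C.P i.succ) : Space 16 →L[ℝ] Space 16) : Space 16 →ₗ[ℝ] Space 16))
        v.2 x := by
  rw [vec_apply, octAct_apply]
  unfold op
  simp only [map_sum, map_smul, Fin.sum_univ_succ, octVec_apply]
  simp
  module

theorem exists_definite_sign (hC : C.IsDefinite) : ∃ δ : ℝ, δ * δ = 1 ∧ ∀ x : Space 16,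
    op (C.P 0) (op (C.P (Fin.succ 0)) (op (C.P (Fin.succ 1)) (op (C.P (Fin.succ 2)) (op (C.P (Fin.succ 3)) (op (C.P (Fin.succ 4)) (op (C.P (Fin.succ 5))
      (op (C.P (Fin.succ 6)) (op (C.P (Fin.succ 7)) x)))))))) = δ • x := by
  have h : ∀ x : Space 16, op (C.P 0) (op (C.P (Fin.succ 0)) (op (C.P (Fin.succ 1)) (op (C.P (Fin.succ 2)) (op (C.P (Fin.succ 3)) (op (C.P (Fin.succ 4))
      (op (C.P (Fin.succ 5)) (op (C.P (Fin.succ 6)) (op (C.P (Fin.succ 7)) x)))))))) = op (List.ofFn C.P).prod x := fun x => by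
    simp only [op_op, List.ofFn_succ, List.ofFn_zero, List.prod_cons, List.prod_nil, mul_one]
    rfl
  rcases hC with hC | hC
  · exact ⟨1, by norm_num, fun x => by rw [h, hC, op_one, one_smul]⟩
  · refine ⟨-1, by norm_num, fun x => ?_⟩
    rw [h, hC, neg_one_smul]
    unfold op
    rw [map_neg, map_one]
    rfl

/-- An octonionic vector in ℝ³² generates a first copy of 𝕆². Its orthogonal complement is invariant
by symmetry of the operators and contains a second octonionic vector. Both vectors have the same
sign δ under P₀, because δ comes from the product of all nine matrices; hence the two modules are
isomorphic. -/
theorem exists_spinorModel (hC : C.IsDefinite) : Nonempty C.SpinorModel := by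
  obtain ⟨δ, hδ, hprod⟩ := exists_definite_sign hC
  set r : Fin 8 → Space 16 →ₗ[ℝ] Space 16 := fun i =>
    ((op (C.P i.succ) : Space 16 →L[ℝ] Space 16) : Space 16 →ₗ[ℝ] Space 16) with hr
  set D : Space 16 →ₗ[ℝ] Space 16 :=
    ((op (C.P 0) : Space 16 →L[ℝ] Space 16) : Space 16 →ₗ[ℝ] Space 16) with hDdef
  have hDr : ∀ x, D (r 0 (r 1 (r 2 (r 3 (r 4 (r 5 (r 6 (r 7 x)))))))) = δ • x := hprod
  have h1 : ∀ i x, r i (r i x) = x := fun i x => C.op_P_op_P_self _ x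
  have h2 : ∀ i j x, i ≠ j → r i (r j x) = -r j (r i x) := fun i j x h =>
    C.op_P_op_P (by simpa using h) x
  have h3 : ∀ i x y, inner ℝ (r i x) y = inner ℝ x (r i y) := fun i x y => C.inner_op_P _ x y
  have hD : ∀ i x, D (r i x) = -r i (D x) := fun i x => C.op_P_op_P (Fin.succ_ne_zero i).symm x
  have hD3 : ∀ x y, inner ℝ (D x) y = inner ℝ x (D y) := fun x y => C.inner_op_P _ x y
  have key : ∀ W : Submodule ℝ (Space 16), (∀ i, ∀ x ∈ W, r i x ∈ W) → W ≠ ⊥ →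
      ∃ s ∈ W, inner ℝ s s = (1 : ℝ) ∧ D s = δ • s ∧
        ∀ v x, octAct r v (octSpinor r s x) = octSpinor r s (octConj v ⋆ x.2, v ⋆ x.1) := by
    intro W hW hne
    obtain ⟨s, hs, hs0, hq1, hq2, hq3, hq4⟩ := exists_octonionic_vector h1 h2 hW hne
    have hn : ∀ T : Space 16 →ₗ[ℝ] Space 16, T s = s → T (‖s‖⁻¹ • s) = ‖s‖⁻¹ • s :=
      fun T h => by rw [map_smul, h]
    have hvol := octVolume_apply h1 h2 (hn _ hq1) (hn _ hq2) (hn _ hq3) (hn _ hq4)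
    refine ⟨‖s‖⁻¹ • s, W.smul_mem _ hs, ?_, ?_,
      octAct_octSpinor h1 h2 (hn _ hq1) (hn _ hq2) (hn _ hq3) (hn _ hq4)⟩
    · rw [real_inner_self_eq_norm_sq, norm_smul, norm_inv, norm_norm,
        inv_mul_cancel₀ (norm_ne_zero_iff.2 hs0), one_pow]
    · have h := hDr (‖s‖⁻¹ • s)
      rwa [hvol] at h
  obtain ⟨s, -, hs, hDs, hs'⟩ := key ⊤ (fun _ _ _ => trivial) top_ne_bot
  set U := LinearMap.range (octSpinor r s) with hU
  have hUr : ∀ i, ∀ x ∈ U, r i x ∈ U := by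
    rintro i _ ⟨x, rfl⟩
    obtain ⟨v, hv⟩ := exists_octAct_eq r i
    exact ⟨_, (hs' v x).symm.trans (by rw [hv])⟩
  -- The first module has dimension at most 16, less than 32.
  have hUne : Uᗮ ≠ ⊥ := by
    intro h
    rw [Submodule.orthogonal_eq_bot_iff] at h
    have h4 := LinearMap.finrank_range_le (octSpinor r s)
    rw [← hU, h, finrank_top, finrank_euclideanSpace_fin, Module.finrank_prod,
      finrank_octonions] at h4
    omega
  obtain ⟨s', hsU, hs1', hDs', hs''⟩ := key Uᗮ (fun i x hx => by
    rw [Submodule.mem_orthogonal] at hx ⊢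
    exact fun u hu => by rw [← h3]; exact hx _ (hUr i u hu)) hUne
  have hmem : ∀ x, octSpinor r s' x ∈ Uᗮ := fun x => by
    have hW : ∀ i, ∀ x ∈ Uᗮ, r i x ∈ Uᗮ := fun i x hx => by
      rw [Submodule.mem_orthogonal] at hx ⊢
      exact fun u hu => by rw [← h3]; exact hx _ (hUr i u hu)
    exact Submodule.add_mem _ (hW 0 _ (octAct_mem hW _ hsU)) (octAct_mem hW _ hsU)
  set f : (Spinors × Spinors) →ₗ[ℝ] Space 16 := (octSpinor r s).coprod (octSpinor r s') with hf
  have hinner : ∀ x y, inner ℝ (f x) (f y) = spinorDot x.1 y.1 + spinorDot x.2 y.2 := by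
    intro x y
    have hp : ∀ a b, inner ℝ (octSpinor r s a) (octSpinor r s' b) = (0 : ℝ) := fun a b =>
      (Submodule.mem_orthogonal _ _).1 (hmem b) _ ⟨a, rfl⟩
    simp only [hf, LinearMap.coprod_apply, inner_add_left, inner_add_right, hp]
    rw [real_inner_comm _ (octSpinor r s' x.2), hp, inner_octSpinor h1 h2 h3 hs hD hD3 hδ hDs,
      inner_octSpinor h1 h2 h3 hs1' hD hD3 hδ hDs', add_zero, zero_add]
    rfl
  have hinj : Function.Injective f := by
    rw [injective_iff_map_eq_zero]
    intro x hx
    have h := hinner x x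
    rw [hx, inner_zero_left] at h
    unfold spinorDot at h
    have ha := octDot_self_nonneg x.1.1
    have hb := octDot_self_nonneg x.1.2
    have hc := octDot_self_nonneg x.2.1
    have hd := octDot_self_nonneg x.2.2
    exact Prod.ext (Prod.ext (octDot_self_eq_zero.1 (by linarith))
      (octDot_self_eq_zero.1 (by linarith))) (Prod.ext (octDot_self_eq_zero.1 (by linarith))
      (octDot_self_eq_zero.1 (by linarith)))
  -- The sign δ is absorbed into the coordinate of P₀, so both definite cases lead to the same
  -- model.
  let scale : (ℝ × Octonions) ≃ₗ[ℝ] (ℝ × Octonions) :=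
    (LinearEquiv.smulOfNeZero ℝ ℝ δ (by rintro rfl; simp at hδ)).prodCongr (LinearEquiv.refl ℝ _)
  have hscale : ∀ v, scale v = (δ * v.1, v.2) := fun v => rfl
  refine ⟨⟨scale.trans octVec, fun v => ?_, LinearEquiv.ofInjectiveOfFinrankEq f hinj ?_, hinner,
    fun v x => ?_⟩⟩
  · rw [LinearEquiv.trans_apply, stdForm_octVec, hscale]
    linear_combination (v.1 * v.1) * hδ
  · rw [finrank_euclideanSpace_fin, Module.finrank_prod, Module.finrank_prod, finrank_octonions]
  · change op (C.vec (octVec (scale v))) (f x) = f _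
    rw [op_vec_octVec, hscale]
    have hDf : ∀ (t : Space 16) (a : Spinors), D t = δ • t →
        (δ * v.1) • op (C.P 0) (octSpinor r t a) = octSpinor r t (v.1 • a.1, -(v.1 • a.2)) := by
      intro t a ht
      have := anticomm_octSpinor hD ht a
      change op (C.P 0) (octSpinor r t a) = _ at this
      rw [this, ← map_smul]
      congr 1
      refine Prod.ext ?_ ?_
      · simp only [Prod.smul_mk, smul_smul]
        congr 1
        linear_combination v.1 * hδ
      · simp only [Prod.smul_mk, smul_neg, smul_smul]
        congr 2
        linear_combination v.1 * hδ
    change (δ * v.1) • op (C.P 0) (f x) + octAct r v.2 (f x) = _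
    simp only [hf, LinearMap.coprod_apply, map_add, smul_add, hDf _ _ hDs, hDf _ _ hDs', hs', hs'']
    rw [add_add_add_comm, ← map_add, ← map_add]
    congr 2 <;> refine Prod.ext rfl ?_ <;>
      simp only [cliffordOp_apply, Prod.snd_add, neg_add_eq_sub]

end SymmetricCliffordSystem

/-! ### Words in the Clifford algebra and faithfulness on the even part -/

namespace CliffordWords

open CliffordAlgebra

variable {n : ℕ}

/-- The standard generators of the Clifford algebra, indexed by natural numbers. -/
def gen (n k : ℕ) : CliffordAlgebra (stdForm n) :=
  ι (stdForm n) fun i => if (i : ℕ) = k then 1 else 0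

theorem gen_mul_self {k : ℕ} (hk : k < n) : gen n k * gen n k = 1 := by
  rw [gen, ι_sq_scalar, QuadraticMap.weightedSumSquares_apply, Finset.sum_eq_single ⟨k, hk⟩]
  · simp
  · intro i _ hi
    rw [if_neg fun h => hi (Fin.ext h)]
    simp
  · simp

theorem gen_mul_gen {j k : ℕ} (h : j ≠ k) : gen n j * gen n k = -(gen n k * gen n j) := by
  rw [eq_neg_iff_add_eq_zero, gen, gen, ι_mul_ι_add_swap, QuadraticMap.polar,
    QuadraticMap.weightedSumSquares_apply, QuadraticMap.weightedSumSquares_apply,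
    QuadraticMap.weightedSumSquares_apply, ← Finset.sum_sub_distrib, ← Finset.sum_sub_distrib,
    Finset.sum_eq_zero, map_zero]
  intro i _
  by_cases h1 : (i : ℕ) = j <;> by_cases h2 : (i : ℕ) = k <;> simp_all

theorem involute_gen (k : ℕ) : involute (gen n k) = -gen n k := involute_ι _

/-- The span of the words in the first `k` generators. -/
def wordSpan (n : ℕ) : ℕ → Submodule ℝ (CliffordAlgebra (stdForm n))
  | 0 => Submodule.span ℝ {1}
  | k + 1 => wordSpan n k ⊔ (wordSpan n k).map (LinearMap.mulRight ℝ (gen n k))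

theorem mem_wordSpan_succ {k : ℕ} {x : CliffordAlgebra (stdForm n)} :
    x ∈ wordSpan n (k + 1) ↔ ∃ a ∈ wordSpan n k, ∃ b ∈ wordSpan n k, x = a + b * gen n k := by
  rw [wordSpan, Submodule.mem_sup]
  constructor
  · rintro ⟨a, ha, _, ⟨b, hb, rfl⟩, rfl⟩
    exact ⟨a, ha, b, hb, rfl⟩
  · rintro ⟨a, ha, b, hb, rfl⟩
    exact ⟨a, ha, _, ⟨b, hb, rfl⟩, rfl⟩

theorem one_mem_wordSpan (k : ℕ) : (1 : CliffordAlgebra (stdForm n)) ∈ wordSpan n k := by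
  induction k with
  | zero => exact Submodule.mem_span_singleton_self 1
  | succ k ih => exact mem_wordSpan_succ.2 ⟨1, ih, 0, zero_mem _, by simp⟩

theorem involute_mem_wordSpan {k : ℕ} {x : CliffordAlgebra (stdForm n)} (hx : x ∈ wordSpan n k) :
    involute x ∈ wordSpan n k := by
  induction k generalizing x with
  | zero =>
    obtain ⟨a, rfl⟩ := Submodule.mem_span_singleton.1 hx
    rw [map_smul, map_one]
    exact Submodule.smul_mem _ _ (Submodule.mem_span_singleton_self 1)
  | succ k ih =>
    obtain ⟨a, ha, b, hb, rfl⟩ := mem_wordSpan_succ.1 hx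
    refine mem_wordSpan_succ.2 ⟨_, ih ha, -involute b, neg_mem (ih hb), ?_⟩
    rw [map_add, map_mul, involute_gen, mul_neg, neg_mul]

/-- The generator anticommutes with each letter of the word, so passing it through costs the parity
sign recorded by `involute`. -/
theorem gen_mul_of_le {j k : ℕ} (hk : k ≤ j) {x : CliffordAlgebra (stdForm n)}
    (hx : x ∈ wordSpan n k) : gen n j * x = involute x * gen n j := by
  induction k generalizing x with
  | zero =>
    obtain ⟨a, rfl⟩ := Submodule.mem_span_singleton.1 hx
    rw [map_smul, map_one, mul_smul_comm, smul_mul_assoc, one_mul, mul_one]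
  | succ k ih =>
    obtain ⟨a, ha, b, hb, rfl⟩ := mem_wordSpan_succ.1 hx
    rw [mul_add, ← mul_assoc, ih (by omega) ha, ih (by omega) hb, map_add, map_mul, involute_gen,
      add_mul, mul_assoc, gen_mul_gen (by omega : j ≠ k), mul_neg, mul_neg, neg_mul, mul_assoc]

theorem gen_mul_mem {i k : ℕ} (hik : i < k) (hk : k ≤ n) {x : CliffordAlgebra (stdForm n)}
    (hx : x ∈ wordSpan n k) : gen n i * x ∈ wordSpan n k := by
  induction k generalizing x with
  | zero => omega
  | succ k ih =>
    obtain ⟨a, ha, b, hb, rfl⟩ := mem_wordSpan_succ.1 hx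
    rcases Nat.lt_succ_iff_lt_or_eq.1 hik with h | rfl
    · exact mem_wordSpan_succ.2 ⟨_, ih h (by omega) ha, _, ih h (by omega) hb, by
        rw [mul_add, mul_assoc]⟩
    · refine mem_wordSpan_succ.2 ⟨_, involute_mem_wordSpan hb, _, involute_mem_wordSpan ha, ?_⟩
      rw [mul_add, ← mul_assoc, gen_mul_of_le le_rfl ha, gen_mul_of_le le_rfl hb, mul_assoc,
        gen_mul_self (by omega), mul_one, add_comm]

theorem ι_eq_sum (v : Fin n → ℝ) : ι (stdForm n) v = ∑ i, v i • gen n i := by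
  conv_lhs => rw [pi_eq_sum_univ' v]
  rw [map_sum]
  refine Finset.sum_congr rfl fun i _ => ?_
  rw [map_smul, gen]
  congr 2
  ext j
  simp [Pi.single_apply, Fin.ext_iff, eq_comm]

/-- The span contains 1 and is stable under left multiplication by the generators, hence by the
whole algebra. -/
theorem wordSpan_eq_top : wordSpan n n = ⊤ := by
  rw [eq_top_iff]
  rintro x -
  suffices h : ∀ y ∈ wordSpan n n, x * y ∈ wordSpan n n by
    simpa using h 1 (one_mem_wordSpan n)
  induction x using CliffordAlgebra.induction with
  | algebraMap r =>
    intro y hy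
    rw [← Algebra.smul_def]
    exact Submodule.smul_mem _ _ hy
  | ι v =>
    intro y hy
    rw [ι_eq_sum, Finset.sum_mul]
    refine Submodule.sum_mem _ fun i _ => ?_
    rw [smul_mul_assoc]
    exact Submodule.smul_mem _ _ (gen_mul_mem i.2 le_rfl hy)
  | mul a b ha hb =>
    intro y hy
    rw [mul_assoc]
    exact ha _ (hb _ hy)
  | add a b ha hb =>
    intro y hy
    rw [add_mul]
    exact add_mem (ha _ hy) (hb _ hy)

/-- Uniqueness of the decomposition is not needed: `a` and `b` are replaced by their components of
the right parity. -/
theorem mem_wordSpan_succ_of_involute_eq {k : ℕ} {x : CliffordAlgebra (stdForm n)}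
    (hx : x ∈ wordSpan n (k + 1)) {ε : ℝ} (hε : ε * ε = 1) (h : involute x = ε • x) :
    ∃ a ∈ wordSpan n k, ∃ b ∈ wordSpan n k, involute a = ε • a ∧ involute b = -(ε • b) ∧
      x = a + b * gen n k := by
  obtain ⟨a, ha, b, hb, rfl⟩ := mem_wordSpan_succ.1 hx
  rw [map_add, map_mul, involute_gen, smul_add] at h
  refine ⟨(2 : ℝ)⁻¹ • (a + ε • involute a), Submodule.smul_mem _ _ (add_mem ha
    (Submodule.smul_mem _ _ (involute_mem_wordSpan ha))), (2 : ℝ)⁻¹ • (b - ε • involute b),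
    Submodule.smul_mem _ _ (sub_mem hb (Submodule.smul_mem _ _ (involute_mem_wordSpan hb))),
    ?_, ?_, ?_⟩
  · rw [map_smul, map_add, map_smul, involute_involute, smul_comm ε, smul_add ε, smul_smul, hε,
      one_smul, add_comm]
  · rw [map_smul, map_sub, map_smul, involute_involute, smul_comm ε, smul_sub ε, smul_smul, hε,
      one_smul, ← smul_neg, neg_sub]
  · have h' := congrArg (fun y => ε • y) h
    simp only [smul_add, smul_smul, hε, one_smul, mul_neg, smul_neg] at h'
    rw [smul_mul_assoc, sub_mul, smul_mul_assoc, ← smul_add]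
    have : a + ε • involute a + (b * gen n k - ε • (involute b * gen n k)) =
        (2 : ℝ) • (a + b * gen n k) := by
      rw [two_smul]
      nth_rewrite 2 [← h']
      abel
    rw [this, smul_smul, inv_mul_cancel₀ two_ne_zero, one_smul]

/-- Write x = a + b g, where g is the last generator, a is even and b is odd. Commuting with g gives
b = -b, so that generator drops out; descending through the generators leaves only scalars. -/
theorem mem_span_one_of_commute {x : CliffordAlgebra (stdForm n)} (hx : involute x = x)
    (hc : ∀ i < n, gen n i * x = x * gen n i) : ∃ a : ℝ, x = a • 1 := by
  have key : ∀ k, k ≤ n → x ∈ wordSpan n k → ∃ a : ℝ, x = a • 1 := by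
    intro k
    induction k with
    | zero =>
      intro _ h
      obtain ⟨a, rfl⟩ := Submodule.mem_span_singleton.1 h
      exact ⟨a, rfl⟩
    | succ k ih =>
      intro hk h
      refine ih (by omega) ?_
      obtain ⟨a, ha, b, hb, ha', hb', h⟩ :=
        mem_wordSpan_succ_of_involute_eq h (one_mul 1) (by rw [hx, one_smul])
      rw [one_smul] at ha' hb'
      have hck := hc k (by omega)
      rw [h, mul_add, add_mul, ← mul_assoc, gen_mul_of_le le_rfl ha, gen_mul_of_le le_rfl hb, ha',
        hb', mul_assoc, mul_assoc, gen_mul_self (by omega), mul_one, mul_one,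
        add_right_inj] at hck
      have hb0 : b = 0 := by
        have h2 : (2 : ℝ) • b = 0 := by
          rw [two_smul]
          nth_rewrite 1 [← hck]
          exact neg_add_cancel b
        exact (smul_eq_zero.1 h2).resolve_left two_ne_zero
      rwa [h, hb0, zero_mul, add_zero]
  exact key n le_rfl (wordSpan_eq_top ▸ trivial)

end CliffordWords

namespace SymmetricCliffordSystem

open CliffordAlgebra CliffordWords

section
variable {m l : ℕ} (C : SymmetricCliffordSystem m l)

theorem rep_gen (i : Fin (m + 1)) : C.rep (gen (m + 1) i) = C.P i := by
  rw [gen, rep_ι, vec_apply, Finset.sum_eq_single i]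
  · simp
  · intro j _ hj
    rw [if_neg fun h => hj (Fin.ext h), zero_smul]
  · simp

/-- The last generator `t` is kept in reserve. The map y ↦ t g y g t fixes words in the first k
generators and changes the sign of b g, so with a + b g the kernel also contains a - b g, hence both
parts. -/
theorem rep_eq_zero_of_mem_wordSpan [NeZero l] {k : ℕ} (hk : k ≤ m)
    {x : CliffordAlgebra (stdForm (m + 1))} (hx : x ∈ wordSpan (m + 1) k) (h0 : C.rep x = 0) :
    x = 0 := by
  induction k generalizing x with
  | zero =>
    obtain ⟨a, rfl⟩ := Submodule.mem_span_singleton.1 hx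
    have : Nonempty (Fin (2 * l)) := ⟨⟨0, by have := NeZero.pos l; omega⟩⟩
    rw [map_smul, map_one] at h0
    rw [(smul_eq_zero.1 h0).resolve_right one_ne_zero, zero_smul]
  | succ k ih =>
    obtain ⟨a, ha, b, hb, rfl⟩ := mem_wordSpan_succ.1 hx
    set g := gen (m + 1) k with hg
    set t := gen (m + 1) m with ht
    have hg2 : g * g = 1 := gen_mul_self (by omega)
    have ht2 : t * t = 1 := gen_mul_self (by omega)
    have hgt : g * t = -(t * g) := gen_mul_gen (by omega)
    have hconj : ∀ y ∈ wordSpan (m + 1) k, t * (g * (y * (g * t))) = y := by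
      intro y hy
      have h1 : g * y = involute y * g := gen_mul_of_le le_rfl hy
      have h2 : t * involute y = y * t := by
        have := gen_mul_of_le (by omega : k ≤ m) (involute_mem_wordSpan hy)
        rwa [involute_involute] at this
      rw [← mul_assoc g y, h1, mul_assoc, ← mul_assoc g, hg2, one_mul, ← mul_assoc, h2, mul_assoc,
        ht2, mul_one]
    have hbg : t * (g * ((b * g) * (g * t))) = -(b * g) := by
      have : (b * g) * (g * t) = -((b * (g * t)) * g) := by
        rw [mul_assoc b, mul_assoc b (g * t), mul_assoc g t g, ← mul_neg, ← mul_neg, hgt, neg_mul_eq_mul_neg]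
      rw [this]
      have h3 := hconj b hb
      simp only [mul_neg, ← mul_assoc] at h3 ⊢
      rw [h3]
    have h1 : C.rep (a - b * g) = 0 := by
      have : a - b * g = t * (g * ((a + b * g) * (g * t))) := by
        rw [add_mul, mul_add, mul_add, hconj a ha, hbg, sub_eq_add_neg]
      rw [this, map_mul, map_mul, map_mul, h0, zero_mul, mul_zero, mul_zero]
    rw [map_add] at h0
    rw [map_sub, sub_eq_zero] at h1
    rw [h1, ← two_smul ℝ, smul_eq_zero] at h0
    have h2 := h0.resolve_left two_ne_zero
    have ha0 := ih (by omega) ha (h1.trans h2)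
    have hb0 := ih (by omega) hb (by
      have := congrArg (· * C.rep g) h2
      simpa only [← map_mul, mul_assoc, hg2, mul_one, zero_mul] using this)
    rw [ha0, hb0, zero_mul, add_zero]

end

variable {C : SymmetricCliffordSystem 8 16}

/-- The volume element acts by the scalar δ, so the full representation is not injective, but it is
injective on the even part. For even x = a + b e₈, the volume element trades b e₈ for -δ c, where c
= e₀⋯e₇ b is an odd word in the first eight generators. Faithfulness on these words gives a = δ c,
and comparing parities makes both vanish. -/
theorem eq_zero_of_rep_eq_zero (hC : C.IsDefinite) {x : CliffordAlgebra (stdForm (8 + 1))}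
    (hx : involute x = x) (h0 : C.rep x = 0) : x = 0 := by
  have hmem : x ∈ wordSpan (8 + 1) (8 + 1) := wordSpan_eq_top (n := 8 + 1) ▸ trivial
  obtain ⟨a, ha, b, hb, ha', hb', rfl⟩ :=
    mem_wordSpan_succ_of_involute_eq hmem (one_mul 1) (by rw [hx, one_smul])
  rw [one_smul] at ha' hb'
  obtain ⟨δ, hδ, hprod⟩ : ∃ δ : ℝ, δ * δ = 1 ∧ (List.ofFn C.P).prod = δ • 1 := by
    rcases hC with hC | hC
    · exact ⟨1, by norm_num, by rw [hC, one_smul]⟩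
    · exact ⟨-1, by norm_num, by rw [hC, neg_one_smul]⟩
  let e : ℕ → CliffordAlgebra (stdForm (8 + 1)) := gen (8 + 1)
  let c := e 0 * (e 1 * (e 2 * (e 3 * (e 4 * (e 5 * (e 6 * (e 7 * b)))))))
  have hcmem : c ∈ wordSpan (8 + 1) 8 := by
    refine gen_mul_mem ?_ ?_ (gen_mul_mem ?_ ?_ (gen_mul_mem ?_ ?_ (gen_mul_mem ?_ ?_
      (gen_mul_mem ?_ ?_ (gen_mul_mem ?_ ?_ (gen_mul_mem ?_ ?_ (gen_mul_mem ?_ ?_ hb))))))) <;>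
    omega
  have hc' : involute c = -c := by
    simp only [c, e, map_mul, involute_gen, hb', neg_mul, mul_neg, neg_neg]
  have hrep : C.rep c = δ • C.rep (gen (8 + 1) 8 * b) := by
    have h8 := hprod
    simp only [List.ofFn_succ, List.ofFn_zero, List.prod_cons, List.prod_nil, mul_one] at h8
    have h8' : C.rep (e 0 * (e 1 * (e 2 * (e 3 * (e 4 * (e 5 * (e 6 * (e 7 * e 8)))))))) =
        δ • 1 := by
      rw [← h8]
      simp only [map_mul]
      congr 1
      · exact C.rep_gen 0
      congr 1
      · exact C.rep_gen 1
      congr 1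
      · exact C.rep_gen 2
      congr 1
      · exact C.rep_gen 3
      congr 1
      · exact C.rep_gen 4
      congr 1
      · exact C.rep_gen 5
      congr 1
      · exact C.rep_gen 6
      congr 1
      · exact C.rep_gen 7
      · exact C.rep_gen 8
    have h9 : c = e 0 * (e 1 * (e 2 * (e 3 * (e 4 * (e 5 * (e 6 * (e 7 * e 8))))))) *
        (e 8 * b) := by
      simp only [c, mul_assoc]
      rw [← mul_assoc (e 8) (e 8) b, gen_mul_self (by omega), one_mul]
    rw [h9, map_mul, h8', smul_mul_assoc, one_mul]
  have hswap : b * gen (8 + 1) 8 = -(gen (8 + 1) 8 * b) := by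
    rw [gen_mul_of_le le_rfl hb, hb', neg_mul, neg_neg]
  have hac : a - δ • c = 0 := by
    refine C.rep_eq_zero_of_mem_wordSpan le_rfl (sub_mem ha (Submodule.smul_mem _ _ hcmem)) ?_
    rw [map_sub, map_smul, hrep, smul_smul, hδ, one_smul, ← map_sub, sub_eq_add_neg, ← hswap]
    exact h0
  have hac' := congrArg involute hac
  rw [map_sub, map_smul, ha', hc', map_zero, smul_neg, sub_neg_eq_add] at hac'
  have ha0 : a = 0 := by
    have h2 : (2 : ℝ) • a = (a - δ • c) + (a + δ • c) := by rw [two_smul]; abel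
    rw [hac, hac', add_zero] at h2
    exact (smul_eq_zero.1 h2).resolve_left two_ne_zero
  have hc0 : c = 0 := by
    rw [ha0, zero_add] at hac'
    exact (smul_eq_zero.1 hac').resolve_left fun h => by simp [h] at hδ
  have hb0 : b = e 7 * (e 6 * (e 5 * (e 4 * (e 3 * (e 2 * (e 1 * (e 0 * c))))))) := by
    have h2 : ∀ k < 9, ∀ y, e k * (e k * y) = y := fun k hk y => by
      rw [← mul_assoc, gen_mul_self hk, one_mul]
    simp only [c]
    rw [h2 0 (by omega), h2 1 (by omega), h2 2 (by omega), h2 3 (by omega), h2 4 (by omega),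
      h2 5 (by omega), h2 6 (by omega), h2 7 (by omega)]
  rw [ha0, hb0, hc0]
  simp only [mul_zero, zero_mul, add_zero]

/-! ### The topology of the spin group -/

instance (n : ℕ) : IsModuleTopology ℝ (CliffordAlgebra (stdForm n)) := ⟨rfl⟩

/-- The image of an element of the spin group in the operators on `ℝ^{2l}`. -/
def spinOp {m l : ℕ} (C : SymmetricCliffordSystem m l) (g : Spin (m + 1)) :
    Space l →L[ℝ] Space l :=
  op (C.rep (g : CliffordAlgebra (stdForm (m + 1))))

/-- The representation, valued in operators, as a linear map. -/
def repOp {m l : ℕ} (C : SymmetricCliffordSystem m l) :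
    CliffordAlgebra (stdForm (m + 1)) →ₐ[ℝ] (Space l →L[ℝ] Space l) :=
  ((Matrix.toEuclideanCLM (n := Fin (2 * l)) (𝕜 := ℝ)).toAlgEquiv : _ →ₐ[ℝ] _).comp C.rep

theorem repOp_apply {m l : ℕ} (C : SymmetricCliffordSystem m l)
    (x : CliffordAlgebra (stdForm (m + 1))) : C.repOp x = op (C.rep x) := rfl

theorem repOp_eq_zero_iff {m l : ℕ} (C : SymmetricCliffordSystem m l)
    (x : CliffordAlgebra (stdForm (m + 1))) : C.repOp x = 0 ↔ C.rep x = 0 :=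
  (Matrix.toEuclideanCLM (n := Fin (2 * l)) (𝕜 := ℝ)).toAlgEquiv.map_eq_zero_iff

/-- Faithfulness on the even part gives a linear left inverse, continuous by finite dimension. It
makes Spin(9) a topological subspace of the operators. -/
theorem exists_repOp_leftInverse (hC : C.IsDefinite) :
    ∃ L : (Space 16 →L[ℝ] Space 16) →ₗ[ℝ] CliffordAlgebra (stdForm (8 + 1)),
      Continuous L ∧ ∀ x, involute x = x → L (C.repOp x) = x := by
  let A₀ : Submodule ℝ (CliffordAlgebra (stdForm (8 + 1))) :=
    LinearMap.eqLocus (involute (Q := stdForm (8 + 1))).toLinearMap LinearMap.id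
  let f : A₀ →ₗ[ℝ] (Space 16 →L[ℝ] Space 16) := C.repOp.toLinearMap ∘ₗ A₀.subtype
  have hf : LinearMap.ker f = ⊥ := by
    rw [LinearMap.ker_eq_bot']
    rintro ⟨x, hx⟩ h
    exact Subtype.ext (eq_zero_of_rep_eq_zero hC hx ((C.repOp_eq_zero_iff x).1 h))
  obtain ⟨L, hL⟩ := f.exists_leftInverse_of_injective hf
  have : IsTopologicalAddGroup (CliffordAlgebra (stdForm (8 + 1))) :=
    IsModuleTopology.topologicalAddGroup ℝ _
  have : ContinuousSMul ℝ (CliffordAlgebra (stdForm (8 + 1))) :=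
    IsModuleTopology.toContinuousSMul ℝ _
  refine ⟨A₀.subtype ∘ₗ L, LinearMap.continuous_of_finiteDimensional _, fun x hx => ?_⟩
  exact congrArg Subtype.val (LinearMap.congr_fun hL ⟨x, hx⟩)

theorem continuous_repOp {m l : ℕ} (C : SymmetricCliffordSystem m l) : Continuous C.repOp :=
  IsModuleTopology.continuous_of_linearMap C.repOp.toLinearMap

theorem isEmbedding_spinOp (hC : C.IsDefinite) : Topology.IsEmbedding C.spinOp := by
  obtain ⟨L, hL, hL'⟩ := exists_repOp_leftInverse hC
  refine Topology.IsEmbedding.of_comp (g := L) (C.continuous_repOp.comp continuous_subtype_val) hL ?_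
  have h : L ∘ C.spinOp = Subtype.val := by
    ext g
    exact hL' _ (spinGroup.involute_eq g.2)
  rw [h]
  exact Topology.IsEmbedding.subtypeVal

end SymmetricCliffordSystem

/-! ### Products of unit vectors in the spin group -/

namespace SpinPair

open CliffordAlgebra

variable {n : ℕ}

theorem ι_mul_self_of_unit {u : Fin n → ℝ} (hu : stdForm n u = 1) :
    ι (stdForm n) u * ι (stdForm n) u = 1 := by
  rw [ι_sq_scalar, hu, map_one]

/-- A unit vector as a unit of the Clifford algebra. -/
def unitOfVec (u : Fin n → ℝ) (hu : stdForm n u = 1) : (CliffordAlgebra (stdForm n))ˣ :=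
  ⟨ι _ u, ι _ u, ι_mul_self_of_unit hu, ι_mul_self_of_unit hu⟩

theorem star_ι_mul_ι (u v : Fin n → ℝ) :
    star (ι (stdForm n) u * ι (stdForm n) v) = ι (stdForm n) v * ι (stdForm n) u := by
  rw [star_mul, star_ι, star_ι, neg_mul_neg]

theorem ι_mul_ι_mem_spinGroup {u v : Fin n → ℝ} (hu : stdForm n u = 1) (hv : stdForm n v = 1) :
    ι (stdForm n) u * ι (stdForm n) v ∈ spinGroup (stdForm n) := by
  refine ⟨⟨⟨unitOfVec u hu * unitOfVec v hv, ?_, rfl⟩, ?_⟩, ?_⟩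
  · exact mul_mem (Subgroup.subset_closure ⟨u, rfl⟩) (Subgroup.subset_closure ⟨v, rfl⟩)
  · rw [SetLike.mem_coe, Unitary.mem_iff, star_ι_mul_ι]
    constructor
    · rw [mul_assoc, ← mul_assoc (ι _ u), ι_mul_self_of_unit hu, one_mul, ι_mul_self_of_unit hv]
    · rw [mul_assoc, ← mul_assoc (ι _ v), ι_mul_self_of_unit hv, one_mul, ι_mul_self_of_unit hu]
  · exact ι_mul_ι_mem_evenOdd_zero _ _ _

/-- The product of two unit vectors, as an element of the spin group. -/
def spinPair (u v : Fin n → ℝ) (hu : stdForm n u = 1) (hv : stdForm n v = 1) : Spin n :=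
  ⟨_, ι_mul_ι_mem_spinGroup hu hv⟩

theorem stdForm_eq_norm_sq (v : EuclideanSpace ℝ (Fin n)) : stdForm n v.ofLp = ‖v‖ ^ 2 := by
  rw [EuclideanSpace.norm_sq_eq, QuadraticMap.weightedSumSquares_apply]
  exact Finset.sum_congr rfl fun i _ => by rw [one_smul, Real.norm_eq_abs, sq_abs, sq]

theorem polar_stdForm (v w : EuclideanSpace ℝ (Fin n)) :
    QuadraticMap.polar (stdForm n) v.ofLp w.ofLp = 2 * inner ℝ v w := by
  rw [QuadraticMap.polar, ← WithLp.ofLp_add, stdForm_eq_norm_sq, stdForm_eq_norm_sq,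
    stdForm_eq_norm_sq, norm_add_sq_real]
  ring

/-- Clifford multiplication by a unit vector implements the reflection up to sign. -/
theorem ι_mul_ι_reflection {u : EuclideanSpace ℝ (Fin n)} (hu : ‖u‖ = 1)
    (w : EuclideanSpace ℝ (Fin n)) : ι (stdForm n) u.ofLp * ι (stdForm n) w.ofLp =
      -(ι (stdForm n) ((ℝ ∙ u)ᗮ.reflection w).ofLp * ι (stdForm n) u.ofLp) := by
  have hu' : stdForm n u.ofLp = 1 := by rw [stdForm_eq_norm_sq, hu, one_pow]
  have h := ι_mul_ι_add_swap (Q := stdForm n) u.ofLp w.ofLp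
  rw [polar_stdForm] at h
  rw [Submodule.reflection_orthogonal_apply, Submodule.reflection_singleton_apply]
  simp only [RCLike.ofReal_real_eq_id, id, hu, one_pow, div_one, WithLp.ofLp_neg, WithLp.ofLp_sub,
    WithLp.ofLp_smul, map_neg, map_sub, map_smul, neg_mul, sub_mul, neg_neg, smul_mul_assoc,
    ι_mul_self_of_unit hu']
  rw [eq_sub_of_add_eq h, Algebra.algebraMap_eq_smul_one, two_smul, mul_smul, two_smul]
  simp only [map_add, map_smul, add_mul, smul_mul_assoc, ι_mul_self_of_unit hu']

theorem isometry_mul_apply {V : Type*} [SeminormedAddCommGroup V] [Module ℝ V]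
    (φ ψ : V ≃ₗᵢ[ℝ] V) (v : V) : (φ * ψ) v = φ (ψ v) := rfl

/-- The linear isometries that are implemented, up to a sign, by products of unit vectors. -/
def HasLift (φ : EuclideanSpace ℝ (Fin n) ≃ₗᵢ[ℝ] EuclideanSpace ℝ (Fin n)) : Prop :=
  (∃ g : Spin n, ∀ v, (g : CliffordAlgebra (stdForm n)) * ι (stdForm n) v.ofLp =
    ι (stdForm n) (φ v).ofLp * g) ∨
  (∃ (g : Spin n) (u : Fin n → ℝ), stdForm n u = 1 ∧ ∀ v,
    ι (stdForm n) u * (g : CliffordAlgebra (stdForm n)) * ι (stdForm n) v.ofLp =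
    -(ι (stdForm n) (φ v).ofLp * (ι (stdForm n) u * g)))

/-- Multiplying by one more unit vector exchanges the even and the odd alternative. -/
theorem HasLift.reflection_mul {φ : EuclideanSpace ℝ (Fin n) ≃ₗᵢ[ℝ] EuclideanSpace ℝ (Fin n)}
    (h : HasLift φ) (u : EuclideanSpace ℝ (Fin n)) :
    HasLift ((ℝ ∙ u)ᗮ.reflection * φ) := by
  by_cases hu0 : u = 0
  · have h1 : (ℝ ∙ u)ᗮ.reflection * φ = φ := by
      subst hu0
      ext1 v
      rw [isometry_mul_apply, Submodule.reflection_orthogonal_apply,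
        Submodule.reflection_singleton_apply]
      simp
    rwa [h1]
  · obtain ⟨t, ht, hspan⟩ : ∃ t : EuclideanSpace ℝ (Fin n), ‖t‖ = 1 ∧ (ℝ ∙ u) = ℝ ∙ t := by
      refine ⟨‖u‖⁻¹ • u, ?_, ?_⟩
      · rw [norm_smul, norm_inv, norm_norm, inv_mul_cancel₀ (norm_ne_zero_iff.2 hu0)]
      · exact (Submodule.span_singleton_smul_eq
          (IsUnit.mk0 _ (inv_ne_zero (norm_ne_zero_iff.2 hu0))) u).symm
    simp only [hspan]
    have ht' : stdForm n t.ofLp = 1 := by rw [stdForm_eq_norm_sq, ht, one_pow]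
    rcases h with ⟨g, hg⟩ | ⟨g, w, hw, hg⟩
    · refine Or.inr ⟨g, t.ofLp, ht', fun v => ?_⟩
      rw [mul_assoc, hg, ← mul_assoc, ι_mul_ι_reflection ht, isometry_mul_apply,
        neg_mul, mul_assoc]
    · refine Or.inl ⟨spinPair t.ofLp w ht' hw * g, fun v => ?_⟩
      have hc : ((spinPair t.ofLp w ht' hw * g : Spin n) : CliffordAlgebra (stdForm n)) =
        ι (stdForm n) t.ofLp * (ι (stdForm n) w * g) := mul_assoc _ _ _
      rw [hc, mul_assoc, hg, mul_neg, ← mul_assoc, ι_mul_ι_reflection ht,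
        isometry_mul_apply, neg_mul, neg_neg, mul_assoc]

theorem hasLift (φ : EuclideanSpace ℝ (Fin n) ≃ₗᵢ[ℝ] EuclideanSpace ℝ (Fin n)) : HasLift φ := by
  obtain ⟨l, -, rfl⟩ := LinearIsometryEquiv.reflections_generate_dim φ
  induction l with
  | nil => exact Or.inl ⟨1, fun v => by simp⟩
  | cons u l ih => exact HasLift.reflection_mul ih u

/-- Isometries of the standard form are implemented, up to a sign, by products of unit vectors. -/
theorem exists_lift (f : (Fin n → ℝ) →ₗ[ℝ] (Fin n → ℝ))
    (hf : ∀ v, stdForm n (f v) = stdForm n v) :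
    (∃ g : Spin n, ∀ v, (g : CliffordAlgebra (stdForm n)) * ι (stdForm n) v =
      ι (stdForm n) (f v) * g) ∨
    (∃ (g : Spin n) (u : Fin n → ℝ), stdForm n u = 1 ∧ ∀ v,
      ι (stdForm n) u * (g : CliffordAlgebra (stdForm n)) * ι (stdForm n) v =
      -(ι (stdForm n) (f v) * (ι (stdForm n) u * g))) := by
  let F : EuclideanSpace ℝ (Fin n) →ₗᵢ[ℝ] EuclideanSpace ℝ (Fin n) :=
    ⟨(WithLp.linearEquiv 2 ℝ (Fin n → ℝ)).symm.toLinearMap ∘ₗ f ∘ₗ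
      (WithLp.linearEquiv 2 ℝ (Fin n → ℝ)).toLinearMap, fun v => by
      refine (sq_eq_sq₀ (norm_nonneg _) (norm_nonneg _)).1 ?_
      rw [← stdForm_eq_norm_sq, ← stdForm_eq_norm_sq]
      exact hf _⟩
  have h := hasLift (F.toLinearIsometryEquiv rfl)
  rcases h with ⟨g, hg⟩ | ⟨g, u, hu, hg⟩
  · exact Or.inl ⟨g, fun v => hg (WithLp.toLp 2 v)⟩
  · exact Or.inr ⟨g, u, hu, fun v => hg (WithLp.toLp 2 v)⟩

end SpinPair

/-! ### The spin representation in octonionic terms -/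

theorem eq_zero_of_eq_neg {V : Type*} [AddCommGroup V] [Module ℝ V] {x : V} (h : x = -x) :
    x = 0 := by
  have h2 : (2 : ℝ) • x = 0 := by
    rw [two_smul]
    nth_rewrite 1 [h]
    exact neg_add_cancel x
  exact (smul_eq_zero.1 h2).resolve_left two_ne_zero

theorem octDot_eq_zero_of_forall {x : Octonions} (h : ∀ y, octDot y x = 0) : x = 0 :=
  octDot_self_eq_zero.1 (h x)

/-- A polar decomposition in the octonions. -/
theorem exists_eq_smul_unit (q : Octonions) :
    ∃ (a : ℝ) (v : Octonions), octDot v v = 1 ∧ q = a • v := by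
  by_cases hq : q = 0
  · exact ⟨0, octOne, by rw [octDot_one_left, octRe_one], by rw [hq, zero_smul]⟩
  · have h := octDot_self_pos hq
    have hs := Real.sqrt_ne_zero'.2 h
    refine ⟨√(octDot q q), (√(octDot q q))⁻¹ • q, ?_, ?_⟩
    · rw [octDot_smul_left, octDot_smul_right, ← mul_assoc, ← mul_inv, Real.mul_self_sqrt h.le,
        inv_mul_cancel₀ h.ne']
    · rw [smul_smul, mul_inv_cancel₀ hs, one_smul]

theorem cliffordOp_self (v : ℝ × Octonions) (x : Spinors) :
    cliffordOp v (cliffordOp v x) = (v.1 * v.1 + octDot v.2 v.2) • x := by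
  simp only [cliffordOp_apply, octMul_add, octMul_sub, octMul_smul, octConj_octMul_octMul,
    octMul_octConj_octMul]
  refine Prod.ext ?_ ?_
  · simp only [Prod.smul_fst]
    module
  · simp only [Prod.smul_snd]
    module

theorem cliffordOp_add (v w : ℝ × Octonions) : cliffordOp (v + w) = cliffordOp v + cliffordOp w := by
  refine LinearMap.ext fun x => ?_
  rw [LinearMap.add_apply]
  simp only [cliffordOp_apply, Prod.fst_add, Prod.snd_add, octConj_add, add_octMul]
  refine Prod.ext ?_ ?_ <;> simp only [Prod.fst_add, Prod.snd_add] <;> module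

theorem cliffordOp_smul (a : ℝ) (v : ℝ × Octonions) :
    cliffordOp (a • v) = a • cliffordOp v := by
  refine LinearMap.ext fun x => ?_
  rw [LinearMap.smul_apply]
  simp only [cliffordOp_apply, Prod.smul_fst, Prod.smul_snd, octConj_smul, smul_octMul]
  refine Prod.ext ?_ ?_ <;> simp only [Prod.smul_fst, Prod.smul_snd] <;> module

/-- `cliffordOp` as a linear map in the vector. -/
def cliffordOpₗ : (ℝ × Octonions) →ₗ[ℝ] Spinors →ₗ[ℝ] Spinors where
  toFun := cliffordOp
  map_add' := cliffordOp_add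
  map_smul' := cliffordOp_smul

/-- The quadratic map from spinors to vectors. -/
def spinorSq (x : Spinors) : ℝ × Octonions :=
  (octDot x.1 x.1 - octDot x.2 x.2, (2 : ℝ) • (x.2 ⋆ octConj x.1))

/-- All nine quadratic forms ⟨Pᵢ x, x⟩ are the coordinates of the single vector `spinorSq x`. -/
theorem spinorDot_cliffordOp_self (v : ℝ × Octonions) (x : Spinors) :
    spinorDot (cliffordOp v x) x = v.1 * (spinorSq x).1 + octDot v.2 (spinorSq x).2 := by
  simp only [spinorDot, cliffordOp_apply, spinorSq, octDot_add_left, octDot_smul_left,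
    octDot_smul_right, sub_eq_add_neg, octDot_neg_left]
  rw [octDot_comm x.2, octDot_comm x.1, octDot_octMul_left, octConj_conj, octDot_comm x.2,
    octDot_octMul_right]
  ring

namespace SymmetricCliffordSystem
namespace SpinorModel

open CliffordAlgebra SpinPair

variable {C : SymmetricCliffordSystem 8 16} (M : C.SpinorModel)

/-- The representation of the Clifford algebra on spinors. -/
def spinRep : CliffordAlgebra (stdForm (8 + 1)) →ₐ[ℝ] Module.End ℝ Spinors :=
  lift (stdForm (8 + 1)) ⟨cliffordOpₗ ∘ₗ M.e.symm.toLinearMap, fun v => by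
    refine LinearMap.ext fun x => ?_
    change cliffordOp (M.e.symm v) (cliffordOp (M.e.symm v) x) = _
    rw [cliffordOp_self, ← M.stdForm_e, M.e.apply_symm_apply, Algebra.algebraMap_eq_smul_one]
    rfl⟩

theorem spinRep_ι (v : ℝ × Octonions) : M.spinRep (ι (stdForm (8 + 1)) (M.e v)) = cliffordOp v := by
  rw [spinRep, lift_ι_apply]
  change cliffordOp (M.e.symm (M.e v)) = _
  rw [M.e.symm_apply_apply]

theorem repOp_Ψ (a : CliffordAlgebra (stdForm (8 + 1))) (x : Spinors × Spinors) :
    C.repOp a (M.Ψ x) = M.Ψ (M.spinRep a x.1, M.spinRep a x.2) := by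
  induction a using CliffordAlgebra.induction generalizing x with
  | algebraMap r =>
    rw [AlgHom.commutes, AlgHom.commutes, Algebra.algebraMap_eq_smul_one,
      Algebra.algebraMap_eq_smul_one]
    change r • M.Ψ x = M.Ψ (r • x.1, r • x.2)
    rw [← map_smul]
    rfl
  | ι v =>
    obtain ⟨v, rfl⟩ := M.e.surjective v
    rw [repOp_apply, rep_ι, M.op_vec, spinRep_ι]
  | mul a b ha hb =>
    rw [map_mul, map_mul]
    change C.repOp a (C.repOp b (M.Ψ x)) = _
    rw [hb, ha]
    rfl
  | add a b ha hb =>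
    rw [map_add, map_add, add_apply, ha, hb, ← map_add]
    rfl

theorem spinOp_Ψ (g : Spin (8 + 1)) (x : Spinors × Spinors) :
    C.spinOp g (M.Ψ x) = M.Ψ (M.spinRep g x.1, M.spinRep g x.2) :=
  M.repOp_Ψ g x

theorem spinRep_mul (g h : Spin (8 + 1)) (x : Spinors) :
    M.spinRep (g * h : Spin (8 + 1)) x = M.spinRep g (M.spinRep h x) := by
  rw [Submonoid.coe_mul, map_mul]
  rfl

theorem spinRep_one (x : Spinors) : M.spinRep (1 : Spin (8 + 1)) x = x := by
  rw [Submonoid.coe_one, map_one]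
  rfl

theorem spinRep_inv_apply (g : Spin (8 + 1)) (x : Spinors) :
    M.spinRep (g⁻¹ : Spin (8 + 1)) (M.spinRep g x) = x := by
  rw [← spinRep_mul, inv_mul_cancel, spinRep_one]

theorem spinRep_apply_inv (g : Spin (8 + 1)) (x : Spinors) :
    M.spinRep g (M.spinRep (g⁻¹ : Spin (8 + 1)) x) = x := by
  rw [← spinRep_mul, mul_inv_cancel, spinRep_one]

theorem stdForm_e_eq_one {v : ℝ × Octonions} (hv : v.1 * v.1 + octDot v.2 v.2 = 1) :
    stdForm (8 + 1) (M.e v) = 1 := by rw [M.stdForm_e, hv]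

theorem exists_spinRep_eq_cliffordOp {v w : ℝ × Octonions}
    (hv : v.1 * v.1 + octDot v.2 v.2 = 1) (hw : w.1 * w.1 + octDot w.2 w.2 = 1) :
    ∃ g : Spin (8 + 1), ∀ x, M.spinRep g x = cliffordOp v (cliffordOp w x) :=
  ⟨spinPair (M.e v) (M.e w) (M.stdForm_e_eq_one hv) (M.stdForm_e_eq_one hw), fun x => by
    change M.spinRep (ι _ (M.e v) * ι _ (M.e w)) x = _
    rw [map_mul, spinRep_ι, spinRep_ι]
    rfl⟩

theorem spinorDot_spinRep (g : Spin (8 + 1)) (x y : Spinors) :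
    spinorDot (M.spinRep g x) (M.spinRep g y) = spinorDot x y := by
  have h : inner ℝ (C.spinOp g (M.Ψ (x, 0))) (C.spinOp g (M.Ψ (y, 0))) =
      inner ℝ (M.Ψ (x, 0)) (M.Ψ (y, 0)) := by
    rw [spinOp, inner_op_rep, op_op, ← map_mul, spinGroup.coe_star_mul_self, map_one, op_one]
  rw [spinOp_Ψ, spinOp_Ψ, M.inner_Ψ, M.inner_Ψ] at h
  simpa [spinorDot, octDot_zero_left] using h

theorem exists_vector_image (g : Spin (8 + 1)) (v : ℝ × Octonions) :
    ∃ w : ℝ × Octonions, ∀ x, M.spinRep g (cliffordOp v x) = cliffordOp w (M.spinRep g x) := by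
  obtain ⟨w, hw⟩ := spinGroup.conjAct_smul_ι_mem_range_ι (x := spinGroup.toUnits g) g.2 (M.e v)
  rw [ConjAct.units_smul_def, ConjAct.ofConjAct_toConjAct] at hw
  obtain ⟨w, rfl⟩ := M.e.surjective w
  refine ⟨w, fun x => ?_⟩
  have h : ι (stdForm (8 + 1)) (M.e w) * (g : CliffordAlgebra (stdForm (8 + 1))) =
      g * ι (stdForm (8 + 1)) (M.e v) := by
    have h1 := congrArg (· * (g : CliffordAlgebra (stdForm (8 + 1)))) hw
    change _ = (g : CliffordAlgebra (stdForm (8 + 1))) * ι _ (M.e v) *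
      ((g⁻¹ : Spin (8 + 1)) : CliffordAlgebra (stdForm (8 + 1))) *
      (g : CliffordAlgebra (stdForm (8 + 1))) at h1
    have h2 : ((g⁻¹ : Spin (8 + 1)) : CliffordAlgebra (stdForm (8 + 1))) * g = 1 :=
      spinGroup.coe_star_mul_self g
    rwa [mul_assoc, h2, mul_one] at h1
  have h3 := congrArg (fun a => M.spinRep a x) h
  simp only [map_mul, spinRep_ι] at h3
  exact h3.symm

/-! ### Transitivity -/

/-- Transitivity on the unit sphere of 𝕆². With p = a u and |u| = 1, the product of the vectors (0,
1) and (0, ū) moves (p, q) to (a, u q). With u q = b v and |v| = 1, the unit vector (a, b v) sends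
(a, b v) to (a² + b², 0), and (1, 0) makes the number of factors even. -/
theorem exists_spinRep_eq_one {x : Spinors} (hx : spinorDot x x = 1) :
    ∃ g : Spin (8 + 1), M.spinRep g x = (octOne, 0) := by
  obtain ⟨p, q⟩ := x
  obtain ⟨a, u, hu, rfl⟩ := exists_eq_smul_unit p
  obtain ⟨g₁, hg₁⟩ := M.exists_spinRep_eq_cliffordOp (v := (0, octOne)) (w := (0, octConj u))
    (by simp [octDot_one_left, octRe_one]) (by simp [octDot_conj_conj, hu])
  obtain ⟨b, v, hv, hq⟩ := exists_eq_smul_unit (u ⋆ q)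
  have hab : a * a + b * b = 1 := by
    have h1 : octDot (u ⋆ q) (u ⋆ q) = octDot q q := by rw [octDot_mul_mul, hu, one_mul]
    rw [hq] at h1
    simp only [spinorDot, octDot_smul_left, octDot_smul_right, hu, hv] at hx h1
    linarith
  obtain ⟨g₂, hg₂⟩ := M.exists_spinRep_eq_cliffordOp (v := (1, 0)) (w := (a, b • v))
    (by simp [octDot_zero_left]) (by simp [octDot_smul_left, octDot_smul_right, hv, hab])
  refine ⟨g₂ * g₁, ?_⟩
  rw [spinRep_mul, hg₁, hg₂]
  simp only [cliffordOp_apply, octConj_conj, zero_smul, zero_add, sub_zero, octConj_one,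
    octOne_mul, one_smul, octConj_zero, zero_octMul, add_zero, zero_sub, octMul_smul, hq,
    octConj_mul_self, hu]
  refine Prod.ext ?_ ?_
  · simp only [octConj_smul, smul_octMul, octConj_mul_self, hv, one_smul, smul_smul, ← add_smul,
      hab]
  · simp only [smul_octMul, octMul_one, smul_smul]
    rw [mul_comm, sub_self, neg_zero]

/-- Take x with x² = z and an imaginary unit j orthogonal to x. The vectors (0, x)(0, 1) send the
spinors (1, 0) and (0, 1) to (x̄, 0) and (0, x). Then (0, j)(0, jx) brings (x̄, 0) back to (1, 0),
and sends (0, x) to (0, x²) because jx is imaginary. -/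
theorem exists_spinRep_fixing_one {z : Octonions} (hz : octDot z z = 1) :
    ∃ g : Spin (8 + 1), M.spinRep g (octOne, 0) = (octOne, 0) ∧
      M.spinRep g (0, octOne) = (0, z) := by
  obtain ⟨x, hx, rfl⟩ := exists_octMul_self_eq hz
  obtain ⟨j, hj, hj0, hjx⟩ := exists_imaginary_unit_orthogonal x
  obtain ⟨g₁, hg₁⟩ := M.exists_spinRep_eq_cliffordOp (v := (0, x)) (w := (0, octOne))
    (by simp [hx]) (by simp [octDot_one_left, octRe_one])
  obtain ⟨g₂, hg₂⟩ := M.exists_spinRep_eq_cliffordOp (v := (0, j)) (w := (0, j ⋆ x))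
    (by simp [hj]) (by simp [octDot_mul_mul, hj, hx])
  have hjc : octConj j = -j := by rw [octConj_eq, hj0]; simp
  have hjxc : octConj (j ⋆ x) = -(j ⋆ x) := by
    rw [octConj_mul, hjc, octMul_neg, octMul_eq_conj_mul hj0 hjx]
  have hjj : j ⋆ j = -octOne := by rw [octMul_self, hj0, hj]; simp
  refine ⟨g₂ * g₁, ?_, ?_⟩
  · rw [spinRep_mul, hg₁, hg₂]
    simp only [cliffordOp_apply, zero_smul, zero_add, sub_zero, octOne_mul, octMul_one,
      octMul_zero, octMul_octMul_octConj, hx, one_smul, octConj_mul_self, hj]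
  · rw [spinRep_mul, hg₁, hg₂]
    simp only [cliffordOp_apply, zero_smul, zero_add, sub_zero, octOne_mul, octMul_one,
      octMul_zero, octConj_one, hjxc, octMul_octMul_self]
    have h1 : (j ⋆ x) ⋆ x = j ⋆ (x ⋆ x) := by
      have := octMul_octMul_self (octConj x) (octConj j)
      have h2 := congrArg octConj this
      simpa only [octConj_mul, octConj_conj] using h2
    rw [neg_octMul, octMul_neg, h1, octMul_octMul_self, hjj, neg_octMul, octOne_mul, neg_neg]

theorem Ψ_mem_focalPlus_iff (x : Spinors × Spinors) : M.Ψ x ∈ C.focalPlus ↔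
    spinorDot x.1 x.1 + spinorDot x.2 x.2 = 1 ∧ spinorSq x.1 + spinorSq x.2 = 0 := by
  rw [mem_focalPlus_iff]
  refine and_congr ?_ ?_
  · rw [← M.inner_Ψ, real_inner_self_eq_norm_sq,
      pow_eq_one_iff_of_nonneg (norm_nonneg _) two_ne_zero]
  · have hv : ∀ v : ℝ × Octonions, inner ℝ (op (C.vec (M.e v)) (M.Ψ x)) (M.Ψ x) =
        v.1 * (spinorSq x.1 + spinorSq x.2).1 + octDot v.2 (spinorSq x.1 + spinorSq x.2).2 :=
      fun v => by
        rw [M.op_vec, M.inner_Ψ, spinorDot_cliffordOp_self, spinorDot_cliffordOp_self,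
          Prod.fst_add, Prod.snd_add, octDot_add_right]
        ring
    constructor
    · intro h
      have h0 : ∀ v : ℝ × Octonions, inner ℝ (op (C.vec (M.e v)) (M.Ψ x)) (M.Ψ x) = (0 : ℝ) :=
        fun v => by
          unfold op at h ⊢
          simp only [vec_apply, map_sum, map_smul, sum_apply, smul_apply, sum_inner,
            real_inner_smul_left, h, mul_zero, Finset.sum_const_zero]
      simp only [hv] at h0
      refine Prod.ext ?_ (octDot_eq_zero_of_forall fun y => ?_)
      · simpa [octDot_zero_left] using h0 (1, 0)
      · simpa using h0 (0, y)
    · intro h i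
      obtain ⟨v, hi⟩ := M.e.surjective (Pi.single i 1)
      have hP : C.P i = C.vec (M.e v) := by
        rw [hi, vec_apply]
        simp [Pi.single_apply]
      rw [hP, hv, h]
      simp [octDot_zero_right]

/-- The base point of `M₊`. -/
def basePoint : Space 16 := (√2)⁻¹ • M.Ψ ((octOne, 0), (0, octOne))

theorem basePoint_eq : M.basePoint = M.Ψ (((√2)⁻¹ • octOne, 0), (0, (√2)⁻¹ • octOne)) := by
  rw [basePoint, ← map_smul]
  simp only [Prod.smul_mk, smul_zero]

theorem inv_sqrt_two_mul_self : (√2)⁻¹ * (√2)⁻¹ = (2 : ℝ)⁻¹ := by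
  rw [← mul_inv, Real.mul_self_sqrt zero_le_two]

theorem basePoint_mem : M.basePoint ∈ C.focalPlus := by
  rw [basePoint_eq, Ψ_mem_focalPlus_iff]
  have h1 : octDot octOne octOne = 1 := by rw [octDot_one_left, octRe_one]
  constructor
  · simp only [spinorDot, octDot_smul_left, octDot_smul_right, h1, octDot_zero_left]
    linear_combination 2 * inv_sqrt_two_mul_self
  · refine Prod.ext ?_ ?_ <;>
      simp [spinorSq, octDot_zero_left, octConj_zero, octMul_zero, zero_octMul]

theorem exists_spinOp_basePoint_eq {y : Space 16} (hy : y ∈ C.focalPlus) :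
    ∃ g : Spin (8 + 1), C.spinOp g M.basePoint = y := by
  obtain ⟨⟨a, b⟩, rfl⟩ := M.Ψ.surjective y
  have hy' := (M.Ψ_mem_focalPlus_iff _).1 hy
  have hs0 : (√2 : ℝ) ≠ 0 := by positivity
  have hs2 : (√2 : ℝ) * √2 = 2 := Real.mul_self_sqrt zero_le_two
  -- The identity |q(x)| = |x|². Since q(a) = -q(b), the two spinors have the same norm.
  have hnorm : ∀ x : Spinors, spinorDot x x * spinorDot x x =
      (spinorSq x).1 * (spinorSq x).1 + octDot (spinorSq x).2 (spinorSq x).2 := fun x => by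
    simp only [spinorDot, spinorSq, octDot_smul_left, octDot_smul_right, octDot_mul_mul,
      octDot_conj_conj]
    ring
  have hpos : ∀ x : Spinors, 0 ≤ spinorDot x x := fun x =>
    add_nonneg (octDot_self_nonneg _) (octDot_self_nonneg _)
  have ha : spinorDot a a = 1 / 2 := by
    have h1 := hnorm a
    have h2 := hnorm b
    rw [eq_neg_of_add_eq_zero_left hy'.2] at h1
    simp only [Prod.fst_neg, Prod.snd_neg, octDot_neg_left, octDot_neg_right, neg_neg,
      neg_mul_neg] at h1
    have h3 := (mul_self_eq_mul_self_iff.1 (h1.trans h2.symm)).resolve_right fun h => by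
      linarith [hpos a, hpos b, hy'.1]
    linarith [hy'.1]
  obtain ⟨g, hg⟩ := M.exists_spinRep_eq_one (x := √2 • a) (by
    simp only [spinorDot, Prod.smul_fst, Prod.smul_snd, octDot_smul_left, octDot_smul_right] at ha ⊢
    linear_combination 2 * ha + (octDot a.1 a.1 + octDot a.2 a.2) * hs2)
  rw [map_smul] at hg
  have hga : M.spinRep g a = ((√2)⁻¹ • octOne, 0) := by
    rw [← inv_smul_smul₀ hs0 (M.spinRep g a), hg, Prod.smul_mk, smul_zero]
  have hmem : C.spinOp g (M.Ψ (a, b)) ∈ C.focalPlus := C.op_rep_mem g hy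
  rw [spinOp_Ψ, Ψ_mem_focalPlus_iff] at hmem
  obtain ⟨p, q, hpq⟩ : ∃ p q, M.spinRep g b = (p, q) := ⟨_, _, rfl⟩
  rw [hga, hpq] at hmem
  have h1 : octDot octOne octOne = 1 := by rw [octDot_one_left, octRe_one]
  obtain ⟨e1, e2⟩ := hmem
  have e3 := congrArg Prod.fst e2
  simp only [spinorDot, spinorSq, Prod.fst_add, Prod.fst_zero, octDot_smul_left,
    octDot_smul_right, h1, octDot_zero_left, mul_one, add_zero, sub_zero,
    inv_sqrt_two_mul_self] at e1 e3
  -- The equations read |p|² + |q|² = 1/2 and |p|² - |q|² = -1/2.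
  obtain rfl : p = 0 := octDot_self_eq_zero.1 (by linarith)
  rw [octDot_zero_left] at e1
  obtain ⟨h, hh1, hh2⟩ := M.exists_spinRep_fixing_one (z := √2 • q) (by
    rw [octDot_smul_left, octDot_smul_right, ← mul_assoc, hs2]
    linarith)
  refine ⟨g⁻¹ * h, ?_⟩
  have hz : ∀ x : Octonions, ((0, (√2)⁻¹ • x) : Spinors) = (√2)⁻¹ • (0, x) := fun x =>
    Prod.ext (smul_zero _).symm rfl
  have hz' : ∀ x : Octonions, (((√2)⁻¹ • x, 0) : Spinors) = (√2)⁻¹ • (x, 0) := fun x =>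
    Prod.ext rfl (smul_zero _).symm
  have k1 : M.spinRep h ((√2)⁻¹ • octOne, 0) = ((√2)⁻¹ • octOne, 0) := by
    rw [hz', map_smul, hh1]
  have k2 : M.spinRep h (0, (√2)⁻¹ • octOne) = (0, q) := by
    rw [hz, map_smul, hh2, ← hz, inv_smul_smul₀ hs0]
  rw [basePoint_eq, spinOp_Ψ, spinRep_mul, spinRep_mul, k1, k2, ← hga, ← hpq,
    spinRep_inv_apply, spinRep_inv_apply]

theorem isPretransitive (M : C.SpinorModel) : MulAction.IsPretransitive (Spin (8 + 1)) C.focalPlus := by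
  refine ⟨fun x y => ?_⟩
  obtain ⟨g, hg⟩ := M.exists_spinOp_basePoint_eq x.2
  obtain ⟨h, hh⟩ := M.exists_spinOp_basePoint_eq y.2
  have hx : g • (⟨M.basePoint, M.basePoint_mem⟩ : C.focalPlus) = x := Subtype.ext hg
  have hy : h • (⟨M.basePoint, M.basePoint_mem⟩ : C.focalPlus) = y := Subtype.ext hh
  exact ⟨h * g⁻¹, by rw [mul_smul, ← hx, inv_smul_smul, hy]⟩

/-! ### The stabilizer of the base point -/

theorem spinOp_basePoint_eq_iff (g : Spin (8 + 1)) : C.spinOp g M.basePoint = M.basePoint ↔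
    M.spinRep g (octOne, 0) = (octOne, 0) ∧ M.spinRep g (0, octOne) = (0, octOne) := by
  have hs0 : (√2 : ℝ)⁻¹ ≠ 0 := by positivity
  rw [basePoint, map_smul, (smul_right_injective _ hs0).eq_iff, spinOp_Ψ, M.Ψ.injective.eq_iff,
    Prod.ext_iff]

/-- The automorphism of the octonions that an element of the stabilizer of the base point
determines, as a function. -/
def octMap (g : Spin (8 + 1)) : Octonions →ₗ[ℝ] Octonions :=
  LinearMap.fst ℝ _ _ ∘ₗ M.spinRep g ∘ₗ LinearMap.inl ℝ _ _

theorem octMap_apply (g : Spin (8 + 1)) (p : Octonions) :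
    M.octMap g p = (M.spinRep g (p, 0)).1 := rfl

section
variable {g : Spin (8 + 1)} (h1 : M.spinRep g (octOne, 0) = (octOne, 0))
  (h2 : M.spinRep g (0, octOne) = (0, octOne))
include h1 h2

/-- Conjugation by g sends the vector (0, w) to some (τ, η). Since (0, w) maps (1, 0) to the spinor
(0, w), which is orthogonal to (1, 0), invariance of the inner product gives τ = 0. Comparing on (1,
0) and (0, 1) identifies w ↦ η with the action of g on both halves; comparing on (p, 0) then says
that this action is multiplicative. -/
theorem spinRep_apply_of_fixing (x : Spinors) :
    M.spinRep g x = (M.octMap g x.1, M.octMap g x.2) ∧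
    ∀ p q, M.octMap g (p ⋆ q) = M.octMap g p ⋆ M.octMap g q := by
  have key : ∀ w, ∃ η, M.spinRep g (0, w) = (0, η) ∧ M.spinRep g (octConj w, 0) = (octConj η, 0) ∧
      ∀ x, M.spinRep g (cliffordOp (0, w) x) = cliffordOp (0, η) (M.spinRep g x) := by
    intro w
    obtain ⟨⟨τ, η⟩, hη⟩ := M.exists_vector_image g (0, w)
    have e1 := hη (octOne, 0)
    have e2 := hη (0, octOne)
    rw [h1] at e1
    rw [h2] at e2
    simp only [cliffordOp_apply, zero_smul, octMul_zero, octMul_one, smul_zero, zero_add, add_zero,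
      sub_zero] at e1 e2
    have hτ : τ = 0 := by
      have h := M.spinorDot_spinRep g (0, w) (octOne, 0)
      rw [h1, e1] at h
      simpa [spinorDot, octDot_zero_left, octDot_zero_right, octDot_smul_left, octDot_one_left,
        octRe_one] using h
    subst hτ
    refine ⟨η, ?_, ?_, hη⟩
    · rw [e1, zero_smul]
    · rw [e2, zero_smul, sub_zero]
  choose β hβ1 hβ2 hβ3 using key
  have hβα : ∀ p q, (M.spinRep g (0, q ⋆ p)) = (0, β q ⋆ (M.octMap g p)) := by
    intro p q
    have h := hβ3 q (p, 0)
    have hp : M.spinRep g (p, 0) = (M.octMap g p, 0) := by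
      have h' := hβ2 (octConj p)
      rw [octConj_conj] at h'
      rw [octMap_apply, h']
    rw [hp] at h
    simpa only [cliffordOp_apply, zero_smul, octMul_zero, zero_add, sub_zero] using h
  have hβ0 : β octOne = octOne := by
    have h := hβ1 octOne
    rw [h2] at h
    exact (congrArg Prod.snd h).symm
  have hβeq : ∀ p, β p = M.octMap g p := by
    intro p
    have h := hβα p octOne
    rw [octOne_mul, hβ1, hβ0, octOne_mul] at h
    exact congrArg Prod.snd h
  refine ⟨?_, fun p q => ?_⟩
  · have hx : x = (x.1, 0) + (0, x.2) := by simp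
    rw [hx, map_add, hβ1, hβeq]
    have h' := hβ2 (octConj x.1)
    rw [octConj_conj] at h'
    have h'' : M.spinRep g (x.1, 0) = (M.octMap g x.1, 0) := by rw [octMap_apply, h']
    rw [h'']
    simp
  · have h := hβα q p
    rw [hβ1, hβeq, hβeq] at h
    exact congrArg Prod.snd h

end

/-- The diagonal action of an automorphism of the octonions on spinors. -/
def diag (f : Octonions →ₗ[ℝ] Octonions) : Spinors →ₗ[ℝ] Spinors := f.prodMap f

theorem diag_apply (f : Octonions →ₗ[ℝ] Octonions) (x : Spinors) : diag f x = (f x.1, f x.2) := rfl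

omit M in
theorem eq_zero_of_antiassoc {a : Octonions} (h : ∀ x y, (y ⋆ x) ⋆ a = x ⋆ (y ⋆ a)) : a = 0 := by
  have h1 := h (⟨0, 1, 0, 0⟩, 0) (⟨0, 0, 1, 0⟩, 0)
  have h2 := h (⟨0, 1, 0, 0⟩, 0) (0, 1)
  have h3 := h (⟨0, 0, 1, 0⟩, 0) (0, 1)
  have h4 := h (⟨0, 0, 0, 1⟩, 0) (0, 1)
  rw [octExt_iff] at h1 h2 h3 h4
  simp [octMul_coords] at h1 h2 h3 h4
  apply octExt <;> simp <;> linarith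

omit M in
-- Schur's lemma for the spin module. Commuting with (1, 0) and (0, 1) makes N diagonal, commuting
-- with all (0, w) makes it right multiplication by some a, and a lies in the nucleus of 𝕆, which is
-- real.
theorem eq_smul_of_commutes {N : Spinors →ₗ[ℝ] Spinors}
    (hN : ∀ v x, N (cliffordOp v x) = cliffordOp v (N x)) : ∃ c : ℝ, ∀ x, N x = c • x := by
  have h1 : ∀ p, (N (p, 0)).2 = 0 := fun p => by
    have h := congrArg Prod.snd (hN (1, 0) (p, 0))
    simp only [cliffordOp_apply, one_smul, octConj_zero, zero_octMul, add_zero, sub_zero,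
      zero_sub] at h
    exact eq_zero_of_eq_neg h
  have h2 : ∀ q, N (0, q) = (0, (N (q, 0)).1) := fun q => by
    have h := hN (0, octOne) (q, 0)
    simp only [cliffordOp_apply, zero_smul, octConj_one, octOne_mul, zero_add, sub_zero, h1] at h
    exact h
  have h3 : ∀ w p, (N (w ⋆ p, 0)).1 = w ⋆ (N (p, 0)).1 := fun w p => by
    have h := congrArg Prod.snd (hN (0, w) (p, 0))
    simp only [cliffordOp_apply, zero_smul, octMul_zero, zero_add, sub_zero, h2] at h
    exact h
  set a := (N (octOne, 0)).1 with ha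
  have h4 : ∀ p, (N (p, 0)).1 = p ⋆ a := fun p => by rw [← octMul_one p, h3, octMul_one]
  have h5 := eq_octRe_smul_of_assoc (a := a) fun v p => by rw [← h4, h3, h4]
  refine ⟨octRe a, fun x => ?_⟩
  have h6 : ∀ p, N (p, 0) = (octRe a • p, 0) := fun p => Prod.ext (by
    rw [h4]
    nth_rewrite 1 [h5]
    rw [octMul_smul, octMul_one]) (h1 p)
  have hx : x = (x.1, 0) + (0, x.2) := by simp
  nth_rewrite 1 [hx]
  rw [map_add, h2, h6, h6]
  simp [Prod.ext_iff]

omit M in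
-- As in the commuting case, N is determined by one octonion a, now through N(p, 0) = (0, p̄ a). The
-- vectors (0, w) force (y x) a = x (y a) for all x, y, which only a = 0 satisfies.
theorem eq_zero_of_anticommutes {N : Spinors →ₗ[ℝ] Spinors}
    (hN : ∀ v x, N (cliffordOp v x) = -cliffordOp v (N x)) (x : Spinors) : N x = 0 := by
  have h1 : ∀ p, (N (p, 0)).1 = 0 := fun p => by
    have h := congrArg Prod.fst (hN (1, 0) (p, 0))
    simp only [cliffordOp_apply, one_smul, octConj_zero, zero_octMul, add_zero, sub_zero,
      zero_sub, Prod.fst_neg] at h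
    exact eq_zero_of_eq_neg h
  have h2 : ∀ q, N (0, q) = (-(N (q, 0)).2, 0) := fun q => by
    have h := hN (0, octOne) (q, 0)
    simp only [cliffordOp_apply, zero_smul, octConj_one, octOne_mul, zero_add, sub_zero, h1] at h
    rw [h]
    simp
  have h3 : ∀ w p, (N (w ⋆ p, 0)).2 = octConj w ⋆ (N (p, 0)).2 := fun w p => by
    have h := congrArg Prod.fst (hN (0, w) (p, 0))
    simp only [cliffordOp_apply, zero_smul, octMul_zero, zero_add, sub_zero, h2,
      Prod.fst_neg, neg_inj] at h
    exact h
  set a := (N (octOne, 0)).2 with ha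
  have h4 : ∀ p, (N (p, 0)).2 = octConj p ⋆ a := fun p => by rw [← octMul_one p, h3, octMul_one]
  have h5 := eq_zero_of_antiassoc (a := a) fun x y => by
    have h := h3 (octConj x) (octConj y)
    rw [h4, h4, octConj_mul, octConj_conj, octConj_conj] at h
    exact h
  have h6 : ∀ p, N (p, 0) = 0 := fun p => Prod.ext (h1 p) (by rw [h4, h5, octMul_zero]; rfl)
  have hx : x = (x.1, 0) + (0, x.2) := by simp
  rw [hx, map_add, h2, h6, h6]
  simp

/-- Every automorphism of the octonions acts on spinors through the spin group. -/
theorem exists_spinRep_eq_diag (α : G2) :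
    ∃ g : Spin (8 + 1), ∀ x, M.spinRep g x = (α.1.val x.1, α.1.val x.2) := by
  let φ : (ℝ × Octonions) →ₗ[ℝ] (ℝ × Octonions) :=
    LinearMap.id.prodMap (α.1.val : Octonions →ₗ[ℝ] Octonions)
  have hφ : ∀ v, φ v = (v.1, α.1.val v.2) := fun v => rfl
  let f : (Fin (8 + 1) → ℝ) →ₗ[ℝ] (Fin (8 + 1) → ℝ) :=
    M.e.toLinearMap ∘ₗ φ ∘ₗ M.e.symm.toLinearMap
  have hfe : ∀ v, f (M.e v) = M.e (φ v) := fun v => by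
    change M.e (φ (M.e.symm (M.e v))) = _
    rw [M.e.symm_apply_apply]
  have hf : ∀ v, stdForm (8 + 1) (f v) = stdForm (8 + 1) v := fun v => by
    obtain ⟨v, rfl⟩ := M.e.surjective v
    rw [hfe, M.stdForm_e, M.stdForm_e, hφ, G2.octDot_map]
  let T : Spinors →ₗ[ℝ] Spinors := diag (α.1.val : Octonions →ₗ[ℝ] Octonions)
  have hT : ∀ x, T x = (α.1.val x.1, α.1.val x.2) := fun x => rfl
  have hTQ : ∀ v x, T (cliffordOp v x) = cliffordOp (φ v) (T x) := fun v x => by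
    simp only [hT, hφ, cliffordOp_apply, map_add, map_sub, map_smul, G2.map_mul, G2.map_conj]
  have hTdot : spinorDot (T (octOne, 0)) (T (octOne, 0)) = 1 := by
    simp [hT, spinorDot, G2.map_one, octDot_one_left, octRe_one, octDot_zero_left]
  rcases exists_lift f hf with ⟨g, hg⟩ | ⟨g, u, hu, hg⟩
  · have hgQ : ∀ v x, M.spinRep g (cliffordOp v x) = cliffordOp (φ v) (M.spinRep g x) := by
      intro v x
      have h := congrArg (fun a => M.spinRep a x) (hg (M.e v))
      simp only [map_mul, hfe, spinRep_ι] at h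
      exact h
    -- The lift `g` and the diagonal map `T` induce the same isometry of vectors, so they differ by
    -- a scalar.
    obtain ⟨c, hc⟩ := eq_smul_of_commutes (N := M.spinRep (g⁻¹ : Spin (8 + 1)) ∘ₗ T) fun v x => by
      rw [LinearMap.comp_apply, hTQ, ← M.spinRep_apply_inv g (T x), ← hgQ, spinRep_inv_apply]
      rfl
    have hTg : ∀ x, T x = c • M.spinRep g x := fun x => by
      rw [← map_smul, ← hc, LinearMap.comp_apply, spinRep_apply_inv]
    have hc2 : c * c = 1 := by
      have h := hTdot
      rw [hTg, ← map_smul, spinorDot_spinRep] at h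
      simpa [spinorDot, octDot_smul_left, octDot_smul_right, octDot_one_left, octRe_one,
        octDot_zero_left] using h
    -- The product of the vectors (1, 0) and (c, 0) is the scalar c = ±1, which corrects the sign
    -- inside Spin(9).
    obtain ⟨s, hs⟩ := M.exists_spinRep_eq_cliffordOp (v := (1, 0)) (w := (c, 0))
      (by simp [octDot_zero_left]) (by simp [octDot_zero_left, hc2])
    refine ⟨s * g, fun x => ?_⟩
    rw [← hT, hTg, spinRep_mul, hs]
    simp only [cliffordOp_apply, octConj_zero, zero_octMul, add_zero, zero_sub, one_smul, neg_neg]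
    rfl
  · exfalso
    obtain ⟨u, rfl⟩ := M.e.surjective u
    have hu2 : ∀ x, cliffordOp u (cliffordOp u x) = x := fun x => by
      rw [cliffordOp_self, ← M.stdForm_e, hu, one_smul]
    have hgQ : ∀ v x, cliffordOp u (M.spinRep g (cliffordOp v x)) =
        -cliffordOp (φ v) (cliffordOp u (M.spinRep g x)) := by
      intro v x
      have h := congrArg (fun a => M.spinRep a x) (hg (M.e v))
      simp only [map_mul, map_neg, hfe, spinRep_ι] at h
      exact h
    let G : Spinors →ₗ[ℝ] Spinors := M.spinRep (g⁻¹ : Spin (8 + 1)) ∘ₗ cliffordOp u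
    have hG1 : ∀ x, G (cliffordOp u (M.spinRep g x)) = x := fun x => by
      change M.spinRep (g⁻¹ : Spin (8 + 1)) (cliffordOp u (cliffordOp u (M.spinRep g x))) = x
      rw [hu2, spinRep_inv_apply]
    have hG2 : ∀ x, cliffordOp u (M.spinRep g (G x)) = x := fun x => by
      change cliffordOp u (M.spinRep g (M.spinRep (g⁻¹ : Spin (8 + 1)) (cliffordOp u x))) = x
      rw [spinRep_apply_inv, hu2]
    -- In the odd alternative g⁻¹ u T anticommutes with all vectors and so vanishes, although T(1,
    -- 0) has norm 1.
    have h0 := eq_zero_of_anticommutes (N := G ∘ₗ T) (fun v x => by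
      have h := hgQ v (G (T x))
      rw [hG2] at h
      rw [LinearMap.comp_apply, hTQ, ← neg_neg (cliffordOp (φ v) (T x)), ← h, map_neg, hG1]
      rfl) (octOne, 0)
    have h1 := hG2 (T (octOne, 0))
    rw [← LinearMap.comp_apply G, h0, map_zero, map_zero] at h1
    rw [← h1] at hTdot
    simp [spinorDot, octDot_zero_left] at hTdot

end SpinorModel
end SymmetricCliffordSystem

/-! ### The stabilizer of the base point is `G₂` -/

theorem continuous_spin_inv (n : ℕ) : Continuous fun g : Spin n => g⁻¹ := by
  let f : CliffordAlgebra (stdForm n) →ₗ[ℝ] CliffordAlgebra (stdForm n) :=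
    CliffordAlgebra.reverse ∘ₗ CliffordAlgebra.involute.toLinearMap
  have hf : Continuous f := by
    have : IsTopologicalAddGroup (CliffordAlgebra (stdForm n)) :=
      IsModuleTopology.topologicalAddGroup ℝ _
    have : ContinuousSMul ℝ (CliffordAlgebra (stdForm n)) :=
      IsModuleTopology.toContinuousSMul ℝ _
    exact IsModuleTopology.continuous_of_linearMap f
  refine continuous_induced_rng.2 ?_
  exact hf.comp continuous_subtype_val

namespace SymmetricCliffordSystem
namespace SpinorModel

open CliffordAlgebra SpinPair

variable {C : SymmetricCliffordSystem 8 16} (M : C.SpinorModel)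

/-- The base point as a point of `M₊`. -/
def base : C.focalPlus := ⟨M.basePoint, M.basePoint_mem⟩

/-- The stabilizer of the base point. -/
def isotropyGroup : Subgroup (Spin (8 + 1)) := MulAction.stabilizer (Spin (8 + 1)) M.base

theorem mem_isotropyGroup_iff {g : Spin (8 + 1)} : g ∈ M.isotropyGroup ↔
    M.spinRep g (octOne, 0) = (octOne, 0) ∧ M.spinRep g (0, octOne) = (0, octOne) := by
  rw [isotropyGroup, MulAction.mem_stabilizer_iff, ← spinOp_basePoint_eq_iff, Subtype.ext_iff]
  rfl

theorem spinRep_isotropyGroup (g : M.isotropyGroup) (x : Spinors) :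
    M.spinRep g.1 x = (M.octMap g x.1, M.octMap g x.2) :=
  have h := M.mem_isotropyGroup_iff.1 g.2
  (M.spinRep_apply_of_fixing h.1 h.2 x).1

theorem octMap_mul (g h : M.isotropyGroup) (p : Octonions) :
    M.octMap (g * h : M.isotropyGroup) p = M.octMap g (M.octMap h p) := by
  rw [octMap_apply, Subgroup.coe_mul, spinRep_mul, spinRep_isotropyGroup, spinRep_isotropyGroup]

theorem octMap_one (p : Octonions) : M.octMap (1 : M.isotropyGroup) p = p := by
  rw [octMap_apply, Subgroup.coe_one, spinRep_one]

/-- The homomorphism from the stabilizer of the base point to `G₂`. -/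
def toG2 : M.isotropyGroup →* G2 where
  toFun g := G2.ofLinearEquiv
    { M.octMap g with
      invFun := M.octMap (g⁻¹ : M.isotropyGroup)
      left_inv := fun p => by
        change M.octMap (g⁻¹ : M.isotropyGroup) (M.octMap g p) = p
        rw [← octMap_mul, inv_mul_cancel, octMap_one]
      right_inv := fun p => by
        change M.octMap g (M.octMap (g⁻¹ : M.isotropyGroup) p) = p
        rw [← octMap_mul, mul_inv_cancel, octMap_one] }
    (by
      have h := M.mem_isotropyGroup_iff.1 g.2
      exact (M.spinRep_apply_of_fixing h.1 h.2 0).2)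
  map_one' := Subtype.ext (Units.ext (ContinuousLinearMap.ext fun p => M.octMap_one p))
  map_mul' g h := Subtype.ext (Units.ext (ContinuousLinearMap.ext fun p => M.octMap_mul g h p))

theorem toG2_apply (g : M.isotropyGroup) (p : Octonions) :
    (M.toG2 g).1.val p = M.octMap g p := rfl

theorem spinRep_eq_toG2 (g : M.isotropyGroup) (x : Spinors) :
    M.spinRep g.1 x = ((M.toG2 g).1.val x.1, (M.toG2 g).1.val x.2) :=
  M.spinRep_isotropyGroup g x

theorem toG2_surjective : Function.Surjective M.toG2 := by
  intro α
  obtain ⟨g, hg⟩ := M.exists_spinRep_eq_diag α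
  have hmem : g ∈ M.isotropyGroup := M.mem_isotropyGroup_iff.2 (by
    rw [hg, hg]
    simp [G2.map_one])
  refine ⟨⟨g, hmem⟩, Subtype.ext (Units.ext (ContinuousLinearMap.ext fun p => ?_))⟩
  rw [toG2_apply, octMap_apply, hg]

theorem continuous_toG2 : Continuous M.toG2 := by
  let F : CliffordAlgebra (stdForm (8 + 1)) →ₗ[ℝ] (Octonions →L[ℝ] Octonions) :=
    (LinearMap.toContinuousLinearMap (E := Octonions) (F' := Octonions) (𝕜 := ℝ)).toLinearMap ∘ₗ
      LinearMap.llcomp ℝ Octonions Spinors Octonions (LinearMap.fst ℝ _ _) ∘ₗ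
      (LinearMap.lcomp ℝ Spinors (LinearMap.inl ℝ _ _)) ∘ₗ M.spinRep.toLinearMap
  have hF : Continuous F := IsModuleTopology.continuous_of_linearMap F
  refine continuous_induced_rng.2 (Units.continuous_iff.2 ⟨?_, ?_⟩)
  · exact hF.comp (continuous_subtype_val.comp continuous_subtype_val)
  · have h : (fun g : M.isotropyGroup => (F ((g.1⁻¹ : Spin (8 + 1)) : CliffordAlgebra _))) =
        fun g => ((Subtype.val ∘ M.toG2) g)⁻¹.val := by
      funext g
      have h1 : ((M.toG2 g).1)⁻¹ = (M.toG2 g⁻¹).1 := by rw [map_inv]; rfl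
      change _ = ((M.toG2 g).1)⁻¹.val
      rw [h1]
      rfl
    rw [← h]
    exact hF.comp (continuous_subtype_val.comp
      ((continuous_spin_inv (8 + 1)).comp continuous_subtype_val))

/-- The operator on `ℝ³²` given by the diagonal action of a linear map of the octonions. -/
def diagOp : (Octonions →L[ℝ] Octonions) →ₗ[ℝ] (Space 16 →L[ℝ] Space 16) where
  toFun f := LinearMap.toContinuousLinearMap (M.Ψ.toLinearMap ∘ₗ
    ((diag (f : Octonions →ₗ[ℝ] Octonions)).prodMap (diag (f : Octonions →ₗ[ℝ] Octonions))) ∘ₗ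
      M.Ψ.symm.toLinearMap)
  map_add' f f' := by
    ext1 x
    obtain ⟨x, rfl⟩ := M.Ψ.surjective x
    simp [diag_apply, ← map_add]
  map_smul' a f := by
    ext1 x
    obtain ⟨x, rfl⟩ := M.Ψ.surjective x
    change M.Ψ _ = a • M.Ψ _
    rw [← map_smul]
    rfl

theorem diagOp_Ψ (f : Octonions →L[ℝ] Octonions) (x : Spinors × Spinors) :
    M.diagOp f (M.Ψ x) = M.Ψ ((f x.1.1, f x.1.2), (f x.2.1, f x.2.2)) := by
  simp [diagOp, diag_apply]

theorem spinOp_eq_diagOp (g : M.isotropyGroup) :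
    C.spinOp g = M.diagOp (M.toG2 g).1.val := by
  ext1 x
  obtain ⟨x, rfl⟩ := M.Ψ.surjective x
  rw [spinOp_Ψ, diagOp_Ψ, spinRep_eq_toG2, spinRep_eq_toG2]

theorem toG2_injective (hC : C.IsDefinite) : Function.Injective M.toG2 := fun g h hgh =>
  Subtype.ext ((isEmbedding_spinOp hC).injective (by rw [spinOp_eq_diagOp, spinOp_eq_diagOp, hgh]))

/-- The stabilizer of the base point is isomorphic to `G₂`. -/
def isotropyEquivG2 (hC : C.IsDefinite) : M.isotropyGroup ≃ₜ* G2 :=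
  { MulEquiv.ofBijective M.toG2 ⟨M.toG2_injective hC, M.toG2_surjective⟩ with
    continuous_toFun := M.continuous_toG2
    continuous_invFun := by
      set e := MulEquiv.ofBijective M.toG2 ⟨M.toG2_injective hC, M.toG2_surjective⟩ with he
      refine continuous_induced_rng.2 ((isEmbedding_spinOp hC).continuous_iff.2 ?_)
      -- Through the embedding `spinOp`, the inverse becomes the linear map α ↦ `diagOp α`, whose
      -- continuity is clear.
      have h : C.spinOp ∘ Subtype.val ∘ e.symm = fun α : G2 => M.diagOp α.1.val := by
        funext α
        obtain ⟨g, rfl⟩ := e.surjective α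
        rw [Function.comp_apply, Function.comp_apply, e.symm_apply_apply]
        exact M.spinOp_eq_diagOp g
      change Continuous (C.spinOp ∘ Subtype.val ∘ e.symm)
      rw [h]
      exact (LinearMap.continuous_of_finiteDimensional M.diagOp).comp
        (Units.continuous_val.comp continuous_subtype_val) }

end SpinorModel
end SymmetricCliffordSystem

/-! ### Slices from a parametrization and equations -/

section Slices

variable {E N B' : Type*} [NormedAddCommGroup E] [NormedSpace ℝ E] [FiniteDimensional ℝ E]
  [NormedAddCommGroup N] [NormedSpace ℝ N] [FiniteDimensional ℝ N]
  [NormedAddCommGroup B'] [NormedSpace ℝ B'] [FiniteDimensional ℝ B']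

theorem exists_split (K : Submodule ℝ E) {d c : ℕ} (hd : Module.finrank ℝ K = d)
    (hE : Module.finrank ℝ E = d + c) :
    ∃ e : E ≃L[ℝ] EuclideanSpace ℝ (Fin d) × EuclideanSpace ℝ (Fin c),
      ∀ y, (e y).2 = 0 ↔ y ∈ K := by
  have hq : Module.finrank ℝ (E ⧸ K) = Module.finrank ℝ (EuclideanSpace ℝ (Fin c)) := by
    have := K.finrank_quotient_add_finrank
    rw [finrank_euclideanSpace_fin]
    omega
  obtain ⟨ε⟩ := FiniteDimensional.nonempty_linearEquiv_of_finrank_eq hq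
  let g : E →L[ℝ] EuclideanSpace ℝ (Fin c) :=
    LinearMap.toContinuousLinearMap (ε.toLinearMap ∘ₗ K.mkQ)
  obtain ⟨π, e, he⟩ := exists_equiv_prod_of_surjective (C := EuclideanSpace ℝ (Fin d)) g
    (ε.surjective.comp K.mkQ_surjective) (by
      rw [finrank_euclideanSpace_fin, finrank_euclideanSpace_fin, hE, add_comm])
  refine ⟨e.trans (ContinuousLinearEquiv.prodComm ℝ _ _), fun y => ?_⟩
  have h : e y = (g y, π y) := congrArg (fun f => f y) he
  change (e y).1 = 0 ↔ _
  rw [h]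
  change ε (K.mkQ y) = 0 ↔ _
  rw [LinearEquiv.map_eq_zero_iff, Submodule.mkQ_apply, Submodule.Quotient.mk_eq_zero]

/-- Turns membership in a linear subspace into an equation usable in a slice argument. -/
theorem exists_clm_eq_zero_iff (K : Submodule ℝ E) :
    ∃ f : E →L[ℝ] E, ∀ x, f x = 0 ↔ x ∈ K := by
  obtain ⟨K', hK⟩ := K.exists_isCompl
  refine ⟨LinearMap.toContinuousLinearMap (K'.subtype ∘ₗ K'.projectionOnto K hK.symm),
    fun x => ?_⟩
  change ((K'.projectionOnto K hK.symm x : K') : E) = 0 ↔ _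
  rw [Submodule.coe_eq_zero, Submodule.projectionOnto_apply_eq_zero_iff]

theorem range_le_ker_of_comp_eq_zero {σ : N → E} {Z : E → B'} {dσ : N →L[ℝ] E} {dZ : E →L[ℝ] B'}
    {p : E} (hσp : σ 0 = p) (h : ∀ t, Z (σ t) = 0) (hdσ : HasFDerivAt σ dσ 0)
    (hdZ : HasFDerivAt Z dZ p) : dσ.range ≤ dZ.ker := by
  rintro _ ⟨t, rfl⟩
  subst hσp
  have h1 := hdZ.comp 0 hdσ
  have h2 : Z ∘ σ = fun _ => 0 := funext h
  rw [h2] at h1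
  have h3 := h1.unique (hasFDerivAt_const (0 : B') (0 : N))
  exact congrArg (fun f => f t) h3

/-- The inclusion opposite to `hle` is automatic because Z ∘ σ = 0. So the rank of `dσ` is the
dimension of the slice. -/
theorem hasSliceAt_euclidean {σ : N → E} {Z : E → B'} {dσ : N →L[ℝ] E} {dZ : E →L[ℝ] B'}
    {S : Set E} {p : E} (hσ : ContDiff ℝ ∞ σ) (hσp : σ 0 = p) (hσS : ∀ t, σ t ∈ S)
    (hZ : ContDiff ℝ ∞ Z) (hZS : ∀ y ∈ S, Z y = 0) (hdσ : HasFDerivAt σ dσ 0)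
    (hdZ : HasFDerivAt Z dZ p) (hle : dZ.ker ≤ dσ.range) {d c : ℕ}
    (hd : Module.finrank ℝ dσ.range = d) (hE : Module.finrank ℝ E = d + c) :
    HasSliceAt (EuclideanSpace ℝ (Fin d)) (EuclideanSpace ℝ (Fin c)) S p := by
  have hker : dσ.range = dZ.ker :=
    le_antisymm (range_le_ker_of_comp_eq_zero hσp (fun t => hZS _ (hσS t)) hdσ hdZ) hle
  obtain ⟨e, he⟩ := exists_split dZ.ker (by rw [← hker, hd]) hE
  exact hasSliceAt_of_ker_le_range hσ hσp hσS hZ hZS hdσ hdZ hle e he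

theorem hasFDerivAt_list_prod_of_eq_one {𝔸 : Type*} [NormedRing 𝔸] [NormedAlgebra ℝ 𝔸]
    {ι : Type*} (l : List ι) {f : ι → N → 𝔸} {f' : ι → N →L[ℝ] 𝔸} {t₀ : N}
    (h1 : ∀ i, f i t₀ = 1) (hf : ∀ i, HasFDerivAt (f i) (f' i) t₀) :
    HasFDerivAt (fun t => (l.map fun i => f i t).prod) (l.map f').sum t₀ := by
  induction l with
  | nil => exact hasFDerivAt_const _ _
  | cons i l ih =>
    have hp : (l.map fun i => f i t₀).prod = 1 := by
      rw [List.map_congr_left (fun i _ => h1 i)]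
      simp
    have h := (hf i).mul' ih
    simp only [List.map_cons, List.prod_cons, List.sum_cons]
    refine h.congr_fderiv ?_
    ext1 v
    simp [h1, hp, add_comm]

theorem contDiff_list_prod {𝔸 : Type*} [NormedRing 𝔸] [NormedAlgebra ℝ 𝔸]
    {ι : Type*} (l : List ι) {f : ι → N → 𝔸} (hf : ∀ i, ContDiff ℝ ∞ (f i)) :
    ContDiff ℝ ∞ (fun t => (l.map fun i => f i t).prod) := by
  induction l with
  | nil => exact contDiff_const
  | cons i l ih => exact (hf i).mul ih

end Slices

/-! ### The Lie algebra of the spin group in the Clifford representation -/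

/-- The pairs of indices `i < j`. -/
abbrev IndexPairs (m : ℕ) : Type := {p : Fin (m + 1) × Fin (m + 1) // p.1 < p.2}

namespace SymmetricCliffordSystem

open CliffordAlgebra CliffordWords SpinPair

section
variable {m l : ℕ} (C : SymmetricCliffordSystem m l)

/-- The linear combinations of the products `Pᵢ Pⱼ`. -/
def bivector : (IndexPairs m → ℝ) →ₗ[ℝ] Matrix (Fin (2 * l)) (Fin (2 * l)) ℝ :=
  Fintype.linearCombination ℝ fun p => C.P p.1.1 * C.P p.1.2

theorem bivector_apply (t : IndexPairs m → ℝ) :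
    C.bivector t = ∑ p, t p • (C.P p.1.1 * C.P p.1.2) := by
  simp [bivector, Fintype.linearCombination_apply]

theorem P_mul_P_mem_range {i j : Fin (m + 1)} (h : i ≠ j) :
    C.P i * C.P j ∈ LinearMap.range C.bivector := by
  have key : ∀ {i j : Fin (m + 1)}, i < j → C.P i * C.P j ∈ LinearMap.range C.bivector :=
    fun {i j} h => ⟨Pi.single ⟨(i, j), h⟩ 1, by
      rw [bivector, Fintype.linearCombination_apply_single, one_smul]⟩
  rcases lt_or_gt_of_ne h with h | h
  · exact key h
  · rw [C.P_mul_P h.ne']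
    exact neg_mem (key h)

theorem bracket_P (k i j : Fin (m + 1)) :
    C.P k * C.P i * C.P j - C.P j * (C.P k * C.P i) =
      (if i = j then (2 : ℝ) else 0) • C.P k - (if k = j then (2 : ℝ) else 0) • C.P i := by
  have h : ∀ i j, C.P i * C.P j = (if i = j then (2 : ℝ) else 0) • 1 - C.P j * C.P i := by
    intro i j
    rw [eq_sub_iff_add_eq, C.anticomm]
    split_ifs
    · rw [← Nat.cast_ofNat (R := ℝ), Nat.cast_smul_eq_nsmul, nsmul_one]
      rfl
    · rw [zero_smul]
  rw [mul_assoc, h i j, mul_sub, mul_smul_comm, mul_one, ← mul_assoc, h k j, sub_mul,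
    smul_mul_assoc, one_mul, mul_assoc]
  abel

theorem vec_injective [NeZero l] : Function.Injective C.vec := by
  rw [injective_iff_map_eq_zero]
  intro v hv
  have h := C.vec_mul_self v
  have : Nonempty (Fin (2 * l)) := ⟨⟨0, by have := NeZero.pos l; omega⟩⟩
  rw [hv, zero_mul, eq_comm, Algebra.algebraMap_eq_smul_one, smul_eq_zero] at h
  have h0 := h.resolve_right one_ne_zero
  rw [QuadraticMap.weightedSumSquares_apply, Finset.sum_eq_zero_iff_of_nonneg
    (fun i _ => by rw [one_smul]; exact mul_self_nonneg _)] at h0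
  funext i
  have := h0 i (Finset.mem_univ i)
  rw [one_smul] at this
  exact mul_self_eq_zero.1 this

/-- A bivector is recovered from its brackets with the vectors: by `bracket_P`, the coefficient of
Pₐ in [Σ tₚ Pᵢ Pⱼ, P_b] is 2 t at the pair (a, b). -/
theorem bivector_injective [NeZero l] : Function.Injective C.bivector := by
  rw [injective_iff_map_eq_zero]
  intro t ht
  have key : ∀ b, (fun k => ∑ p : IndexPairs m, t p * ((if p.1.2 = b then (2 : ℝ) else 0) *
      (if p.1.1 = k then 1 else 0) - (if p.1.1 = b then (2 : ℝ) else 0) *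
      (if p.1.2 = k then 1 else 0))) = 0 := by
    intro b
    apply C.vec_injective
    rw [map_zero]
    have h : C.bivector t * C.P b - C.P b * C.bivector t = 0 := by
      rw [ht, zero_mul, mul_zero, sub_zero]
    rw [bivector_apply, Finset.sum_mul, Finset.mul_sum, ← Finset.sum_sub_distrib] at h
    rw [← h, vec_apply]
    simp only [Finset.sum_smul]
    rw [Finset.sum_comm]
    refine Finset.sum_congr rfl fun p _ => ?_
    rw [smul_mul_assoc, mul_smul_comm, ← smul_sub, bracket_P]
    have hs : ∀ (c : ℝ) i, ∑ k, (c * if i = k then 1 else 0) • C.P k = c • C.P i := by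
      intro c i
      simp
    simp only [mul_sub, ← mul_assoc, sub_smul, Finset.sum_sub_distrib, hs, smul_sub, smul_smul]
  funext p
  obtain ⟨⟨a, b⟩, hab⟩ := p
  have h := congrFun (key b) a
  rw [Finset.sum_eq_single ⟨(a, b), hab⟩] at h
  · have hab' : (a : Fin (m + 1)) ≠ b := ne_of_lt hab
    simpa [hab'] using h
  · rintro ⟨⟨i, j⟩, hij⟩ _ hne
    have h1 : ¬(j = b ∧ i = a) := fun h => hne (by simp [h.1, h.2])
    have h2 : ¬(i = b ∧ j = a) := fun h => by
      have hij' : i < j := hij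
      have hab' : a < b := hab
      rw [h.1, h.2] at hij'
      exact lt_asymm hij' hab'
    dsimp only
    split_ifs <;> simp_all
  · simp

/-- The bracket with X is a linear map of the span of the Pᵢ. It is skew because X commutes with the
scalars PᵢPⱼ + PⱼPᵢ, and every skew map is the bracket with a bivector. -/
theorem exists_bivector_bracket [NeZero l] {X : Matrix (Fin (2 * l)) (Fin (2 * l)) ℝ}
    (hX : ∀ i, ∃ v, X * C.P i - C.P i * X = C.vec v) :
    ∃ Y ∈ LinearMap.range C.bivector, ∀ i, X * C.P i - C.P i * X = Y * C.P i - C.P i * Y := by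
  choose a ha using hX
  have hvs : ∀ v i, C.vec v * C.P i + C.P i * C.vec v =
      (2 * v i) • (1 : Matrix (Fin (2 * l)) (Fin (2 * l)) ℝ) := by
    intro v i
    rw [vec_apply, Finset.sum_mul, Finset.mul_sum, ← Finset.sum_add_distrib]
    simp only [smul_mul_assoc, mul_smul_comm, ← smul_add, C.anticomm, smul_ite, smul_zero,
      Finset.sum_ite_eq', Finset.mem_univ, if_true]
    rw [mul_comm (2 : ℝ), mul_smul]
    congr 1
    rw [← Nat.cast_ofNat (R := ℝ), Nat.cast_smul_eq_nsmul, nsmul_one]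
    rfl
  have hanti : ∀ i j, a i j = -a j i := by
    intro i j
    have h : (C.vec (a i) * C.P j + C.P j * C.vec (a i)) +
        (C.vec (a j) * C.P i + C.P i * C.vec (a j)) =
        X * (C.P i * C.P j + C.P j * C.P i) - (C.P i * C.P j + C.P j * C.P i) * X := by
      rw [← ha, ← ha]
      noncomm_ring
    rw [hvs, hvs, C.anticomm, ← add_smul] at h
    have h0 : X * (if i = j then 2 else 0) - (if i = j then 2 else 0) * X = 0 := by
      split_ifs
      · rw [mul_two X, two_mul X, sub_self]
      · rw [mul_zero, zero_mul, sub_self]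
    have : Nonempty (Fin (2 * l)) := ⟨⟨0, by have := NeZero.pos l; omega⟩⟩
    rw [h0, smul_eq_zero] at h
    linarith [h.resolve_right one_ne_zero]
  -- The factor 1/4: a bracket with PₖPᵢ contributes 2, and each unordered pair occurs twice in the
  -- sum.
  refine ⟨∑ i, ∑ k, (a i k / 4) • (C.P k * C.P i), ?_, fun j => ?_⟩
  · refine Submodule.sum_mem _ fun i _ => Submodule.sum_mem _ fun k _ => ?_
    by_cases hik : k = i
    · subst hik
      have : a k k = 0 := by linarith [hanti k k]
      rw [this, zero_div, zero_smul]
      exact zero_mem _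
    · exact Submodule.smul_mem _ _ (C.P_mul_P_mem_range hik)
  · rw [ha, Finset.sum_mul, Finset.mul_sum, ← Finset.sum_sub_distrib]
    simp only [Finset.sum_mul, Finset.mul_sum, ← Finset.sum_sub_distrib, smul_mul_assoc,
      mul_smul_comm, ← smul_sub, bracket_P]
    simp only [smul_sub, Finset.sum_sub_distrib]
    have h1 : ∑ i, ∑ k, (a i k / 4) • ((if i = j then (2 : ℝ) else 0) • C.P k) =
        (2 : ℝ)⁻¹ • C.vec (a j) := by
      rw [Finset.sum_eq_single j]
      · rw [vec_apply, Finset.smul_sum]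
        refine Finset.sum_congr rfl fun k _ => ?_
        rw [if_pos rfl, smul_smul, smul_smul]
        congr 1
        ring
      · intro i _ hi
        simp [hi]
      · simp
    have h2 : ∑ i, ∑ k, (a i k / 4) • ((if k = j then (2 : ℝ) else 0) • C.P i) =
        -((2 : ℝ)⁻¹ • C.vec (a j)) := by
      rw [vec_apply, Finset.smul_sum, ← Finset.sum_neg_distrib]
      refine Finset.sum_congr rfl fun i _ => ?_
      rw [Finset.sum_eq_single j]
      · rw [if_pos rfl, smul_smul, smul_smul, ← neg_smul, hanti i j]
        congr 1
        ring
      · intro k _ hk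
        simp [hk]
      · simp
    rw [h1, h2, sub_neg_eq_add, ← add_smul]
    norm_num

end

variable {C : SymmetricCliffordSystem 8 16}

theorem exists_eq_smul_one_of_commute (hC : C.IsDefinite) {x : CliffordAlgebra (stdForm (8 + 1))}
    (hx : involute x = x) (hc : ∀ i, C.rep x * C.P i = C.P i * C.rep x) :
    ∃ a : ℝ, C.rep x = a • 1 := by
  obtain ⟨a, rfl⟩ := mem_span_one_of_commute hx fun i hi => by
    have hg2 : gen (8 + 1) i * gen (8 + 1) i = 1 := gen_mul_self hi
    -- The commutator of an even element with a generator is odd; the extra generator brings it back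
    -- to the even part, where the representation is faithful.
    have h0 : (gen (8 + 1) i * x - x * gen (8 + 1) i) * gen (8 + 1) i = 0 := by
      refine eq_zero_of_rep_eq_zero hC ?_ ?_
      · rw [map_mul, map_sub, map_mul, map_mul, hx, involute_gen]
        noncomm_ring
      · have h := C.rep_gen ⟨i, hi⟩
        rw [map_mul, map_sub, map_mul, map_mul, h, hc, sub_self, zero_mul]
    have h1 := congrArg (· * gen (8 + 1) i) h0
    simp only [mul_assoc, hg2, mul_one, zero_mul] at h1
    exact sub_eq_zero.1 h1
  exact ⟨a, by rw [map_smul, map_one]⟩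

theorem bivector_transpose {m l : ℕ} (C : SymmetricCliffordSystem m l)
    (t : IndexPairs m → ℝ) : (C.bivector t).transpose = -C.bivector t := by
  rw [bivector_apply, Matrix.transpose_sum, ← Finset.sum_neg_distrib]
  refine Finset.sum_congr rfl fun p _ => ?_
  rw [Matrix.transpose_smul, Matrix.transpose_mul, C.symm, C.symm, C.P_mul_P (ne_of_gt p.2),
    smul_neg]

theorem exists_rep_eq_bivector {m l : ℕ} (C : SymmetricCliffordSystem m l)
    (t : IndexPairs m → ℝ) : ∃ x, involute x = x ∧ C.rep x = C.bivector t := by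
  refine ⟨∑ p, t p • (gen (m + 1) p.1.1 * gen (m + 1) p.1.2), ?_, ?_⟩
  · simp only [map_sum, map_smul, map_mul, involute_gen, neg_mul_neg]
  · simp only [map_sum, map_smul, map_mul, rep_gen, bivector_apply]

/-- The infinitesimal characterization of the spin group. -/
theorem mem_range_bivector (hC : C.IsDefinite) {x : CliffordAlgebra (stdForm (8 + 1))}
    (hx : involute x = x) (hanti : (C.rep x).transpose = -C.rep x)
    (hP : ∀ i, ∃ v, C.rep x * C.P i - C.P i * C.rep x = C.vec v) :
    C.rep x ∈ LinearMap.range C.bivector := by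
  obtain ⟨_, ⟨t, rfl⟩, hY⟩ := C.exists_bivector_bracket hP
  obtain ⟨y, hy, hyt⟩ := C.exists_rep_eq_bivector t
  -- After subtracting the bivector, the remainder commutes with all Pᵢ and is a scalar. It is also
  -- skew-symmetric, so it is zero.
  obtain ⟨a, ha⟩ := exists_eq_smul_one_of_commute hC (x := x - y) (by rw [map_sub, hx, hy])
    fun i => by
      rw [map_sub, hyt, sub_mul, mul_sub, sub_eq_sub_iff_sub_eq_sub]
      exact hY i
  rw [map_sub, hyt] at ha
  have h : (a • (1 : Matrix (Fin (2 * 16)) (Fin (2 * 16)) ℝ)).transpose = -(a • 1) := by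
    rw [← ha, Matrix.transpose_sub, hanti, bivector_transpose]
    abel
  rw [Matrix.transpose_smul, Matrix.transpose_one] at h
  have h0 := eq_zero_of_eq_neg h
  rw [h0, sub_eq_zero] at ha
  exact ⟨t, ha.symm⟩

end SymmetricCliffordSystem

/-! ### The spin group as a submanifold -/

section NormedAlgebra

variable {𝔸 : Type*} [NormedRing 𝔸] [NormedAlgebra ℝ 𝔸]

/-- Left multiplication by a unit. -/
def mulLeftEquiv (u v : 𝔸) (huv : u * v = 1) (hvu : v * u = 1) : 𝔸 ≃L[ℝ] 𝔸 :=
  ContinuousLinearEquiv.equivOfInverse (ContinuousLinearMap.mul ℝ 𝔸 u)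
    (ContinuousLinearMap.mul ℝ 𝔸 v)
    (fun x => by rw [ContinuousLinearMap.mul_apply', ContinuousLinearMap.mul_apply', ← mul_assoc,
      hvu, one_mul])
    (fun x => by rw [ContinuousLinearMap.mul_apply', ContinuousLinearMap.mul_apply', ← mul_assoc,
      huv, one_mul])

theorem exists_hasFDerivAt_conj (St : 𝔸 ≃L[ℝ] 𝔸) (h1 : St 1 = 1) (p : 𝔸) : ∃ D : 𝔸 →L[ℝ] 𝔸,
    HasFDerivAt (fun T => T * p * St T) D 1 ∧ ∀ X, D X = X * p + p * St X := by
  refine ⟨_, ((hasFDerivAt_id 1).mul' (hasFDerivAt_const p 1)).mul' St.hasFDerivAt,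
    fun X => ?_⟩
  simp [h1, add_comm]

theorem exists_hasFDerivAt_star_mul (St : 𝔸 ≃L[ℝ] 𝔸) (h1 : St 1 = 1) : ∃ D : 𝔸 →L[ℝ] 𝔸,
    HasFDerivAt (fun T => St T * T - 1) D 1 ∧ ∀ X, D X = St X + X := by
  refine ⟨_, (St.hasFDerivAt.mul' (hasFDerivAt_id 1)).sub_const 1, fun X => ?_⟩
  simp [h1, add_comm]

theorem hasFDerivAt_cos_smul_one_add {N : Type*} [NormedAddCommGroup N] [NormedSpace ℝ N]
    (f : N →L[ℝ] ℝ) (a : 𝔸) :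
    HasFDerivAt (fun t => Real.cos (f t) • (1 : 𝔸) + Real.sin (f t) • a) (f.smulRight a) 0 := by
  refine ((f.hasFDerivAt.cos.smul_const (1 : 𝔸)).add
    (f.hasFDerivAt.sin.smul_const a)).congr_fderiv ?_
  ext1 v
  simp

theorem cos_zero_smul_one_add (a : 𝔸) :
    Real.cos 0 • (1 : 𝔸) + Real.sin 0 • a = 1 := by simp

theorem hasFDerivAt_rotation_prod {ι : Type*} [Fintype ι] (a : ι → 𝔸) :
    HasFDerivAt (fun t : ι → ℝ => ((Finset.univ : Finset ι).toList.map fun p =>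
      Real.cos (t p) • (1 : 𝔸) + Real.sin (t p) • a p).prod)
      (LinearMap.toContinuousLinearMap (Fintype.linearCombination ℝ a)) 0 := by
  refine (hasFDerivAt_list_prod_of_eq_one (t₀ := (0 : ι → ℝ)) (Finset.univ : Finset ι).toList
    (fun p => cos_zero_smul_one_add (a p)) (fun p => hasFDerivAt_cos_smul_one_add
      (ContinuousLinearMap.proj (R := ℝ) (φ := fun _ : ι => ℝ) p) (a p))).congr_fderiv ?_
  ext1 t
  rw [Finset.sum_map_toList]
  simp [Fintype.linearCombination_apply]

theorem contDiff_rotation_prod {ι : Type*} [Fintype ι] (a : ι → 𝔸) :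
    ContDiff ℝ ∞ (fun t : ι → ℝ => ((Finset.univ : Finset ι).toList.map fun p =>
      Real.cos (t p) • (1 : 𝔸) + Real.sin (t p) • a p).prod) := by
  refine contDiff_list_prod _ fun p => ?_
  have hp : ContDiff ℝ ∞ fun t : ι → ℝ => t p := contDiff_apply ℝ ℝ p
  exact (hp.cos.smul contDiff_const).add (hp.sin.smul contDiff_const)

theorem mul_add_mul_neg_eq_sub {R : Type*} [Ring R] (a b : R) :
    a * b + b * -a = a * b - b * a := by
  rw [mul_neg, sub_eq_add_neg]

end NormedAlgebra

namespace SymmetricCliffordSystem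

open CliffordAlgebra CliffordWords SpinPair

section
variable {m l : ℕ} (C : SymmetricCliffordSystem m l)

theorem op_injective : Function.Injective
    (op : Matrix (Fin (2 * l)) (Fin (2 * l)) ℝ → Space l →L[ℝ] Space l) :=
  (Matrix.toEuclideanCLM (n := Fin (2 * l)) (𝕜 := ℝ)).injective

theorem op_mul (A B : Matrix (Fin (2 * l)) (Fin (2 * l)) ℝ) : op (A * B) = op A * op B :=
  map_mul (Matrix.toEuclideanCLM (n := Fin (2 * l)) (𝕜 := ℝ)) A B

theorem op_transpose (A : Matrix (Fin (2 * l)) (Fin (2 * l)) ℝ) : op A.transpose = star (op A) := by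
  unfold op
  rw [← map_star, Matrix.star_eq_conjTranspose, Matrix.conjTranspose_eq_transpose_of_trivial]

/-- The correspondence of matrices and operators, as a linear map. -/
def opₗ (l : ℕ) : Matrix (Fin (2 * l)) (Fin (2 * l)) ℝ →ₗ[ℝ] (Space l →L[ℝ] Space l) :=
  (Matrix.toEuclideanCLM (n := Fin (2 * l)) (𝕜 := ℝ)).toAlgEquiv.toLinearMap

theorem opₗ_apply (A : Matrix (Fin (2 * l)) (Fin (2 * l)) ℝ) : opₗ l A = op A := rfl

theorem spinOp_mul (g h : Spin (m + 1)) : C.spinOp (g * h) = C.spinOp g * C.spinOp h := by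
  rw [spinOp, Submonoid.coe_mul, map_mul, op_mul]
  rfl

theorem spinOp_one : C.spinOp 1 = 1 := by
  ext1 x
  rw [spinOp, Submonoid.coe_one, map_one, op_one]
  rfl

theorem spinOp_inv (g : Spin (m + 1)) : C.spinOp g⁻¹ = star (C.spinOp g) := by
  rw [spinOp, spinOp, ← op_transpose, ← rep_reverse]
  congr 2
  change star (g : CliffordAlgebra (stdForm (m + 1))) = _
  rw [CliffordAlgebra.star_def, spinGroup.involute_eq g.2]

theorem star_spinOp_mul_self (g : Spin (m + 1)) : star (C.spinOp g) * C.spinOp g = 1 := by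
  rw [← spinOp_inv, ← spinOp_mul, inv_mul_cancel, spinOp_one]

theorem exists_conj_P (g : Spin (m + 1)) (i : Fin (m + 1)) :
    ∃ v, C.spinOp g * op (C.P i) * star (C.spinOp g) = op (C.vec v) := by
  obtain ⟨w, hw⟩ := spinGroup.conjAct_smul_ι_mem_range_ι (x := spinGroup.toUnits g) g.2
    (fun j => if (j : ℕ) = i then (1 : ℝ) else 0)
  rw [ConjAct.units_smul_def, ConjAct.ofConjAct_toConjAct] at hw
  have hw' : ι (stdForm (m + 1)) w = (g : CliffordAlgebra (stdForm (m + 1))) * gen (m + 1) i *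
      ((g⁻¹ : Spin (m + 1)) : CliffordAlgebra (stdForm (m + 1))) := hw
  refine ⟨w, ?_⟩
  rw [← spinOp_inv, ← C.rep_ι w, hw', map_mul, map_mul, rep_gen, op_mul, op_mul]
  rfl

theorem stdForm_single (i : Fin (m + 1)) :
    stdForm (m + 1) (fun j => if j = i then (1 : ℝ) else 0) = 1 := by
  rw [QuadraticMap.weightedSumSquares_apply, Finset.sum_eq_single i]
  · simp
  · intro j _ hj
    simp [hj]
  · simp

theorem stdForm_rotation {i j : Fin (m + 1)} (h : i ≠ j) (θ : ℝ) :
    stdForm (m + 1) (fun k => if k = i then Real.cos θ else if k = j then Real.sin θ else 0) =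
      1 := by
  rw [QuadraticMap.weightedSumSquares_apply, Fintype.sum_eq_add i j h]
  · simp [h.symm, ← sq]
  · rintro k ⟨h1, h2⟩
    simp [h1, h2]

/-- The product of the unit vectors eᵢ and cos θ eᵢ + sin θ eⱼ. -/
theorem exists_spinOp_rotation {i j : Fin (m + 1)} (h : i ≠ j) (θ : ℝ) :
    ∃ g : Spin (m + 1), C.spinOp g =
      Real.cos θ • 1 + Real.sin θ • (op (C.P i) * op (C.P j)) := by
  refine ⟨spinPair _ _ (stdForm_single i) (stdForm_rotation h θ), ?_⟩
  have h1 : C.vec (fun k => if k = i then (1 : ℝ) else 0) = C.P i := by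
    rw [vec_apply]
    simp
  have h2 : C.vec (fun k => if k = i then Real.cos θ else if k = j then Real.sin θ else 0) =
      Real.cos θ • C.P i + Real.sin θ • C.P j := by
    rw [vec_apply, Fintype.sum_eq_add i j h]
    · simp [h.symm]
    · rintro k ⟨h1, h2⟩
      simp [h1, h2]
  change op (C.rep (ι _ _ * ι _ _)) = _
  rw [map_mul, rep_ι, rep_ι, h1, h2, mul_add, mul_smul_comm, mul_smul_comm, P_mul_self,
    ← op_mul]
  unfold op
  rw [map_add, map_smul, map_smul, map_one]

/-- A parametrization of a neighbourhood of the identity in the spin group. -/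
def spinParam (t : IndexPairs m → ℝ) : Space l →L[ℝ] Space l :=
  ((Finset.univ : Finset (IndexPairs m)).toList.map fun p =>
    Real.cos (t p) • 1 + Real.sin (t p) • (op (C.P p.1.1) * op (C.P p.1.2))).prod

theorem spinParam_mem (t : IndexPairs m → ℝ) : C.spinParam t ∈ Set.range C.spinOp := by
  rw [spinParam]
  induction (Finset.univ : Finset (IndexPairs m)).toList with
  | nil => exact ⟨1, C.spinOp_one⟩
  | cons p L ih =>
    obtain ⟨g, hg⟩ := C.exists_spinOp_rotation (ne_of_lt p.2) (t p)
    obtain ⟨h, hh⟩ := ih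
    exact ⟨g * h, by rw [spinOp_mul, hg, hh, List.map_cons, List.prod_cons]⟩

theorem contDiff_spinParam : ContDiff ℝ ∞ C.spinParam :=
  contDiff_rotation_prod fun p : IndexPairs m => op (C.P p.1.1) * op (C.P p.1.2)

theorem spinParam_zero : C.spinParam 0 = 1 := by
  rw [spinParam]
  refine List.prod_eq_one fun x hx => ?_
  obtain ⟨p, -, rfl⟩ := List.mem_map.1 hx
  exact cos_zero_smul_one_add _

theorem hasFDerivAt_spinParam :
    HasFDerivAt C.spinParam (LinearMap.toContinuousLinearMap (opₗ l ∘ₗ C.bivector)) 0 := by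
  have h : opₗ l ∘ₗ C.bivector =
      Fintype.linearCombination ℝ fun p : IndexPairs m => op (C.P p.1.1) * op (C.P p.1.2) := by
    refine LinearMap.ext fun t => ?_
    rw [LinearMap.comp_apply, bivector_apply, map_sum, Fintype.linearCombination_apply]
    refine Finset.sum_congr rfl fun p _ => ?_
    rw [map_smul, opₗ_apply, op_mul]
  rw [h]
  exact hasFDerivAt_rotation_prod fun p : IndexPairs m => op (C.P p.1.1) * op (C.P p.1.2)

end

variable {C : SymmetricCliffordSystem 8 16}

/-- Of the 32² = 1024 dimensions, 36 = 9 · 8 / 2 are the dimension of Spin(9); the other 988 are its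
codimension. -/
theorem finrank_operators : Module.finrank ℝ (Space 16 →L[ℝ] Space 16) = 36 + 988 := by
  rw [← (LinearMap.toContinuousLinearMap (𝕜 := ℝ) (E := Space 16) (F' := Space 16)).finrank_eq,
    Module.finrank_linearMap, finrank_euclideanSpace_fin]

/-- The equations say that T is orthogonal, that it conjugates each Pᵢ into the span of the Pⱼ, and
that it comes from the even Clifford algebra. Their linearization at 1 consists of the operators
described by `mem_range_bivector`, which is the image of the differential of `spinParam`. -/
theorem hasSliceAt_one (hC : C.IsDefinite) : HasSliceAt (EuclideanSpace ℝ (Fin 36))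
    (EuclideanSpace ℝ (Fin 988)) (Set.range C.spinOp) 1 := by
  let A₀ : Submodule ℝ (CliffordAlgebra (stdForm (8 + 1))) :=
    LinearMap.eqLocus (involute (Q := stdForm (8 + 1))).toLinearMap LinearMap.id
  obtain ⟨f₁, hf₁⟩ := exists_clm_eq_zero_iff (LinearMap.range (opₗ 16 ∘ₗ C.vec))
  obtain ⟨f₂, hf₂⟩ := exists_clm_eq_zero_iff (A₀.map C.repOp.toLinearMap)
  let St : (Space 16 →L[ℝ] Space 16) ≃L[ℝ] (Space 16 →L[ℝ] Space 16) := starL' ℝ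
  have hSt : ∀ T, St T = star T := fun T => rfl
  let Z : (Space 16 →L[ℝ] Space 16) → (Space 16 →L[ℝ] Space 16) ×
      (Fin (8 + 1) → (Space 16 →L[ℝ] Space 16)) × (Space 16 →L[ℝ] Space 16) := fun T =>
    (St T * T - 1, fun i => f₁ (T * op (C.P i) * St T), f₂ T)
  have hSt1 : St 1 = 1 := star_one _
  have hd2 := fun i => exists_hasFDerivAt_conj St hSt1 (op (C.P i))
  obtain ⟨D₁, hD₁, hD₁'⟩ := exists_hasFDerivAt_star_mul St hSt1
  choose D₂ hD₂ hD₂' using hd2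
  have hdZ : HasFDerivAt Z (D₁.prod ((ContinuousLinearMap.pi fun i => f₁ ∘L D₂ i).prod f₂)) 1 :=
    hD₁.prodMk ((hasFDerivAt_pi.2 fun i => f₁.hasFDerivAt.comp 1 (hD₂ i)).prodMk f₂.hasFDerivAt)
  refine hasSliceAt_euclidean C.contDiff_spinParam C.spinParam_zero C.spinParam_mem (Z := Z) ?_ ?_
    C.hasFDerivAt_spinParam hdZ ?_ ?_ finrank_operators
  · refine ((St.contDiff.mul contDiff_id).sub contDiff_const).prodMk ((contDiff_pi.2 fun i =>
      f₁.contDiff.comp ((contDiff_id.mul contDiff_const).mul St.contDiff)).prodMk f₂.contDiff)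
  · rintro _ ⟨g, rfl⟩
    refine Prod.ext ?_ (Prod.ext (funext fun i => ?_) ?_)
    · change star (C.spinOp g) * C.spinOp g - 1 = 0
      rw [star_spinOp_mul_self, sub_self]
    · obtain ⟨v, hv⟩ := C.exists_conj_P g i
      change f₁ (C.spinOp g * op (C.P i) * star (C.spinOp g)) = 0
      rw [hf₁, hv]
      exact ⟨v, rfl⟩
    · change f₂ (C.spinOp g) = 0
      rw [hf₂]
      exact ⟨g, spinGroup.involute_eq g.2, rfl⟩
  · intro X hX
    have h1 : star X + X = 0 := (hD₁' X).symm.trans (congrArg Prod.fst hX)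
    have h2 : ∀ i, f₁ (X * op (C.P i) + op (C.P i) * St X) = 0 := fun i => by
      rw [← hD₂']
      exact congrFun (congrArg (fun y => y.2.1) hX) i
    have h3 : f₂ X = 0 := congrArg (fun y => y.2.2) hX
    obtain ⟨x, hx, rfl⟩ := (hf₂ X).1 h3
    have hstar : star (op (C.rep x)) = -op (C.rep x) := eq_neg_of_add_eq_zero_left h1
    obtain ⟨t, ht⟩ := mem_range_bivector hC (x := x) hx (op_injective (by
      rw [op_transpose, hstar]
      exact (map_neg (opₗ 16) _).symm)) fun i => by
        obtain ⟨v, hv⟩ := (hf₁ _).1 (h2 i)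
        refine ⟨v, op_injective ?_⟩
        have hv' : op (C.vec v) = op (C.rep x) * op (C.P i) + op (C.P i) * star (op (C.rep x)) := hv
        rw [hstar] at hv'
        refine Eq.trans ?_ (hv'.trans (mul_add_mul_neg_eq_sub _ _)).symm
        rw [← op_mul, ← op_mul]
        exact map_sub (opₗ 16) _ _
    exact ⟨t, congrArg op ht⟩
  · have hinj : Function.Injective (opₗ 16 ∘ₗ C.bivector) :=
      op_injective.comp C.bivector_injective
    change Module.finrank ℝ (LinearMap.range (opₗ 16 ∘ₗ C.bivector)) = 36
    rw [LinearMap.finrank_range_of_inj hinj, Module.finrank_fintype_fun_eq_card]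
    rfl

theorem isSliceEmbedding_spinOp (hC : C.IsDefinite) : IsSliceEmbedding
    (EuclideanSpace ℝ (Fin 36)) (EuclideanSpace ℝ (Fin 988)) C.spinOp := by
  refine ⟨isEmbedding_spinOp hC, fun g => ?_⟩
  let A := mulLeftEquiv (C.spinOp g) (C.spinOp g⁻¹)
    (by rw [← spinOp_mul, mul_inv_cancel, spinOp_one])
    (by rw [← spinOp_mul, inv_mul_cancel, spinOp_one])
  have hA : ∀ T, A T = C.spinOp g * T := fun T => rfl
  have h := (hasSliceAt_one hC).image A fun T => by
    rw [hA]
    constructor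
    · rintro ⟨h, hh⟩
      refine ⟨g⁻¹ * h, ?_⟩
      rw [spinOp_mul, hh, ← mul_assoc, ← spinOp_mul, inv_mul_cancel, spinOp_one, one_mul]
    · rintro ⟨h, rfl⟩
      exact ⟨g * h, C.spinOp_mul g h⟩
  rwa [hA, mul_one] at h

end SymmetricCliffordSystem

/-! ### The focal submanifold as a submanifold -/

/-- The imaginary octonions. -/
abbrev ImOct : Submodule ℝ Octonions := LinearMap.ker octRe

theorem finrank_imOct : Module.finrank ℝ ImOct = 7 := by
  have h := octRe.finrank_range_add_finrank_ker
  have hs : Function.Surjective octRe := fun a => ⟨a • octOne, by simp [octRe_one]⟩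
  rw [LinearMap.range_eq_top.2 hs, finrank_top, finrank_octonions, Module.finrank_self] at h
  change 1 + Module.finrank ℝ ImOct = 8 at h
  omega

namespace SymmetricCliffordSystem

theorem vec_commutator_mem {m l : ℕ} (C : SymmetricCliffordSystem m l) (v w : Fin (m + 1) → ℝ) :
    C.vec v * C.vec w - C.vec w * C.vec v ∈ LinearMap.range C.bivector := by
  have h : C.vec v * C.vec w - C.vec w * C.vec v =
      ∑ i, ∑ j, (v i * w j) • (C.P i * C.P j - C.P j * C.P i) := by
    simp only [vec_apply, smul_sub, Finset.sum_sub_distrib, Finset.sum_mul_sum,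
      smul_mul_smul_comm]
    congr 1
    rw [Finset.sum_comm]
    simp only [mul_comm (w _) (v _)]
  rw [h]
  refine Submodule.sum_mem _ fun i _ => Submodule.sum_mem _ fun j _ => Submodule.smul_mem _ _ ?_
  by_cases hij : i = j
  · subst hij
    rw [sub_self]
    exact zero_mem _
  · exact sub_mem (C.P_mul_P_mem_range hij) (C.P_mul_P_mem_range (Ne.symm hij))

namespace SpinorModel

open CliffordAlgebra SpinPair

variable {C : SymmetricCliffordSystem 8 16} (M : C.SpinorModel)

/-- The model of the tangent space of `M₊` at the base point. -/
abbrev TangentModel : Type := ImOct × Octonions × ImOct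

theorem finrank_tangentModel : Module.finrank ℝ TangentModel = 22 := by
  rw [Module.finrank_prod, Module.finrank_prod, finrank_imOct, finrank_octonions]

/-- The inclusion of the tangent space of `M₊` at the base point. -/
def tangentMap : TangentModel →ₗ[ℝ] Space 16 where
  toFun v := M.Ψ ((v.1, v.2.1), (-octConj v.2.1, v.2.2))
  map_add' v w := by
    rw [← map_add]
    refine congrArg M.Ψ (Prod.ext (Prod.ext rfl rfl) (Prod.ext ?_ rfl))
    change -octConj (v.2.1 + w.2.1) = -octConj v.2.1 + -octConj w.2.1
    rw [octConj_add, neg_add]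
  map_smul' a v := by
    rw [RingHom.id_apply, ← map_smul]
    refine congrArg M.Ψ (Prod.ext (Prod.ext rfl rfl) (Prod.ext ?_ rfl))
    change -octConj (a • v.2.1) = a • -octConj v.2.1
    rw [octConj_smul, smul_neg]

theorem tangentMap_apply (v : TangentModel) :
    M.tangentMap v = M.Ψ ((v.1, v.2.1), (-octConj v.2.1, v.2.2)) := rfl

theorem tangentMap_injective : Function.Injective M.tangentMap := by
  rintro ⟨p, q, s⟩ ⟨p', q', s'⟩ h
  have h' := M.Ψ.injective h
  simp only [Prod.mk.injEq] at h'
  exact Prod.ext (Subtype.ext h'.1.1) (Prod.ext h'.1.2 (Subtype.ext h'.2.2))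

/-- For an imaginary unit a orthogonal to u, a and u anticommute and a² = -1; hence b = -(1/2) a u
has [a, b] = u. -/
theorem exists_commutator_eq (u : Octonions) (hu : octRe u = 0) :
    ∃ a b, octRe a = 0 ∧ octRe b = 0 ∧ a ⋆ b - b ⋆ a = u := by
  obtain ⟨a, ha, ha0, hau⟩ := exists_imaginary_unit_orthogonal u
  have hac : octConj a = -a := by rw [octConj_eq, ha0]; simp
  have huc : octConj u = -u := by rw [octConj_eq, hu]; simp
  have hua : a ⋆ u = -(u ⋆ a) := by rw [octMul_eq_conj_mul ha0 hau, huc, neg_octMul]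
  have haa : a ⋆ a = -octOne := by rw [octMul_self, ha0, ha]; simp
  refine ⟨a, (-(2 : ℝ)⁻¹) • (a ⋆ u), ha0, ?_, ?_⟩
  · rw [map_smul, octRe_mul, hac, octDot_neg_left, hau]
    simp
  · rw [octMul_smul, smul_octMul, octMul_flexible, ← neg_neg (u ⋆ a), ← hua, octMul_neg,
      octMul_octMul_self, haa, neg_octMul, octOne_mul]
    module

/-- Infinitesimal transitivity. Commutators of (1, 0) with (0, u), of (0, u) with (0, 1), and of (0,
a) with (0, b) produce, up to scale, the directions (0, u; -ū, 0), (u, 0; 0, -u) and (u, 0; 0, u).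
These span the tangent model; the last two handle the difference and the sum of the imaginary
components. -/
theorem tangentMap_mem_range (v : TangentModel) :
    ∃ t, op (C.bivector t) M.basePoint = M.tangentMap v := by
  have key : ∀ a b : ℝ × Octonions, ∃ t, op (C.bivector t) (M.Ψ ((octOne, 0), (0, octOne))) =
      M.Ψ (cliffordOp a (cliffordOp b (octOne, 0)) - cliffordOp b (cliffordOp a (octOne, 0)),
        cliffordOp a (cliffordOp b (0, octOne)) - cliffordOp b (cliffordOp a (0, octOne))) := by
    intro a b
    obtain ⟨t, ht⟩ := C.vec_commutator_mem (M.e a) (M.e b)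
    refine ⟨t, ?_⟩
    have h : op (C.bivector t) (M.Ψ ((octOne, 0), (0, octOne))) =
        op (C.vec (M.e a)) (op (C.vec (M.e b)) (M.Ψ ((octOne, 0), (0, octOne)))) -
        op (C.vec (M.e b)) (op (C.vec (M.e a)) (M.Ψ ((octOne, 0), (0, octOne)))) := by
      rw [op_op, op_op, ht]
      unfold op
      rw [map_sub]
      rfl
    rw [h, M.op_vec, M.op_vec, M.op_vec, M.op_vec, ← map_sub]
    rfl
  let L : (IndexPairs 8 → ℝ) →ₗ[ℝ] Space 16 :=
    { toFun := fun t => op (C.bivector t) (M.Ψ ((octOne, 0), (0, octOne)))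
      map_add' := fun t t' => by
        rw [map_add]
        unfold op
        rw [map_add]
        rfl
      map_smul' := fun a t => by
        rw [map_smul]
        unfold op
        rw [map_smul]
        rfl }
  have h1 : ∀ u, M.Ψ ((0, u), (-octConj u, 0)) ∈ LinearMap.range L := fun u => by
    obtain ⟨t, ht⟩ := key (1, 0) (0, (-(2 : ℝ)⁻¹) • u)
    refine ⟨t, ht.trans (congrArg M.Ψ ?_)⟩
    simp only [cliffordOp_apply, octConj_zero, zero_smul, one_smul, zero_octMul, octMul_zero,
      octMul_one, smul_zero, add_zero, zero_add, sub_zero, zero_sub, octConj_smul, octMul_neg]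
    refine Prod.ext (Prod.ext ?_ ?_) (Prod.ext ?_ ?_) <;>
      simp only [Prod.fst_sub, Prod.snd_sub] <;> module
  have h2 : ∀ u, octRe u = 0 → M.Ψ ((u, 0), (0, -u)) ∈ LinearMap.range L := fun u hu => by
    have huc : octConj u = -u := by rw [octConj_eq, hu]; simp
    obtain ⟨t, ht⟩ := key (0, (-(2 : ℝ)⁻¹) • u) (0, octOne)
    refine ⟨t, ht.trans (congrArg M.Ψ ?_)⟩
    simp only [cliffordOp_apply, octConj_one, zero_smul, octOne_mul, octMul_zero,
      octMul_one, add_zero, zero_add, sub_zero, octConj_smul, huc]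
    refine Prod.ext (Prod.ext ?_ ?_) (Prod.ext ?_ ?_) <;>
      simp only [Prod.fst_sub, Prod.snd_sub] <;> module
  have h3 : ∀ u, octRe u = 0 → M.Ψ ((u, 0), (0, u)) ∈ LinearMap.range L := fun u hu => by
    obtain ⟨a, b, ha, hb, hab⟩ := exists_commutator_eq (-u) (by rw [map_neg, hu, neg_zero])
    have hac : octConj a = -a := by rw [octConj_eq, ha]; simp
    have hbc : octConj b = -b := by rw [octConj_eq, hb]; simp
    obtain ⟨t, ht⟩ := key (0, a) (0, b)
    refine ⟨t, ht.trans (congrArg M.Ψ ?_)⟩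
    have hab' : u = b ⋆ a - a ⋆ b := by rw [← neg_sub, hab, neg_neg]
    simp only [cliffordOp_apply, zero_smul, octMul_zero, octMul_neg, neg_octMul,
      octMul_one, add_zero, zero_add, sub_zero, hac, hbc, hab']
    refine Prod.ext (Prod.ext ?_ ?_) (Prod.ext ?_ ?_) <;>
      simp only [Prod.fst_sub, Prod.snd_sub] <;> module
  have hv : M.tangentMap v ∈ LinearMap.range L := by
    obtain ⟨⟨p, hp⟩, q, ⟨s, hs⟩⟩ := v
    rw [LinearMap.mem_ker] at hp hs
    have hp' : octRe ((2 : ℝ)⁻¹ • (p - s)) = 0 := by rw [map_smul, map_sub, hp, hs]; simp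
    have hs' : octRe ((2 : ℝ)⁻¹ • (p + s)) = 0 := by rw [map_smul, map_add, hp, hs]; simp
    have h := add_mem (h1 q) (add_mem (h2 _ hp') (h3 _ hs'))
    rw [← map_add, ← map_add] at h
    convert h using 1
    rw [tangentMap_apply]
    refine congrArg M.Ψ (Prod.ext (Prod.ext ?_ ?_) (Prod.ext ?_ ?_)) <;>
      simp only [Prod.fst_add, Prod.snd_add] <;> module
  obtain ⟨t, ht⟩ := (LinearMap.range L).smul_mem (√2) hv
  refine ⟨t, ?_⟩
  have hs0 : (√2 : ℝ) ≠ 0 := by positivity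
  rw [basePoint, map_smul]
  change (√2)⁻¹ • L t = _
  rw [ht, inv_smul_smul₀ hs0]

/-- The equations of `M₊`. -/
def focalEq (C : SymmetricCliffordSystem 8 16) (y : Space 16) : ℝ × (Fin (8 + 1) → ℝ) :=
  (inner ℝ y y - 1, fun i => inner ℝ (op (C.P i) y) y)

theorem focalEq_eq_zero {y : Space 16} (hy : y ∈ C.focalPlus) : focalEq C y = 0 := by
  rw [mem_focalPlus_iff] at hy
  refine Prod.ext ?_ (funext hy.2)
  change inner ℝ y y - 1 = 0
  rw [real_inner_self_eq_norm_sq, hy.1]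
  norm_num

theorem contDiff_focalEq : ContDiff ℝ ∞ (focalEq C) :=
  ((contDiff_id.inner ℝ contDiff_id).sub contDiff_const).prodMk
    (contDiff_pi.2 fun i => (op (C.P i)).contDiff.inner ℝ contDiff_id)

theorem exists_hasFDerivAt_focalEq (x : Space 16) : ∃ D : Space 16 →L[ℝ] ℝ × (Fin (8 + 1) → ℝ),
    HasFDerivAt (focalEq C) D x ∧
      ∀ y, D y = 0 ↔ inner ℝ x y = (0 : ℝ) ∧ ∀ i, inner ℝ (op (C.P i) x) y = (0 : ℝ) := by
  have h1 := ((hasFDerivAt_id (𝕜 := ℝ) x).inner ℝ (hasFDerivAt_id x)).sub_const 1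
  have h2 := fun i => (op (C.P i)).hasFDerivAt.inner ℝ (hasFDerivAt_id (𝕜 := ℝ) x)
  refine ⟨_, h1.prodMk (hasFDerivAt_pi.2 h2), fun y => ?_⟩
  rw [Prod.ext_iff, funext_iff]
  refine and_congr ?_ (forall_congr' fun i => ?_)
  · simp [real_inner_comm]
  · have h : inner ℝ x (op (C.P i) y) = inner ℝ (op (C.P i) x) y := (C.inner_op_P i x y).symm
    change inner ℝ (op (C.P i) x) y + inner ℝ (op (C.P i) y) x = 0 ↔ _
    rw [real_inner_comm x, h]
    constructor <;> intro h' <;> linarith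

end SpinorModel
end SymmetricCliffordSystem

namespace SymmetricCliffordSystem
namespace SpinorModel

open CliffordAlgebra SpinPair

variable {C : SymmetricCliffordSystem 8 16} (M : C.SpinorModel)

/-- For y = (p, q; r, s), orthogonality to the base point x gives Re p + Re s = 0. Orthogonality to
the Pᵢ x gives Re p = Re s and q + r̄ = 0. -/
theorem mem_range_tangentMap {y : Space 16} (h0 : inner ℝ M.basePoint y = (0 : ℝ))
    (h : ∀ i, inner ℝ (op (C.P i) M.basePoint) y = (0 : ℝ)) :
    y ∈ LinearMap.range M.tangentMap := by
  obtain ⟨⟨⟨p, q⟩, ⟨r, s⟩⟩, rfl⟩ := M.Ψ.surjective y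
  have hs0 : (√2 : ℝ)⁻¹ ≠ 0 := by positivity
  have hv : ∀ v : ℝ × Octonions,
      v.1 * (octRe p - octRe s) + octDot v.2 (q + octConj r) = 0 := fun v => by
    have h1 : inner ℝ (op (C.vec (M.e v)) M.basePoint) (M.Ψ ((p, q), (r, s))) = (0 : ℝ) := by
      unfold op at h ⊢
      simp only [vec_apply, map_sum, map_smul, sum_apply, smul_apply, sum_inner,
        real_inner_smul_left, h, mul_zero, Finset.sum_const_zero]
    rw [basePoint, map_smul, M.op_vec, real_inner_smul_left, M.inner_Ψ,
      mul_eq_zero_iff_left hs0] at h1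
    simp only [spinorDot, cliffordOp_apply, octMul_zero, octMul_one, add_zero, sub_zero, smul_zero,
      zero_add, zero_sub, octDot_smul_left, octDot_one_left, octDot_neg_left] at h1
    have h2 : octDot v.2 (octConj r) = octDot (octConj v.2) r := by
      rw [← octDot_conj_conj, octConj_conj]
    rw [octDot_add_right, h2]
    linarith
  rw [basePoint, real_inner_smul_left, M.inner_Ψ, mul_eq_zero_iff_left hs0] at h0
  simp only [spinorDot, octDot_one_left, octDot_zero_left, add_zero, zero_add] at h0
  have h1 := hv (1, 0)
  simp only [octDot_zero_left, one_mul, add_zero] at h1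
  have h2 : q + octConj r = 0 := octDot_eq_zero_of_forall fun w => by
    simpa using hv (0, w)
  have hr : r = -octConj q := by
    rw [eq_neg_of_add_eq_zero_left h2, octConj_neg, octConj_conj, neg_neg]
  refine ⟨(⟨p, ?_⟩, q, ⟨s, ?_⟩), ?_⟩
  · rw [LinearMap.mem_ker]
    linarith
  · rw [LinearMap.mem_ker]
    linarith
  · rw [tangentMap_apply, hr]

theorem exists_hasFDerivAt_focalEq_basePoint : ∃ D : Space 16 →L[ℝ] ℝ × (Fin (8 + 1) → ℝ),
    HasFDerivAt (focalEq C) D M.basePoint ∧ D.ker ≤ LinearMap.range M.tangentMap := by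
  obtain ⟨D, hD, hD'⟩ := exists_hasFDerivAt_focalEq (C := C) M.basePoint
  refine ⟨D, hD, fun y hy => ?_⟩
  obtain ⟨h0, h⟩ := (hD' y).1 hy
  exact M.mem_range_tangentMap h0 h

theorem finrank_range_tangentMap :
    Module.finrank ℝ (LinearMap.range M.tangentMap) = 22 := by
  rw [LinearMap.finrank_range_of_inj M.tangentMap_injective, finrank_tangentModel]

/-- The orbit map of the base point along `spinParam`. -/
def orbitParam (t : IndexPairs 8 → ℝ) : Space 16 := C.spinParam t M.basePoint

theorem contDiff_orbitParam : ContDiff ℝ ∞ M.orbitParam :=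
  C.contDiff_spinParam.clm_apply contDiff_const

theorem orbitParam_zero : M.orbitParam 0 = M.basePoint := by
  rw [orbitParam, C.spinParam_zero]
  rfl

theorem orbitParam_mem (t : IndexPairs 8 → ℝ) : M.orbitParam t ∈ C.focalPlus := by
  obtain ⟨g, hg⟩ := C.spinParam_mem t
  rw [orbitParam, ← hg]
  exact C.op_rep_mem g M.basePoint_mem

theorem exists_hasFDerivAt_orbitParam : ∃ dσ : (IndexPairs 8 → ℝ) →L[ℝ] Space 16,
    HasFDerivAt M.orbitParam dσ 0 ∧ ∀ t, dσ t = op (C.bivector t) M.basePoint :=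
  ⟨_, ((ContinuousLinearMap.apply ℝ (Space 16) M.basePoint).hasFDerivAt).comp 0
    C.hasFDerivAt_spinParam, fun _ => rfl⟩

/-- Three inclusions close a circle: the image of `dσ` lies in the kernel of `D`, the kernel lies in
the tangent model, and the tangent model lies in the image of `dσ`. So all three coincide. -/
theorem exists_tangent_data : ∃ (dσ : (IndexPairs 8 → ℝ) →L[ℝ] Space 16)
    (D : Space 16 →L[ℝ] ℝ × (Fin (8 + 1) → ℝ)),
    HasFDerivAt M.orbitParam dσ 0 ∧ HasFDerivAt (focalEq C) D M.basePoint ∧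
    dσ.range = LinearMap.range M.tangentMap ∧ D.ker = LinearMap.range M.tangentMap := by
  obtain ⟨dσ, hσ, hσ'⟩ := M.exists_hasFDerivAt_orbitParam
  obtain ⟨D, hD, hD'⟩ := M.exists_hasFDerivAt_focalEq_basePoint
  have h1 : LinearMap.range M.tangentMap ≤ dσ.range := by
    rintro _ ⟨v, rfl⟩
    obtain ⟨t, ht⟩ := M.tangentMap_mem_range v
    exact ⟨t, (hσ' t).trans ht⟩
  have h2 : dσ.range ≤ D.ker := range_le_ker_of_comp_eq_zero M.orbitParam_zero
    (fun t => focalEq_eq_zero (M.orbitParam_mem t)) hσ hD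
  exact ⟨dσ, D, hσ, hD, le_antisymm (h2.trans hD') h1, le_antisymm hD' (h1.trans h2)⟩

theorem hasSliceAt_basePoint : HasSliceAt (EuclideanSpace ℝ (Fin 22))
    (EuclideanSpace ℝ (Fin 10)) C.focalPlus M.basePoint := by
  obtain ⟨dσ, D, hσ, hD, hr, hk⟩ := M.exists_tangent_data
  refine hasSliceAt_euclidean M.contDiff_orbitParam M.orbitParam_zero M.orbitParam_mem
    contDiff_focalEq (fun y hy => focalEq_eq_zero hy) hσ hD (by rw [hr, hk])
    (by rw [hr, M.finrank_range_tangentMap]) finrank_euclideanSpace_fin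

end SpinorModel

/-- The operator `spinOp g` as an automorphism of `ℝ^{2l}`. -/
def spinEquiv {m l : ℕ} (C : SymmetricCliffordSystem m l) (g : Spin (m + 1)) :
    Space l ≃L[ℝ] Space l :=
  ContinuousLinearEquiv.equivOfInverse (C.spinOp g) (C.spinOp g⁻¹)
    (fun x => by
      change (C.spinOp g⁻¹ * C.spinOp g) x = x
      rw [← spinOp_mul, inv_mul_cancel, spinOp_one]
      rfl)
    (fun x => by
      change (C.spinOp g * C.spinOp g⁻¹) x = x
      rw [← spinOp_mul, mul_inv_cancel, spinOp_one]
      rfl)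

theorem spinEquiv_mem_focalPlus_iff {m l : ℕ} (C : SymmetricCliffordSystem m l) (g : Spin (m + 1))
    (y : Space l) : C.spinEquiv g y ∈ C.focalPlus ↔ y ∈ C.focalPlus := by
  refine ⟨fun h => ?_, fun h => C.op_rep_mem g h⟩
  have h' := C.op_rep_mem g⁻¹ h
  have h2 : C.spinOp g⁻¹ (C.spinEquiv g y) = y := (C.spinEquiv g).symm_apply_apply y
  rwa [← h2]

theorem SpinorModel.isSliceEmbedding_focalPlus {C : SymmetricCliffordSystem 8 16}
    (M : C.SpinorModel) : IsSliceEmbedding (EuclideanSpace ℝ (Fin 22))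
      (EuclideanSpace ℝ (Fin 10)) (Subtype.val : C.focalPlus → Space 16) := by
  refine ⟨.subtypeVal, fun x => ?_⟩
  rw [Subtype.range_coe]
  obtain ⟨g, hg⟩ := M.exists_spinOp_basePoint_eq x.2
  have h := M.hasSliceAt_basePoint.image (C.spinEquiv g) (C.spinEquiv_mem_focalPlus_iff g)
  rwa [show C.spinEquiv g M.basePoint = x from hg] at h

end SymmetricCliffordSystem

/-! ### Groups and actions on slice-embedded manifolds -/

section

variable {F B E X : Type*} [NormedAddCommGroup F] [NormedSpace ℝ F] [NormedAddCommGroup B]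
  [NormedSpace ℝ B] [NormedAddCommGroup E] [NormedSpace ℝ E] [TopologicalSpace X]

theorem IsSliceEmbedding.contMDiff {j : X → E} (h : IsSliceEmbedding F B j)
    (e : (F × B) ≃L[ℝ] E) :
    letI := h.chartedSpace
    ContMDiff 𝓘(ℝ, F) 𝓘(ℝ, E) ∞ j := by
  let _ := h.chartedSpace
  have := h.isManifold
  exact (h.contMDiff_iff e id).1 contMDiff_id

theorem IsSliceEmbedding.isSmoothEmbedding {j : X → E} (h : IsSliceEmbedding F B j)
    (e : (F × B) ≃L[ℝ] E) :
    letI := h.chartedSpace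
    Manifold.IsSmoothEmbedding 𝓘(ℝ, F) 𝓘(ℝ, E) ∞ j := by
  let _ := h.chartedSpace
  exact ⟨(h.isImmersionOfComplement e).isImmersion, h.isEmbedding⟩

theorem IsSliceEmbedding.lieGroup {G 𝔸 : Type*} [Group G] [TopologicalSpace G] [NormedRing 𝔸]
    [NormedAlgebra ℝ 𝔸] {j : G → 𝔸} (h : IsSliceEmbedding F B j) (e : (F × B) ≃L[ℝ] 𝔸)
    (hmul : ∀ a b, j (a * b) = j a * j b) (S : 𝔸 →L[ℝ] 𝔸) (hinv : ∀ a, j a⁻¹ = S (j a)) :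
    letI := h.chartedSpace
    LieGroup 𝓘(ℝ, F) ∞ G := by
  let _ := h.chartedSpace
  have := h.isManifold
  have hj := h.contMDiff e
  have h1 : ContMDiff (𝓘(ℝ, F).prod 𝓘(ℝ, F)) 𝓘(ℝ, F) ∞ fun p : G × G => p.1 * p.2 := by
    rw [h.contMDiff_iff e]
    have h2 : (j ∘ fun p : G × G => p.1 * p.2) = fun p => j p.1 * j p.2 :=
      funext fun p => hmul _ _
    rw [h2]
    have h3 : ContDiff ℝ ∞ fun p : 𝔸 × 𝔸 => p.1 * p.2 := contDiff_fst.mul contDiff_snd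
    exact h3.contMDiff.comp
      ((hj.comp contMDiff_fst).prodMk_space (hj.comp contMDiff_snd))
  have h2 : ContMDiff 𝓘(ℝ, F) 𝓘(ℝ, F) ∞ fun a : G => a⁻¹ := by
    rw [h.contMDiff_iff e]
    have h3 : (j ∘ fun a : G => a⁻¹) = fun a => S (j a) := funext hinv
    rw [h3]
    exact S.contDiff.contMDiff.comp hj
  exact { contMDiff_mul := h1, contMDiff_inv := h2 }

theorem IsSliceEmbedding.contMDiff_smul {G F' B' : Type*} [NormedAddCommGroup F']
    [NormedSpace ℝ F'] [NormedAddCommGroup B'] [NormedSpace ℝ B'] [TopologicalSpace G] [SMul G X]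
    {i : G → E →L[ℝ] E} (hi : IsSliceEmbedding F' B' i) (ei : (F' × B') ≃L[ℝ] (E →L[ℝ] E))
    {j : X → E} (hj : IsSliceEmbedding F B j) (ej : (F × B) ≃L[ℝ] E)
    (hsmul : ∀ g x, j (g • x) = i g (j x)) :
    letI := hi.chartedSpace
    letI := hj.chartedSpace
    ContMDiff (𝓘(ℝ, F').prod 𝓘(ℝ, F)) 𝓘(ℝ, F) ∞ fun p : G × X => p.1 • p.2 := by
  let _ := hi.chartedSpace
  let _ := hj.chartedSpace
  have := hi.isManifold
  have := hj.isManifold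
  rw [hj.contMDiff_iff ej]
  have h2 : (j ∘ fun p : G × X => p.1 • p.2) = fun p => i p.1 (j p.2) :=
    funext fun p => hsmul _ _
  rw [h2]
  have h3 : ContDiff ℝ ∞ fun p : (E →L[ℝ] E) × E => p.1 p.2 :=
    contDiff_fst.clm_apply contDiff_snd
  exact h3.contMDiff.comp
    (((hi.contMDiff ei).comp contMDiff_fst).prodMk_space ((hj.contMDiff ej).comp contMDiff_snd))

end

/-! ### Surjectivity of differentials and open maps -/

section

variable {F₁ F₂ N E : Type*} [NormedAddCommGroup F₁] [NormedSpace ℝ F₁]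
  [NormedAddCommGroup F₂] [NormedSpace ℝ F₂] [FiniteDimensional ℝ F₂]
  [NormedAddCommGroup N] [NormedSpace ℝ N] [FiniteDimensional ℝ N] [NormedAddCommGroup E]
  [NormedSpace ℝ E]
  {G X : Type*} [TopologicalSpace G] [ChartedSpace F₁ G] [TopologicalSpace X] [ChartedSpace F₂ X]

theorem surjective_of_finrank_le_finrank_range_comp (a : N →L[ℝ] F₁) (b : F₁ →L[ℝ] F₂)
    (c : F₂ →L[ℝ] E) (L : N →L[ℝ] E) (hL : ∀ t, L t = c (b (a t)))
    (h : Module.finrank ℝ F₂ ≤ Module.finrank ℝ L.range) : Function.Surjective b := by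
  have h1 : L.range ≤ Submodule.map (c : F₂ →ₗ[ℝ] E) b.range := by
    rintro _ ⟨t, rfl⟩
    exact ⟨b (a t), ⟨a t, rfl⟩, (hL t).symm⟩
  have h2 := Submodule.finrank_mono h1
  have h3 := Submodule.finrank_map_le (c : F₂ →ₗ[ℝ] E) b.range
  have h4 : (b : F₁ →ₗ[ℝ] F₂).range = ⊤ :=
    Submodule.eq_top_of_finrank_eq (le_antisymm (Submodule.finrank_le _) (h.trans (h2.trans h3)))
  exact LinearMap.range_eq_top.1 h4

/-- The composite through the tangent space of `X` has rank at least dim `X`, so the middle factor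
is onto. -/
theorem surjective_mfderiv_of_comp {s : N → G} {f : G → X} {k : X → E} {L : N →L[ℝ] E} {t : N}
    (hs : MDifferentiableAt 𝓘(ℝ, N) 𝓘(ℝ, F₁) s t)
    (hf : MDifferentiableAt 𝓘(ℝ, F₁) 𝓘(ℝ, F₂) f (s t))
    (hk : MDifferentiableAt 𝓘(ℝ, F₂) 𝓘(ℝ, E) k (f (s t)))
    (hL : HasFDerivAt (fun t => k (f (s t))) L t)
    (h : Module.finrank ℝ F₂ ≤ Module.finrank ℝ L.range) :
    Function.Surjective (mfderiv 𝓘(ℝ, F₁) 𝓘(ℝ, F₂) f (s t)) := by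
  refine surjective_of_finrank_le_finrank_range_comp (N := N) (F₁ := F₁) (F₂ := F₂) (E := E)
    (mfderiv 𝓘(ℝ, N) 𝓘(ℝ, F₁) s t) _ (mfderiv 𝓘(ℝ, F₂) 𝓘(ℝ, E) k (f (s t))) L (fun v => ?_) h
  have h1 := (hk.hasMFDerivAt.comp (s t) hf.hasMFDerivAt).comp t hs.hasMFDerivAt
  have h2 := hasMFDerivAt_unique h1 hL.hasMFDerivAt
  exact (congrArg (fun T : N →L[ℝ] E => T v) h2).symm

theorem isOpenMap_of_surjective_mfderiv [CompleteSpace F₁] [IsManifold 𝓘(ℝ, F₁) ∞ G]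
    [IsManifold 𝓘(ℝ, F₂) ∞ X] {f : G → X}
    (hf : ContMDiff 𝓘(ℝ, F₁) 𝓘(ℝ, F₂) ∞ f)
    (hs : ∀ g, Function.Surjective (mfderiv 𝓘(ℝ, F₁) 𝓘(ℝ, F₂) f g)) : IsOpenMap f := by
  refine isOpenMap_iff_nhds_le.2 fun x => ?_
  set φ := chartAt F₁ x
  set ψ := chartAt F₂ (f x)
  let g : F₁ → F₂ := ψ ∘ f ∘ φ.symm
  have hxφ : x ∈ φ.source := mem_chart_source F₁ x
  have hxψ : f x ∈ ψ.source := mem_chart_source F₂ (f x)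
  have hU : IsOpen (φ.target ∩ φ.symm ⁻¹' (f ⁻¹' ψ.source)) :=
    φ.isOpen_inter_preimage_symm (ψ.open_source.preimage hf.continuous)
  have hxU : φ x ∈ φ.target ∩ φ.symm ⁻¹' (f ⁻¹' ψ.source) := by
    refine ⟨mem_chart_target F₁ x, ?_⟩
    rw [Set.mem_preimage, φ.left_inv hxφ]
    exact hxψ
  have hg : ContDiffAt ℝ ∞ g (φ x) := by
    have h1 := (contMDiff_iff.1 hf).2 x (f x)
    have h2 : ContDiffOn ℝ ∞ g (φ.target ∩ φ.symm ⁻¹' (f ⁻¹' ψ.source)) := by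
      simpa [g, extChartAt, OpenPartialHomeomorph.extend] using h1
    exact h2.contDiffAt (hU.mem_nhds hxU)
  let D : F₁ →L[ℝ] F₂ := mfderiv 𝓘(ℝ, F₁) 𝓘(ℝ, F₂) f x
  have hdg : HasFDerivAt g D (φ x) := by
    have h1 := ((hf x).mdifferentiableAt (by simp)).hasMFDerivAt.2
    simp only [writtenInExtChartAt, extChartAt, OpenPartialHomeomorph.extend, mfld_simps] at h1
    exact hasFDerivWithinAt_univ.1 h1
  have h3 : Filter.map g (nhds (φ x)) = nhds (g (φ x)) :=
    (hg.hasStrictFDerivAt' hdg (by simp)).map_nhds_eq_of_surj (LinearMap.range_eq_top.2 (hs x))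
  have hgx : g (φ x) = ψ (f x) := by simp only [g, Function.comp_apply, φ.left_inv hxφ]
  have h4 : f =ᶠ[nhds x] fun y => ψ.symm (g (φ y)) := by
    filter_upwards [φ.open_source.mem_nhds hxφ,
      hf.continuous.continuousAt.preimage_mem_nhds (ψ.open_source.mem_nhds hxψ)] with y hy hy'
    simp only [g, Function.comp_apply, φ.left_inv hy]
    exact (ψ.left_inv hy').symm
  have h5 : Filter.map ψ.symm (nhds (ψ (f x))) = nhds (f x) := by
    have h := ψ.symm.map_nhds_eq (x := ψ (f x)) (ψ.map_source hxψ)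
    rwa [ψ.left_inv hxψ] at h
  rw [Filter.map_congr h4, ← h5, ← hgx, ← h3, ← φ.map_nhds_eq hxφ, Filter.map_map,
    Filter.map_map]
  rfl

end

/-! ### The isotropy representation in the model -/

theorem isInternal_of_projections {ι V : Type*} [Fintype ι] [DecidableEq ι] [AddCommGroup V]
    [Module ℝ V] {W : ι → Submodule ℝ V} (π : ι → V →ₗ[ℝ] V) (h1 : ∀ i, ∀ v ∈ W i, π i v = v)
    (h2 : ∀ i j, i ≠ j → ∀ v ∈ W j, π i v = 0) (h3 : ∀ i v, π i v ∈ W i)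
    (h4 : ∀ v, ∑ i, π i v = v) : DirectSum.IsInternal W := by
  have key : ∀ (x : DirectSum ι fun i => W i) (i : ι),
      π i (DirectSum.coeAddMonoidHom W x) = x i := by
    intro x i
    induction x using DirectSum.induction_on with
    | zero => simp
    | of j y =>
      rw [DirectSum.coeAddMonoidHom_of]
      by_cases hij : i = j
      · subst hij
        rw [h1 i _ y.2, DirectSum.of_eq_same]
      · rw [h2 i j hij _ y.2, DirectSum.of_eq_of_ne _ _ _ hij]
        rfl
    | add x y hx hy =>
      rw [map_add, map_add, hx, hy, DirectSum.add_apply]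
      rfl
  constructor
  · intro x y h
    refine DFinsupp.ext fun i => Subtype.ext ?_
    rw [← key, ← key, h]
  · intro v
    refine ⟨∑ i, DirectSum.of (fun i => W i) i ⟨π i v, h3 i v⟩, ?_⟩
    rw [map_sum]
    simp only [DirectSum.coeAddMonoidHom_of]
    exact h4 v

namespace G2

/-- The action of `G₂` on the imaginary octonions. -/
def onImOct (α : G2) (z : ImOct) : ImOct :=
  ⟨α.1.val z, by rw [LinearMap.mem_ker, octRe_map]; exact z.2⟩

/-- Every `ρ k` acts on the image of `i` as some automorphism and every automorphism occurs, so
invariant subspaces of the image pull back to G₂-invariant subspaces of Im 𝕆. -/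
theorem irreducible_range {V K : Type*} [AddCommGroup V] [Module ℝ V] {ρ : K → V → V}
    {i : ImOct →ₗ[ℝ] V} (hi : Function.Injective i)
    (h1 : ∀ k, ∃ α : G2, ∀ z, ρ k (i z) = i (onImOct α z))
    (h2 : ∀ α : G2, ∃ k, ∀ z, ρ k (i z) = i (onImOct α z)) :
    Module.finrank ℝ (LinearMap.range i) = 7 ∧
      (∀ k, ∀ v ∈ LinearMap.range i, ρ k v ∈ LinearMap.range i) ∧ LinearMap.range i ≠ ⊥ ∧
      ∀ U ≤ LinearMap.range i, (∀ k, ∀ v ∈ U, ρ k v ∈ U) → U = ⊥ ∨ U = LinearMap.range i := by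
  have hfr : Module.finrank ℝ (LinearMap.range i) = 7 := by
    rw [LinearMap.finrank_range_of_inj hi, finrank_imOct]
  refine ⟨hfr, ?_, ?_, fun U hU hinv => ?_⟩
  · rintro k _ ⟨z, rfl⟩
    obtain ⟨α, hα⟩ := h1 k
    exact ⟨_, (hα z).symm⟩
  · intro h
    rw [h, finrank_bot] at hfr
    omega
  · have hU' : (U.comap i).map ImOct.subtype ≤ LinearMap.ker octRe := by
      rintro _ ⟨z, -, rfl⟩
      exact z.2
    rcases eq_bot_or_eq_ker_of_invariant hU' (by
      rintro α _ ⟨z, hz, rfl⟩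
      obtain ⟨k, hk⟩ := h2 α
      refine ⟨onImOct α z, ?_, rfl⟩
      have := hinv k _ hz
      rwa [hk] at this) with h | h
    · left
      rw [Submodule.eq_bot_iff]
      intro v hv
      obtain ⟨z, rfl⟩ := hU hv
      have hz : (z : Octonions) ∈ (U.comap i).map ImOct.subtype := ⟨z, hv, rfl⟩
      rw [h, Submodule.mem_bot] at hz
      rw [show z = 0 from Subtype.ext hz, map_zero]
    · right
      refine le_antisymm hU ?_
      rintro _ ⟨z, rfl⟩
      have hz : (z : Octonions) ∈ (U.comap i).map ImOct.subtype := by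
        rw [h]
        exact z.2
      obtain ⟨z', hz', he⟩ := hz
      rwa [← show z' = z from Subtype.ext he]

end G2

namespace SymmetricCliffordSystem
namespace SpinorModel

/-- The isotropy action of `G₂` on the model of the tangent space. -/
def tangentAct (α : G2) (v : TangentModel) : TangentModel :=
  (G2.onImOct α v.1, α.1.val v.2.1, G2.onImOct α v.2.2)

/-- The imaginary part of an octonion. -/
def octIm : Octonions →ₗ[ℝ] ImOct where
  toFun x := ⟨x - octRe x • octOne, by simp [octRe_one]⟩
  map_add' x y := Subtype.ext <| by
    change x + y - octRe (x + y) • octOne = x - octRe x • octOne + (y - octRe y • octOne)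
    rw [map_add]
    module
  map_smul' a x := Subtype.ext <| by
    change a • x - octRe (a • x) • octOne = a • (x - octRe x • octOne)
    rw [map_smul, smul_eq_mul]
    module

theorem octIm_coe (z : ImOct) : octIm z = z := Subtype.ext <| by
  change (z : Octonions) - octRe z • octOne = z
  rw [show octRe z = 0 from z.2, zero_smul, sub_zero]

theorem octIm_one : octIm octOne = 0 := Subtype.ext <| by
  change octOne - octRe octOne • octOne = 0
  rw [octRe_one, one_smul, sub_self]

/-- The middle summand of the tangent model splits as 𝕆 = ℝ ⊕ Im 𝕆, which gives the trivial line and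
the second of the three copies of Im 𝕆. -/
theorem exists_isotropy_decomposition {V K : Type*} [AddCommGroup V] [Module ℝ V] {ρ : K → V → V}
    (L : V ≃ₗ[ℝ] TangentModel) (h1 : ∀ k, ∃ α : G2, ∀ v, L (ρ k v) = tangentAct α (L v))
    (h2 : ∀ α : G2, ∃ k, ∀ v, L (ρ k v) = tangentAct α (L v)) :
    ∃ W : Fin 4 → Submodule ℝ V, DirectSum.IsInternal W ∧ Module.finrank ℝ (W 0) = 1 ∧
      (∀ k, ∀ v ∈ W 0, ρ k v = v) ∧
      ∀ i : Fin 4, i ≠ 0 → Module.finrank ℝ (W i) = 7 ∧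
        (∀ k, ∀ v ∈ W i, ρ k v ∈ W i) ∧ W i ≠ ⊥ ∧
        ∀ U ≤ W i, (∀ k, ∀ v ∈ U, ρ k v ∈ U) → U = ⊥ ∨ U = W i := by
  let j₀ : ℝ →ₗ[ℝ] TangentModel :=
    LinearMap.inr ℝ _ _ ∘ₗ LinearMap.inl ℝ _ _ ∘ₗ LinearMap.toSpanSingleton ℝ _ octOne
  let j₁ : ImOct →ₗ[ℝ] TangentModel := LinearMap.inl ℝ _ _
  let j₂ : ImOct →ₗ[ℝ] TangentModel :=
    LinearMap.inr ℝ _ _ ∘ₗ LinearMap.inl ℝ _ _ ∘ₗ ImOct.subtype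
  let j₃ : ImOct →ₗ[ℝ] TangentModel := LinearMap.inr ℝ _ _ ∘ₗ LinearMap.inr ℝ _ _
  let p₀ : TangentModel →ₗ[ℝ] ℝ := octRe ∘ₗ LinearMap.fst ℝ _ _ ∘ₗ LinearMap.snd ℝ _ _
  let p₁ : TangentModel →ₗ[ℝ] ImOct := LinearMap.fst ℝ _ _
  let p₂ : TangentModel →ₗ[ℝ] ImOct := octIm ∘ₗ LinearMap.fst ℝ _ _ ∘ₗ LinearMap.snd ℝ _ _
  let p₃ : TangentModel →ₗ[ℝ] ImOct := LinearMap.snd ℝ _ _ ∘ₗ LinearMap.snd ℝ _ _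
  have hj₀ : ∀ a, j₀ a = (0, a • octOne, 0) := fun a => rfl
  have hj₁ : ∀ z, j₁ z = (z, 0, 0) := fun a => rfl
  have hj₂ : ∀ z : ImOct, j₂ z = (0, (z : Octonions), 0) := fun a => rfl
  have hj₃ : ∀ z, j₃ z = (0, 0, z) := fun a => rfl
  have hp₀ : ∀ v, p₀ v = octRe v.2.1 := fun v => rfl
  have hp₁ : ∀ v, p₁ v = v.1 := fun v => rfl
  have hp₂ : ∀ v, p₂ v = octIm v.2.1 := fun v => rfl
  have hp₃ : ∀ v, p₃ v = v.2.2 := fun v => rfl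
  let S : TangentModel →ₗ[ℝ] V := L.symm.toLinearMap
  have hS : ∀ v, S v = L.symm v := fun v => rfl
  have hSi : Function.Injective S := L.symm.injective
  have hre : ∀ z : ImOct, octRe (z : Octonions) = 0 := fun z => z.2
  have hz0 : ∀ α : G2, G2.onImOct α 0 = 0 := fun α => Subtype.ext (_root_.map_zero α.1.val)
  have heq : ∀ {i : ImOct →ₗ[ℝ] TangentModel} (_ : ∀ α z, tangentAct α (i z) = i (G2.onImOct α z))
      (k : K) (α : G2), (∀ v, L (ρ k v) = tangentAct α (L v)) →
      ∀ z, ρ k ((S ∘ₗ i) z) = (S ∘ₗ i) (G2.onImOct α z) := fun {i} hi k α hα z => by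
    rw [LinearMap.comp_apply, LinearMap.comp_apply, hS, hS, LinearEquiv.eq_symm_apply, hα,
      L.apply_symm_apply, hi]
  have hirr : ∀ {i : ImOct →ₗ[ℝ] TangentModel} (_ : Function.Injective i)
      (_ : ∀ α z, tangentAct α (i z) = i (G2.onImOct α z)), _ := fun {i} hinj hi =>
    G2.irreducible_range (ρ := ρ) (i := S ∘ₗ i) (hSi.comp hinj)
      (fun k => (h1 k).imp fun α hα => heq hi k α hα)
      (fun α => (h2 α).imp fun k hk => heq hi k α hk)
  have hi₁ : Function.Injective j₁ := LinearMap.inl_injective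
  have hi₂ : Function.Injective j₂ :=
    LinearMap.inr_injective.comp (LinearMap.inl_injective.comp ImOct.injective_subtype)
  have hi₃ : Function.Injective j₃ := LinearMap.inr_injective.comp LinearMap.inr_injective
  have hi₀ : Function.Injective j₀ := by
    refine LinearMap.inr_injective.comp (LinearMap.inl_injective.comp fun a b h => ?_)
    have h' : a • octOne = b • octOne := h
    have := congrArg octRe h'
    simpa [octRe_one] using this
  have hr₁ := hirr hi₁ fun α z => by
    rw [hj₁, hj₁, tangentAct]
    simp only [hz0, _root_.map_zero]
  have hr₂ := hirr hi₂ fun α z => by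
    rw [hj₂, hj₂, tangentAct]
    simp only [hz0]
    rfl
  have hr₃ := hirr hi₃ fun α z => by
    rw [hj₃, hj₃, tangentAct]
    simp only [hz0, _root_.map_zero]
  refine ⟨![LinearMap.range (S ∘ₗ j₀), LinearMap.range (S ∘ₗ j₁), LinearMap.range (S ∘ₗ j₂),
    LinearMap.range (S ∘ₗ j₃)], ?_, ?_, ?_, ?_⟩
  · refine isInternal_of_projections ![S ∘ₗ j₀ ∘ₗ p₀ ∘ₗ L.toLinearMap,
      S ∘ₗ j₁ ∘ₗ p₁ ∘ₗ L.toLinearMap, S ∘ₗ j₂ ∘ₗ p₂ ∘ₗ L.toLinearMap,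
      S ∘ₗ j₃ ∘ₗ p₃ ∘ₗ L.toLinearMap] ?_ ?_ ?_ ?_
    · intro i
      fin_cases i <;> rintro _ ⟨z, rfl⟩ <;>
        simp [hS, hj₀, hj₁, hj₂, hj₃, hp₀, hp₁, hp₂, hp₃, octRe_one, octIm_coe]
    · intro i j hij
      fin_cases i <;> fin_cases j <;> first | exact absurd rfl hij | skip
      all_goals rintro _ ⟨z, rfl⟩
      all_goals simp [hS, hj₀, hj₁, hj₂, hj₃, hp₀, hp₁, hp₂, hp₃, octIm_one, hre]
    · intro i v
      fin_cases i <;> exact ⟨_, rfl⟩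
    · intro v
      rw [Fin.sum_univ_four]
      change S (j₀ (p₀ (L v))) + S (j₁ (p₁ (L v))) + S (j₂ (p₂ (L v))) + S (j₃ (p₃ (L v))) = v
      rw [← map_add, ← map_add, ← map_add, hS, LinearEquiv.symm_apply_eq, hj₀, hj₁, hj₂, hj₃, hp₀,
        hp₁, hp₂, hp₃]
      refine Prod.ext ?_ (Prod.ext ?_ ?_)
      · simp
      · change octRe (L v).2.1 • octOne + 0 + ((L v).2.1 - octRe (L v).2.1 • octOne) + 0 = _
        module
      · simp
  · change Module.finrank ℝ (LinearMap.range (S ∘ₗ j₀)) = 1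
    rw [LinearMap.finrank_range_of_inj (f := S ∘ₗ j₀) (hSi.comp hi₀), Module.finrank_self]
  · rintro k _ ⟨a, rfl⟩
    obtain ⟨α, hα⟩ := h1 k
    rw [LinearMap.comp_apply, hS, LinearEquiv.eq_symm_apply, hα, L.apply_symm_apply, hj₀,
      tangentAct]
    simp only [hz0, map_smul, G2.map_one]
  · intro i hi
    fin_cases i
    · exact absurd rfl hi
    · exact hr₁
    · exact hr₂
    · exact hr₃

/-- The G₂-fixed vectors of the tangent model form the line spanned by u = (0, 1, 0). An equivariant
A preserves it, so A u = c u, and A² = -1 would give c² = -1. -/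
theorem not_exists_equivariant_complex_structure (A : TangentModel →ₗ[ℝ] TangentModel)
    (hA : ∀ (α : G2) v, A (tangentAct α v) = tangentAct α (A v)) (hsq : ∀ v, A (A v) = -v) :
    False := by
  let u : TangentModel := (0, octOne, 0)
  have hu : ∀ α : G2, tangentAct α u = u := fun α =>
    Prod.ext (Subtype.ext (_root_.map_zero α.1.val))
      (Prod.ext (G2.map_one α) (Subtype.ext (_root_.map_zero α.1.val)))
  have hfix : ∀ α : G2, tangentAct α (A u) = A u := fun α => by rw [← hA, hu]
  have h1 : (A u).1 = 0 := Subtype.ext <| G2.eq_zero_of_fixed (A u).1.2 fun α =>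
    congrArg (fun v : TangentModel => (v.1 : Octonions)) (hfix α)
  have h3 : (A u).2.2 = 0 := Subtype.ext <| G2.eq_zero_of_fixed (A u).2.2.2 fun α =>
    congrArg (fun v : TangentModel => (v.2.2 : Octonions)) (hfix α)
  have h2 : (A u).2.1 = octRe (A u).2.1 • octOne := by
    rw [← sub_eq_zero]
    refine G2.eq_zero_of_fixed (by simp [octRe_one]) fun α => ?_
    have h := congrArg (fun v : TangentModel => v.2.1) (hfix α)
    change α.1.val (A u).2.1 = (A u).2.1 at h
    rw [map_sub, map_smul, G2.map_one, h]
  set c := octRe (A u).2.1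
  have h4 : A u = c • u := Prod.ext (by rw [h1]; simp [u]) (Prod.ext h2 (by rw [h3]; simp [u]))
  have h5 := hsq u
  rw [h4, map_smul, h4, smul_smul] at h5
  have h6 := congrArg (fun v : TangentModel => octRe v.2.1) h5
  change octRe ((c * c) • octOne) = octRe (-octOne) at h6
  rw [map_smul, map_neg, octRe_one, smul_eq_mul, mul_one] at h6
  nlinarith

end SpinorModel
end SymmetricCliffordSystem

/-! ### Smoothness and surjective differentials of orbit maps -/

namespace SymmetricCliffordSystem

variable {C : SymmetricCliffordSystem 8 16}

theorem exists_prod_equiv_operators : Nonempty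
    ((EuclideanSpace ℝ (Fin 36) × EuclideanSpace ℝ (Fin 988)) ≃L[ℝ]
      (Space 16 →L[ℝ] Space 16)) := by
  refine FiniteDimensional.nonempty_continuousLinearEquiv_of_finrank_eq ?_
  rw [finrank_operators, Module.finrank_prod, finrank_euclideanSpace_fin,
    finrank_euclideanSpace_fin]

theorem exists_prod_equiv_space : Nonempty
    ((EuclideanSpace ℝ (Fin 22) × EuclideanSpace ℝ (Fin 10)) ≃L[ℝ] Space 16) := by
  refine FiniteDimensional.nonempty_continuousLinearEquiv_of_finrank_eq ?_
  rw [Module.finrank_prod, finrank_euclideanSpace_fin, finrank_euclideanSpace_fin,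
    finrank_euclideanSpace_fin]

theorem lieGroup_spin (hC : C.IsDefinite) :
    letI := (isSliceEmbedding_spinOp hC).chartedSpace
    LieGroup (𝓡 36) ∞ (Spin (8 + 1)) := by
  obtain ⟨e⟩ := exists_prod_equiv_operators
  let St : (Space 16 →L[ℝ] Space 16) ≃L[ℝ] (Space 16 →L[ℝ] Space 16) := starL' ℝ
  exact (isSliceEmbedding_spinOp hC).lieGroup e C.spinOp_mul
    (St : (Space 16 →L[ℝ] Space 16) →L[ℝ] (Space 16 →L[ℝ] Space 16)) C.spinOp_inv

namespace SpinorModel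

variable (M : C.SpinorModel)

/-- The target `Y` is kept general so that the orbit map to M₊ and the projection to the quotient
are treated together. -/
theorem contMDiff_of_orbit (hC : C.IsDefinite) {Y : Type*} [TopologicalSpace Y] {j : Y → Space 16}
    (hj : IsSliceEmbedding (EuclideanSpace ℝ (Fin 22)) (EuclideanSpace ℝ (Fin 10)) j)
    {f : Spin (8 + 1) → Y} (hf : ∀ g, j (f g) = C.spinOp g M.basePoint) :
    letI := (isSliceEmbedding_spinOp hC).chartedSpace
    letI := hj.chartedSpace
    ContMDiff (𝓡 36) (𝓡 22) ∞ f := by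
  let hs := isSliceEmbedding_spinOp hC
  let _ := hs.chartedSpace
  let _ := hj.chartedSpace
  have := hs.isManifold
  obtain ⟨e⟩ := exists_prod_equiv_operators
  obtain ⟨e'⟩ := exists_prod_equiv_space
  rw [hj.contMDiff_iff e']
  have h1 : j ∘ f = fun g => C.spinOp g M.basePoint := funext hf
  rw [h1]
  have h2 : ContDiff ℝ ∞ fun T : Space 16 →L[ℝ] Space 16 => T M.basePoint :=
    contDiff_id.clm_apply contDiff_const
  exact h2.contMDiff.comp (hs.contMDiff e)

theorem surjective_mfderiv_of_orbit (hC : C.IsDefinite) {Y : Type*} [TopologicalSpace Y]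
    {j : Y → Space 16}
    (hj : IsSliceEmbedding (EuclideanSpace ℝ (Fin 22)) (EuclideanSpace ℝ (Fin 10)) j)
    {f : Spin (8 + 1) → Y} (hf : ∀ g, j (f g) = C.spinOp g M.basePoint) :
    letI := (isSliceEmbedding_spinOp hC).chartedSpace
    letI := hj.chartedSpace
    ∀ g, Function.Surjective (mfderiv (𝓡 36) (𝓡 22) f g) := by
  let hs := isSliceEmbedding_spinOp hC
  let _ := hs.chartedSpace
  let _ := hj.chartedSpace
  have := hs.isManifold
  obtain ⟨e⟩ := exists_prod_equiv_operators
  obtain ⟨e'⟩ := exists_prod_equiv_space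
  intro g
  choose σ hσ using fun t => C.spinParam_mem t
  -- The factor `(σ 0)⁻¹` acts as the identity and makes `s 0 = g` hold for the chosen lifts `σ`.
  let s : (IndexPairs 8 → ℝ) → Spin (8 + 1) := fun t => g * σ t * (σ 0)⁻¹
  have hs0 : s 0 = g := mul_inv_cancel_right g (σ 0)
  have hss : ∀ t, C.spinOp (s t) = C.spinOp g * C.spinParam t := fun t => by
    have h0 : C.spinOp (σ 0)⁻¹ = 1 := by
      have h1 := C.spinOp_mul (σ 0)⁻¹ (σ 0)
      rw [inv_mul_cancel, spinOp_one, hσ, C.spinParam_zero, mul_one] at h1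
      exact h1.symm
    rw [spinOp_mul, spinOp_mul, h0, mul_one, hσ]
  have hsm : ContMDiff 𝓘(ℝ, IndexPairs 8 → ℝ) (𝓡 36) ∞ s := by
    rw [hs.contMDiff_iff e]
    have h1 : C.spinOp ∘ s = fun t => C.spinOp g * C.spinParam t := funext hss
    rw [h1]
    exact (contDiff_const.mul C.contDiff_spinParam).contMDiff
  obtain ⟨dσ, D, hdσ, -, hr, -⟩ := M.exists_tangent_data
  have hL : HasFDerivAt (fun t => j (f (s t)))
      ((C.spinEquiv g : Space 16 →L[ℝ] Space 16).comp dσ) 0 := by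
    have h1 : (fun t => j (f (s t))) = fun t => C.spinEquiv g (M.orbitParam t) := by
      funext t
      rw [hf, hss]
      rfl
    rw [h1]
    exact (C.spinEquiv g : Space 16 →L[ℝ] Space 16).hasFDerivAt.comp 0 hdσ
  have hrank : Module.finrank ℝ
      ((C.spinEquiv g : Space 16 →L[ℝ] Space 16).comp dσ).range = 22 := by
    have h1 : ((C.spinEquiv g : Space 16 →L[ℝ] Space 16).comp dσ).range =
        dσ.range.map (C.spinEquiv g).toLinearEquiv.toLinearMap :=
      LinearMap.range_comp _ _
    rw [h1, LinearEquiv.finrank_map_eq, hr, M.finrank_range_tangentMap]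
  have hfm := M.contMDiff_of_orbit hC hj hf
  have h := surjective_mfderiv_of_comp (f := f) (k := j) (t := 0)
    ((hsm 0).mdifferentiableAt (by simp)) ((hfm (s 0)).mdifferentiableAt (by simp))
    ((hj.contMDiff e' (f (s 0))).mdifferentiableAt (by simp)) hL (by
      rw [hrank, finrank_euclideanSpace_fin])
  rwa [hs0] at h

theorem isSubmersion_of_orbit (hC : C.IsDefinite) {Y : Type} [TopologicalSpace Y]
    {j : Y → Space 16}
    (hj : IsSliceEmbedding (EuclideanSpace ℝ (Fin 22)) (EuclideanSpace ℝ (Fin 10)) j)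
    {f : Spin (8 + 1) → Y} (hf : ∀ g, j (f g) = C.spinOp g M.basePoint) :
    letI := (isSliceEmbedding_spinOp hC).chartedSpace
    letI := hj.chartedSpace
    Manifold.IsSubmersion (𝓡 36) (𝓡 22) ∞ f := by
  let _ := (isSliceEmbedding_spinOp hC).chartedSpace
  let _ := hj.chartedSpace
  have := (isSliceEmbedding_spinOp hC).isManifold
  have := hj.isManifold
  -- The fibre dimension is 36 - 22 = 14, the dimension of G₂.
  have h := isSubmersionOfComplement_of_surjective_mfderiv (C := EuclideanSpace ℝ (Fin 14))
    (M.contMDiff_of_orbit hC hj hf) (M.surjective_mfderiv_of_orbit hC hj hf) (by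
      rw [finrank_euclideanSpace_fin, finrank_euclideanSpace_fin, finrank_euclideanSpace_fin])
  exact h.isSubmersion

/-! ### The homogeneous space -/

theorem isOpenMap_orbit (hC : C.IsDefinite) :
    IsOpenMap fun g : Spin (8 + 1) => g • M.base := by
  let hs := isSliceEmbedding_spinOp hC
  let hj := M.isSliceEmbedding_focalPlus
  let _ := hs.chartedSpace
  let _ := hj.chartedSpace
  have := hs.isManifold
  have := hj.isManifold
  exact isOpenMap_of_surjective_mfderiv
    (M.contMDiff_of_orbit hC hj (f := fun g => g • M.base) fun g => rfl)
    (M.surjective_mfderiv_of_orbit hC hj fun g => rfl)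

/-- The bijection from the homogeneous space onto `M₊`. -/
def orbitEquiv : (Spin (8 + 1) ⧸ M.isotropyGroup) ≃ C.focalPlus :=
  Equiv.ofBijective (MulAction.ofQuotientStabilizer (Spin (8 + 1)) M.base)
    ⟨MulAction.injective_ofQuotientStabilizer _ _, fun y => by
      have := M.isPretransitive
      obtain ⟨g, hg⟩ := MulAction.exists_smul_eq (Spin (8 + 1)) M.base y
      exact ⟨QuotientGroup.mk g, hg⟩⟩

theorem orbitEquiv_smul (g : Spin (8 + 1)) (q : Spin (8 + 1) ⧸ M.isotropyGroup) :
    M.orbitEquiv (g • q) = g • M.orbitEquiv q :=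
  MulAction.ofQuotientStabilizer_smul (Spin (8 + 1)) M.base g q

/-- The induced bijection is continuous, and it is open because the orbit map is open. -/
theorem isEmbedding_orbitEquiv (hC : C.IsDefinite) : Topology.IsEmbedding M.orbitEquiv := by
  have hopen := M.isOpenMap_orbit hC
  let hs := isSliceEmbedding_spinOp hC
  let hj := M.isSliceEmbedding_focalPlus
  let _ := hs.chartedSpace
  let _ := hj.chartedSpace
  have hc : Continuous fun g : Spin (8 + 1) => g • M.base :=
    (M.contMDiff_of_orbit hC hj (f := fun g => g • M.base) fun g => rfl).continuous
  have h1 : Continuous M.orbitEquiv := Continuous.quotient_lift hc _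
  have h2 : IsOpenMap M.orbitEquiv := fun U hU => by
    have h3 : M.orbitEquiv '' U =
        (fun g : Spin (8 + 1) => g • M.base) '' (QuotientGroup.mk ⁻¹' U) := by
      change _ = (M.orbitEquiv ∘ QuotientGroup.mk) '' _
      rw [Set.image_comp, Set.image_preimage_eq _ QuotientGroup.mk_surjective]
    rw [h3]
    exact hopen _ (hU.preimage continuous_quot_mk)
  exact (Topology.IsOpenEmbedding.of_continuous_injective_isOpenMap h1 M.orbitEquiv.injective
    h2).isEmbedding

/-- The quotient gets its manifold structure from its embedding onto M₊, so the diffeomorphism is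
immediate. That this is the quotient structure is expressed by the projection being a submersion. -/
theorem isSliceEmbedding_quotient (hC : C.IsDefinite) : IsSliceEmbedding
    (EuclideanSpace ℝ (Fin 22)) (EuclideanSpace ℝ (Fin 10))
    (fun q => (M.orbitEquiv q : Space 16)) := by
  refine ⟨Topology.IsEmbedding.subtypeVal.comp (M.isEmbedding_orbitEquiv hC), fun q => ?_⟩
  have h1 : Set.range (fun q => (M.orbitEquiv q : Space 16)) =
      Set.range (Subtype.val : C.focalPlus → Space 16) :=
    M.orbitEquiv.surjective.range_comp _
  rw [h1]
  exact M.isSliceEmbedding_focalPlus.hasSliceAt (M.orbitEquiv q)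

theorem exists_diffeomorph (hC : C.IsDefinite) :
    letI := (M.isSliceEmbedding_quotient hC).chartedSpace
    letI := M.isSliceEmbedding_focalPlus.chartedSpace
    ∃ Φ : (Spin (8 + 1) ⧸ M.isotropyGroup) ≃ₘ^∞⟮𝓡 22, 𝓡 22⟯ C.focalPlus,
      ∀ (g : Spin (8 + 1)) (q : Spin (8 + 1) ⧸ M.isotropyGroup), Φ (g • q) = g • Φ q := by
  let hq := M.isSliceEmbedding_quotient hC
  let hj := M.isSliceEmbedding_focalPlus
  let _ := hq.chartedSpace
  let _ := hj.chartedSpace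
  have := hq.isManifold
  have := hj.isManifold
  obtain ⟨e⟩ := exists_prod_equiv_space
  refine ⟨{ toEquiv := M.orbitEquiv, contMDiff_toFun := ?_, contMDiff_invFun := ?_ },
    M.orbitEquiv_smul⟩
  · exact (hj.contMDiff_iff e _).2 (hq.contMDiff e)
  · refine (hq.contMDiff_iff e _).2 ?_
    have h : (fun q => (M.orbitEquiv q : Space 16)) ∘ M.orbitEquiv.symm = Subtype.val :=
      funext fun x => congrArg Subtype.val (M.orbitEquiv.apply_symm_apply x)
    change ContMDiff _ _ _ ((fun q => (M.orbitEquiv q : Space 16)) ∘ M.orbitEquiv.symm)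
    rw [h]
    exact hj.contMDiff e

end SpinorModel
end SymmetricCliffordSystem

/-! ### Tangent spaces and isotropy -/

theorem exists_linearEquiv_of_range_le {U V E : Type*} [AddCommGroup U] [Module ℝ U]
    [AddCommGroup V] [Module ℝ V] [AddCommGroup E] [Module ℝ E] [FiniteDimensional ℝ U]
    [FiniteDimensional ℝ V] (a : V →ₗ[ℝ] E) (b : U →ₗ[ℝ] E) (hb : Function.Injective b)
    (hd : Module.finrank ℝ V ≤ Module.finrank ℝ U) (h : LinearMap.range b ≤ LinearMap.range a) :
    ∃ L : V ≃ₗ[ℝ] U, ∀ v, a v = b (L v) := by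
  have h1 := a.finrank_range_add_finrank_ker
  have h2 := LinearMap.finrank_range_of_inj hb
  have h3 := Submodule.finrank_mono h
  have hker : LinearMap.ker a = ⊥ := Submodule.finrank_eq_zero.1 (by omega)
  have hr : LinearMap.range a = LinearMap.range b :=
    (Submodule.eq_of_le_of_finrank_le h (by omega)).symm
  refine ⟨(LinearEquiv.ofInjective a (LinearMap.ker_eq_bot.1 hker)).trans
    ((LinearEquiv.ofEq _ _ hr).trans (LinearEquiv.ofInjective b hb).symm), fun v => ?_⟩
  have h4 := (LinearEquiv.ofInjective b hb).apply_symm_apply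
    (LinearEquiv.ofEq _ _ hr (LinearEquiv.ofInjective a (LinearMap.ker_eq_bot.1 hker) v))
  exact (congrArg Subtype.val h4).symm

namespace SymmetricCliffordSystem
namespace SpinorModel

variable {C : SymmetricCliffordSystem 8 16} (M : C.SpinorModel)

theorem spinOp_tangentMap (k : M.isotropyGroup) (v : TangentModel) :
    C.spinOp k.1 (M.tangentMap v) = M.tangentMap (tangentAct (M.toG2 k) v) := by
  rw [tangentMap_apply, tangentMap_apply, spinOp_Ψ, spinRep_eq_toG2, spinRep_eq_toG2]
  simp only [map_neg, G2.map_conj]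
  rfl

/-- Identifies the tangent space at x = g · base with the tangent model moved by g. The map t ↦ g ·
`orbitParam t` into M₊ shows that the differential of the inclusion reaches all of it; equality
follows by dimension. -/
theorem exists_tangent_equiv {x : C.focalPlus} {g : Spin (8 + 1)} (hg : g • M.base = x) :
    letI := M.isSliceEmbedding_focalPlus.chartedSpace
    ∃ L : TangentSpace (𝓡 22) x ≃ₗ[ℝ] TangentModel, ∀ v,
      (mfderiv (𝓡 22) 𝓘(ℝ, Space 16) Subtype.val x : EuclideanSpace ℝ (Fin 22) →L[ℝ] Space 16) v =
        C.spinOp g (M.tangentMap (L v)) := by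
  let hj := M.isSliceEmbedding_focalPlus
  let _ := hj.chartedSpace
  have := hj.isManifold
  obtain ⟨e⟩ := exists_prod_equiv_space
  let D : EuclideanSpace ℝ (Fin 22) →L[ℝ] Space 16 :=
    mfderiv (𝓡 22) 𝓘(ℝ, Space 16) Subtype.val x
  let c : (IndexPairs 8 → ℝ) → C.focalPlus := fun t =>
    g • (⟨M.orbitParam t, M.orbitParam_mem t⟩ : C.focalPlus)
  have hc0 : c 0 = x := by
    rw [← hg]
    exact congrArg (g • ·) (Subtype.ext M.orbitParam_zero)
  have hcv : ∀ t, (c t : Space 16) = C.spinEquiv g (M.orbitParam t) := fun t => rfl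
  have hcm : ContMDiff 𝓘(ℝ, IndexPairs 8 → ℝ) (𝓡 22) ∞ c := by
    rw [hj.contMDiff_iff e]
    have h1 : Subtype.val ∘ c = fun t => C.spinEquiv g (M.orbitParam t) := funext hcv
    rw [h1]
    exact ((C.spinEquiv g).contDiff.comp M.contDiff_orbitParam).contMDiff
  obtain ⟨dσ, -, hdσ, -, hr, -⟩ := M.exists_tangent_data
  have hval : MDifferentiableAt (𝓡 22) 𝓘(ℝ, Space 16) (Subtype.val : C.focalPlus → Space 16)
      (c 0) := (hj.contMDiff e (c 0)).mdifferentiableAt (by simp)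
  have h1 := hval.hasMFDerivAt.comp 0 ((hcm 0).mdifferentiableAt (by simp)).hasMFDerivAt
  have h2 : HasFDerivAt (Subtype.val ∘ c)
      ((C.spinEquiv g : Space 16 →L[ℝ] Space 16).comp dσ) 0 :=
    (C.spinEquiv g : Space 16 →L[ℝ] Space 16).hasFDerivAt.comp 0 hdσ
  have h3 := hasMFDerivAt_unique h1 h2.hasMFDerivAt
  refine exists_linearEquiv_of_range_le (D : EuclideanSpace ℝ (Fin 22) →ₗ[ℝ] Space 16)
    ((C.spinEquiv g).toLinearEquiv.toLinearMap ∘ₗ M.tangentMap)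
    ((C.spinEquiv g).injective.comp M.tangentMap_injective)
    (by rw [finrank_tangentModel, finrank_euclideanSpace_fin]) ?_
  rintro _ ⟨v, rfl⟩
  have hv : M.tangentMap v ∈ dσ.range := by
    rw [hr]
    exact ⟨v, rfl⟩
  obtain ⟨t, ht⟩ := hv
  refine ⟨(mfderiv 𝓘(ℝ, IndexPairs 8 → ℝ) (𝓡 22) c 0 :
    (IndexPairs 8 → ℝ) →L[ℝ] EuclideanSpace ℝ (Fin 22)) t, ?_⟩
  let Dv : C.focalPlus → EuclideanSpace ℝ (Fin 22) →L[ℝ] Space 16 := fun y =>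
    mfderiv (𝓡 22) 𝓘(ℝ, Space 16) Subtype.val y
  have h4 : (mfderiv (𝓡 22) 𝓘(ℝ, Space 16) Subtype.val (c 0) :
      EuclideanSpace ℝ (Fin 22) →L[ℝ] Space 16) = D :=
    congrArg Dv hc0
  have h5 := congrArg (fun T : (IndexPairs 8 → ℝ) →L[ℝ] Space 16 => T t) h3
  change _ = C.spinEquiv g (M.tangentMap v)
  rw [← ht, ← h4]
  exact h5

theorem mfderiv_val_smul (h : Spin (8 + 1)) (x : C.focalPlus) :
    letI := M.isSliceEmbedding_focalPlus.chartedSpace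
    ∀ v, (mfderiv (𝓡 22) 𝓘(ℝ, Space 16) Subtype.val (h • x) :
        EuclideanSpace ℝ (Fin 22) →L[ℝ] Space 16)
      (mfderiv (𝓡 22) (𝓡 22) (fun y : C.focalPlus => h • y) x v) =
      C.spinOp h ((mfderiv (𝓡 22) 𝓘(ℝ, Space 16) Subtype.val x :
        EuclideanSpace ℝ (Fin 22) →L[ℝ] Space 16) v) := by
  let hj := M.isSliceEmbedding_focalPlus
  let _ := hj.chartedSpace
  have := hj.isManifold
  obtain ⟨e⟩ := exists_prod_equiv_space
  intro v
  have hval := hj.contMDiff e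
  have hv : ∀ x : C.focalPlus, HasMFDerivAt (𝓡 22) 𝓘(ℝ, Space 16) Subtype.val x
      (mfderiv (𝓡 22) 𝓘(ℝ, Space 16) Subtype.val x) := fun x =>
    ((hval x).mdifferentiableAt (by simp)).hasMFDerivAt
  have hsm : ContMDiff (𝓡 22) (𝓡 22) ∞ fun y : C.focalPlus => h • y := by
    rw [hj.contMDiff_iff e]
    exact (C.spinOp h).contDiff.contMDiff.comp hval
  have h1 := (hv (h • x)).comp x ((hsm x).mdifferentiableAt (by simp)).hasMFDerivAt
  have h2 := (C.spinOp h).hasFDerivAt.hasMFDerivAt.comp x (hv x)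
  have h3 := hasMFDerivAt_unique h1 h2
  exact congrArg (fun T : EuclideanSpace ℝ (Fin 22) →L[ℝ] Space 16 => T v) h3

theorem mfderiv_val_isotropyRep (x : C.focalPlus) (k : MulAction.stabilizer (Spin (8 + 1)) x) :
    letI := M.isSliceEmbedding_focalPlus.chartedSpace
    ∀ v, (mfderiv (𝓡 22) 𝓘(ℝ, Space 16) Subtype.val x :
        EuclideanSpace ℝ (Fin 22) →L[ℝ] Space 16) (isotropyRep (𝓡 22) (Spin (8 + 1)) x k v) =
      C.spinOp k ((mfderiv (𝓡 22) 𝓘(ℝ, Space 16) Subtype.val x :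
        EuclideanSpace ℝ (Fin 22) →L[ℝ] Space 16) v) := by
  let _ := M.isSliceEmbedding_focalPlus.chartedSpace
  intro v
  have h1 := M.mfderiv_val_smul k.1 x v
  let Dv : C.focalPlus → EuclideanSpace ℝ (Fin 22) →L[ℝ] Space 16 := fun y =>
    mfderiv (𝓡 22) 𝓘(ℝ, Space 16) Subtype.val y
  have h2 : (mfderiv (𝓡 22) 𝓘(ℝ, Space 16) Subtype.val ((k : Spin (8 + 1)) • x) :
      EuclideanSpace ℝ (Fin 22) →L[ℝ] Space 16) =
      (mfderiv (𝓡 22) 𝓘(ℝ, Space 16) Subtype.val x :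
        EuclideanSpace ℝ (Fin 22) →L[ℝ] Space 16) :=
    congrArg Dv k.2
  rw [h2] at h1
  -- The `cast` in `isotropyRep` is harmless, since all tangent spaces are definitionally the same
  -- model space.
  exact h1

/-- The stabilizer of g · base is the conjugate by g of the stabilizer of the base point. The
tangent identification also moves by g, so the two conjugations cancel and the G₂-action on the
model remains. -/
theorem exists_isotropy_model (x : C.focalPlus) :
    letI := M.isSliceEmbedding_focalPlus.chartedSpace
    ∃ L : TangentSpace (𝓡 22) x ≃ₗ[ℝ] TangentModel,
      (∀ k : MulAction.stabilizer (Spin (8 + 1)) x, ∃ α : G2, ∀ v,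
        L (isotropyRep (𝓡 22) (Spin (8 + 1)) x k v) = tangentAct α (L v)) ∧
      ∀ α : G2, ∃ k : MulAction.stabilizer (Spin (8 + 1)) x, ∀ v,
        L (isotropyRep (𝓡 22) (Spin (8 + 1)) x k v) = tangentAct α (L v) := by
  let _ := M.isSliceEmbedding_focalPlus.chartedSpace
  have := M.isPretransitive
  obtain ⟨g, hg⟩ := MulAction.exists_smul_eq (Spin (8 + 1)) M.base x
  obtain ⟨L, hL⟩ := M.exists_tangent_equiv hg
  have hinj : Function.Injective fun w => C.spinOp g (M.tangentMap w) :=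
    (C.spinEquiv g).injective.comp M.tangentMap_injective
  have key : ∀ (k : MulAction.stabilizer (Spin (8 + 1)) x) (k' : M.isotropyGroup),
      k.1 * g = g * k'.1 → ∀ v, L (isotropyRep (𝓡 22) (Spin (8 + 1)) x k v) =
        tangentAct (M.toG2 k') (L v) := fun k k' hk v => by
    refine hinj ?_
    have h1 : C.spinOp k.1 (C.spinOp g (M.tangentMap (L v))) =
        C.spinOp g (C.spinOp k'.1 (M.tangentMap (L v))) := by
      change (C.spinOp k.1 * C.spinOp g) _ = (C.spinOp g * C.spinOp k'.1) _
      rw [← spinOp_mul, ← spinOp_mul, hk]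
    change C.spinOp g (M.tangentMap _) = C.spinOp g (M.tangentMap _)
    rw [← spinOp_tangentMap, ← h1, ← hL, ← hL]
    exact M.mfderiv_val_isotropyRep x k v
  refine ⟨L, fun k => ?_, fun α => ?_⟩
  · have hk : g⁻¹ * k.1 * g ∈ M.isotropyGroup := by
      rw [isotropyGroup, MulAction.mem_stabilizer_iff, mul_smul, mul_smul, hg, k.2, ← hg,
        inv_smul_smul]
    exact ⟨M.toG2 ⟨_, hk⟩, key k ⟨_, hk⟩ (by group)⟩
  · obtain ⟨k', rfl⟩ := M.toG2_surjective α
    have hk : g * k'.1 * g⁻¹ ∈ MulAction.stabilizer (Spin (8 + 1)) x := by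
      rw [MulAction.mem_stabilizer_iff, mul_smul, mul_smul, ← hg, inv_smul_smul, k'.2]
    exact ⟨⟨_, hk⟩, key ⟨_, hk⟩ k' (inv_mul_cancel_right _ _)⟩

theorem not_exists_invariant_almostComplexStructure :
    letI := M.isSliceEmbedding_focalPlus.chartedSpace
    haveI := M.isSliceEmbedding_focalPlus.isManifold
    ¬ ∃ J : AlmostComplexStructure (𝓡 22) C.focalPlus,
      J.IsInvariant (𝓡 22) (Spin (8 + 1)) := by
  let _ := M.isSliceEmbedding_focalPlus.chartedSpace
  have := M.isSliceEmbedding_focalPlus.isManifold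
  rintro ⟨J, hJ⟩
  obtain ⟨L, -, hL⟩ := M.exists_isotropy_model M.base
  let J₀ : TangentSpace (𝓡 22) M.base →L[ℝ] TangentSpace (𝓡 22) M.base := J.J M.base
  have hcomm : ∀ (k : MulAction.stabilizer (Spin (8 + 1)) M.base) v,
      J₀ (isotropyRep (𝓡 22) (Spin (8 + 1)) M.base k v) =
        isotropyRep (𝓡 22) (Spin (8 + 1)) M.base k (J₀ v) := fun k v => by
    have h1 := hJ k.1 M.base v
    let Jy : C.focalPlus → EuclideanSpace ℝ (Fin 22) →L[ℝ] EuclideanSpace ℝ (Fin 22) :=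
      fun y => J.J y
    have h2 : (J.J ((k : Spin (8 + 1)) • M.base) :
        EuclideanSpace ℝ (Fin 22) →L[ℝ] EuclideanSpace ℝ (Fin 22)) = J.J M.base :=
      congrArg Jy k.2
    exact (congrArg (fun T : EuclideanSpace ℝ (Fin 22) →L[ℝ] EuclideanSpace ℝ (Fin 22) =>
      T (isotropyRep (𝓡 22) (Spin (8 + 1)) M.base k v)) h2).symm.trans h1
  refine not_exists_equivariant_complex_structure
    (L.toLinearMap ∘ₗ (J₀ : TangentSpace (𝓡 22) M.base →ₗ[ℝ] TangentSpace (𝓡 22) M.base) ∘ₗ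
      L.symm.toLinearMap) (fun α w => ?_) fun w => ?_
  · obtain ⟨k, hk⟩ := hL α
    change L (J₀ (L.symm (tangentAct α w))) = tangentAct α (L (J₀ (L.symm w)))
    have h1 : L.symm (tangentAct α w) =
        isotropyRep (𝓡 22) (Spin (8 + 1)) M.base k (L.symm w) := by
      rw [LinearEquiv.symm_apply_eq, hk, L.apply_symm_apply]
    rw [h1, hcomm, hk]
  · change L (J₀ (L.symm (L (J₀ (L.symm w))))) = -w
    have h1 : J₀ (J₀ (L.symm w)) = -L.symm w := J.sq M.base (L.symm w)
    rw [L.symm_apply_apply, h1, map_neg, L.apply_symm_apply]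

end SpinorModel
end SymmetricCliffordSystem

end

/-! ### The main theorem -/

theorem proposition2 (C : SymmetricCliffordSystem 8 16) (hC : C.IsDefinite) :
    -- `Spin(9)` is a Lie group and `M₊` a smooth submanifold of `ℝ³²`
    ∃ (_ : ChartedSpace (EuclideanSpace ℝ (Fin 36)) (Spin 9))
      (_ : LieGroup (𝓡 36) ∞ (Spin 9))
      (_ : ChartedSpace (EuclideanSpace ℝ (Fin 22)) C.focalPlus)
      (_ : IsManifold (𝓡 22) ∞ C.focalPlus),
      Manifold.IsSmoothEmbedding (𝓡 22) 𝓘(ℝ, EuclideanSpace ℝ (Fin (2 * 16))) ∞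
        (Subtype.val : C.focalPlus → EuclideanSpace ℝ (Fin (2 * 16))) ∧
      -- the action of `Spin(9)` on `M₊` is smooth and transitive
      ContMDiffSMul (𝓡 36) (𝓡 22) ∞ (Spin 9) C.focalPlus ∧
      MulAction.IsPretransitive (Spin 9) C.focalPlus ∧
      -- `M₊` is (equivariantly) diffeomorphic to the quotient manifold `Spin(9)/G₂`
      (∃ (H : Subgroup (Spin 9))
        (_ : ChartedSpace (EuclideanSpace ℝ (Fin 22)) (Spin 9 ⧸ H)),
        Nonempty (H ≃ₜ* G2) ∧
        IsManifold (𝓡 22) ∞ (Spin 9 ⧸ H) ∧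
        Manifold.IsSubmersion (𝓡 36) (𝓡 22) ∞ (QuotientGroup.mk : Spin 9 → Spin 9 ⧸ H) ∧
        ∃ Φ : (Spin 9 ⧸ H) ≃ₘ^∞⟮𝓡 22, 𝓡 22⟯ C.focalPlus,
          ∀ (g : Spin 9) (q : Spin 9 ⧸ H), Φ (g • q) = g • Φ q) ∧
      -- the isotropy representation is the sum of a trivial line and three irreducible
      -- `7`-dimensional pieces
      (∀ x : C.focalPlus, ∃ W : Fin 4 → Submodule ℝ (TangentSpace (𝓡 22) x),
        DirectSum.IsInternal W ∧
        Module.finrank ℝ (W 0) = 1 ∧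
        (∀ (g : MulAction.stabilizer (Spin 9) x), ∀ v ∈ W 0,
          isotropyRep (𝓡 22) (Spin 9) x g v = v) ∧
        ∀ i : Fin 4, i ≠ 0 → Module.finrank ℝ (W i) = 7 ∧
          IsIsotropyIrreducible (𝓡 22) (Spin 9) x (W i)) ∧
      -- no invariant almost complex structure
      ¬ ∃ J : AlmostComplexStructure (𝓡 22) C.focalPlus, J.IsInvariant (𝓡 22) (Spin 9) := by
  obtain ⟨M⟩ := SymmetricCliffordSystem.exists_spinorModel hC
  let hs := SymmetricCliffordSystem.isSliceEmbedding_spinOp hC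
  let hj := M.isSliceEmbedding_focalPlus
  let hq := M.isSliceEmbedding_quotient hC
  obtain ⟨e⟩ := SymmetricCliffordSystem.exists_prod_equiv_operators
  obtain ⟨e'⟩ := SymmetricCliffordSystem.exists_prod_equiv_space
  refine ⟨hs.chartedSpace, SymmetricCliffordSystem.lieGroup_spin hC, hj.chartedSpace,
    hj.isManifold, hj.isSmoothEmbedding e', ?_, M.isPretransitive, ?_, fun x => ?_,
    M.not_exists_invariant_almostComplexStructure⟩
  · let _ := hs.chartedSpace
    let _ := hj.chartedSpace
    exact ⟨hs.contMDiff_smul e hj e' fun _ _ => rfl⟩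
  · exact ⟨M.isotropyGroup, hq.chartedSpace, ⟨M.isotropyEquivG2 hC⟩, hq.isManifold,
      M.isSubmersion_of_orbit hC hq fun _ => rfl, M.exists_diffeomorph hC⟩
  · let _ := hj.chartedSpace
    obtain ⟨L, h1, h2⟩ := M.exists_isotropy_model x
    exact SymmetricCliffordSystem.SpinorModel.exists_isotropy_decomposition L h1 h2
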